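/- Let $F$ be the distribution function of a positive random variable ($F(0)=0$) with $F\in D(G_{-\gamma})$, $\gamma>0$, where $G_{g}(x)=\exp(-(1+gx)^{-1/g})$ is the generalized extreme value law. Put $G(x)=F(e^x)$, $y_0=\sup\{x:G(x)<1\}$, $V(u)=y_0-G^{-1}(1-u)$. Let $U_1,U_2,\dots$ be i.i.d. uniform on $(0,1)$ with order statistics $U_{1,n}\le\dots\le U_{n,n}$, and let $X_i=F^{-1}(1-U_i)$, with order statistics $X_{1,n}\le\dots\le X_{n,n}$. Let $k=k(n)\ge 1$ (for all large $n$) be integers with $k/n\to0$, and let $f$ be positive and bounded on $\{1,2,\dots\}$. Set $$T_n(f)=\sum_{j=1}^{k}f(j)\,(\log X_{n-j+1,n}-\log X_{n-j,n}),\qquad s_n=y_0-\log X_{n-k+1,n},$$ $$E_j=j\log\frac{U_{j+1,n}}{U_{j,n}},\quad F_j=\frac{\gamma E_j}{j},\quad F_j^*=\exp\Big(-\sum_{h=j}^{k-1}F_h\Big)\ (\text{so }F_k^*=1),\quad Z_n=\sum_{j=1}^{k}f(j)F_j^*\,(e^{F_j}-1).$$ **(0)** For each $n$, the variables $E_1,\dots,E_{n-1}$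 are independent standard exponential. Moreover $y_0<\infty$, and there are a constant $c>0$ and measurable functions $p,b$ with $p(u)\to0$, $b(u)\to 0$ as $u\downarrow0$ such that $b(t)/t$ is integrable on $[u,1]$ and $$V(u)=c\,(1+p(u))\,u^{\gamma}\exp\Big(\int_u^1\frac{b(t)}{t}\,dt\Big)\qquad\text{for every }u\in(0,1).$$ For every such representation $(c,p,b)$, put $p_n=\sup_{0<u\le U_{k+1,n}}|p(u)|$, $b_n=\sup_{0<u\le U_{k+1,n}}|b(u)|$ and $c_n=\max(p_n,\,b_n\log(k+1))$. Then $p_n\to_P 0$, $b_n\to_P 0$, and the following hold. **(1) Representation approach.** If $c_n=O_P(1)$, then $$\frac{T_n(f)}{s_n}=Z_n+O_P\Big(c_n\sum_{j=1}^kf(j)F_j^*(e^{F_j}-1)+p_n\sum_{j=1}^kf(j)F_j^*e^{F_j}\Big).$$ If $c_n\to_P0$ and $k\,p_n\to_P0$, then $T_n(f)/s_n-Z_n\to_P0$. **(2) Second order approach.** Let $S$ be a function of constant nonzero sign near $0$ and $h$ a function on $(0,\infty)$ satisfying the continuous second order condition: for all $u_n\downarrow0$ and $x_n\to x>0$, with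 $s(u)=\gamma V(u)$, $$S(u_n)^{-1}\Big\{\frac{G^{-1}(1-x_nu_n)-G^{-1}(1-u_n)}{s(u_n)}-\frac{x_n^{\gamma}-1}{-\gamma}\Big\}\to h(x).$$ If $c_n=O_P(1)$, then there are nonnegative $\eta_n\to_P0$ such that $$\frac{T_n(f)}{s_n}=Z_n-\gamma\sum_{j=1}^kf(j)F_j^*S(U_{j,n})\,h(e^{E_j/j})+O_P\Big(c_nZ_n+(c_n+\eta_n)\sum_{j=1}^kf(j)F_j^*|S(U_{j,n})|\Big).$$ If $c_n\to_P0$ and $\sum_{j=1}^k|S(U_{j,n})|\to_P0$, then $T_n(f)/s_n-Z_n\to_P0$. Here $R_n=O_P(w_n)$, for $w_n\ge0$, means: for every $\varepsilon>0$ there is $M$ with $P(|R_n|>Mw_n)\le\varepsilon$ for all large $n$. -/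

import Mathlib

open MeasureTheory ProbabilityTheory Filter Topology Set

noncomputable section

namespace Hill

/-! ### Distribution functions, quantiles and domains of attraction -/

/-- The generalized inverse `L⁻¹(v) = inf {x : v ≤ L x}`. -/
def quantile (L : ℝ → ℝ) (v : ℝ) : ℝ := sInf {x | v ≤ L x}

/-- The upper endpoint `sup {x : L x < 1}`. -/
def upperEndpoint (L : ℝ → ℝ) : ℝ := sSup {x | L x < 1}

/-- The distribution function `G x = F (exp x)`. -/
def logDF (F : ℝ → ℝ) (x : ℝ) : ℝ := F (Real.exp x)

/-- The generalized extreme value distribution function with index `g`: it equals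
`exp (-(1 + g x)^(-1/g))` where `1 + g x > 0`; elsewhere it is `0` (if `g > 0`) or `1` (if `g < 0`);
for `g = 0` it is the Gumbel distribution function. -/
def gev (g x : ℝ) : ℝ :=
  if g = 0 then Real.exp (-Real.exp (-x))
  else if 0 < 1 + g * x then Real.exp (-(1 + g * x) ^ (-1 / g))
  else if 0 < g then 0 else 1

/-- `F ∈ D(G_g)`: the law of the suitably normalized maximum of `n` independent variables with
distribution function `F` converges to the generalized extreme value law with index `g`. -/
def InMaxDomain (F : ℝ → ℝ) (g : ℝ) : Prop :=
  ∃ a b : ℕ → ℝ, (∀ n, 0 < a n) ∧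
    ∀ x, Tendsto (fun n : ℕ => F (a n * x + b n) ^ n) atTop (𝓝 (gev g x))

/-- `V(u) = y₀(G) - G⁻¹(1 - u)`. -/
def tailGap (G : ℝ → ℝ) (u : ℝ) : ℝ := upperEndpoint G - quantile G (1 - u)

/-- `(c, p, b)` is a Karamata representation of `G` at its finite upper endpoint, with index `-γ`:
`y₀ - G⁻¹(1 - u) = c (1 + p u) u^γ exp (∫_u^1 b t / t dt)` for `0 < u < 1`,
where `p u → 0` and `b u → 0` as `u ↓ 0`. -/
structure IsKaramataRep (G : ℝ → ℝ) (γ c : ℝ) (p b : ℝ → ℝ) : Prop where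
  c_pos : 0 < c
  measurable_p : Measurable p
  measurable_b : Measurable b
  tendsto_p : Tendsto p (𝓝[>] 0) (𝓝 0)
  tendsto_b : Tendsto b (𝓝[>] 0) (𝓝 0)
  integrable : ∀ u ∈ Ioo (0 : ℝ) 1, IntervalIntegrable (fun t => b t / t) volume u 1
  eq : ∀ u ∈ Ioo (0 : ℝ) 1,
    tailGap G u = c * (1 + p u) * u ^ γ * Real.exp (∫ t in u..1, b t / t)

/-- The continuous second order condition for `G` with extreme value index `-γ`, first order
auxiliary function `s u = γ (y₀ - G⁻¹(1 - u))`, second order auxiliary function `S` (of constant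
sign near `0`) and limit `h`: whenever `u ↓ 0` and `y → x > 0`, the quotient
`S(u)⁻¹ {(G⁻¹(1 - y u) - G⁻¹(1 - u)) / s(u) - (y^γ - 1) / (-γ)}` tends to `h x`. -/
def IsContSOC (G : ℝ → ℝ) (γ : ℝ) (S h : ℝ → ℝ) : Prop :=
  ((∀ᶠ u in 𝓝[>] (0 : ℝ), 0 < S u) ∨ (∀ᶠ u in 𝓝[>] (0 : ℝ), S u < 0)) ∧
  ∀ x : ℝ, 0 < x →
    Tendsto (fun w : ℝ × ℝ =>
        (S w.1)⁻¹ * ((quantile G (1 - w.2 * w.1) - quantile G (1 - w.1)) / (γ * tailGap G w.1)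
          - (w.2 ^ γ - 1) / (-γ)))
      (𝓝[>] (0 : ℝ) ×ˢ 𝓝 x) (𝓝 (h x))

/-! ### Stochastic order symbols -/

/-- `Z_n = O_P(w_n)` for nonnegative weights `w_n`. -/
def IsBigOP {Ω : Type*} [MeasurableSpace Ω] (P : Measure Ω) (Z w : ℕ → Ω → ℝ) : Prop :=
  ∀ ε : ℝ, 0 < ε → ∃ M : ℝ, ∀ᶠ n in atTop,
    P {ω | M * w n ω < |Z n ω|} ≤ ENNReal.ofReal ε

/-- `Z_n → 0` in probability. -/
def IsLittleOP {Ω : Type*} [MeasurableSpace Ω] (P : Measure Ω) (Z : ℕ → Ω → ℝ) : Prop :=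
  TendstoInMeasure P Z atTop (fun _ => 0)

/-! ### Order statistics and the functional Hill process -/

/-- The `j`-th smallest (`1 ≤ j ≤ n`) of the first `n` terms of `x`. -/
def orderStat (x : ℕ → ℝ) (n j : ℕ) : ℝ :=
  (((Multiset.range n).map x).sort (· ≤ ·)).getD (j - 1) 0

section HillStat

variable {Ω : Type*}

/-- The order statistic `U_{j,n}`. -/
def ordU (U : ℕ → Ω → ℝ) (n j : ℕ) (ω : Ω) : ℝ := orderStat (fun i => U i ω) n j

/-- The order statistic `X_{j,n}` of the sample `X_i = F⁻¹(1 - U_i)`. -/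
def ordX (F : ℝ → ℝ) (U : ℕ → Ω → ℝ) (n j : ℕ) (ω : Ω) : ℝ :=
  orderStat (fun i => quantile F (1 - U i ω)) n j

/-- The functional Hill process
`T_n(f) = ∑_{j=1}^k f j (log X_{n-j+1,n} - log X_{n-j,n})`. -/
def hillT (F : ℝ → ℝ) (U : ℕ → Ω → ℝ) (f : ℕ → ℝ) (k n : ℕ) (ω : Ω) : ℝ :=
  ∑ j ∈ Finset.Icc 1 k,
    f j * (Real.log (ordX F U n (n - j + 1) ω) - Real.log (ordX F U n (n - j) ω))

/-- The normalization `s_n = y₀(G) - log X_{n-k+1,n}`. -/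
def hillS (F : ℝ → ℝ) (U : ℕ → Ω → ℝ) (k n : ℕ) (ω : Ω) : ℝ :=
  upperEndpoint (logDF F) - Real.log (ordX F U n (n - k + 1) ω)

/-- `E_j = j log (U_{j+1,n} / U_{j,n})`. -/
def malmquistE (U : ℕ → Ω → ℝ) (n j : ℕ) (ω : Ω) : ℝ :=
  j * Real.log (ordU U n (j + 1) ω / ordU U n j ω)

/-- `F_j = γ E_j / j`. -/
def fExp (γ : ℝ) (U : ℕ → Ω → ℝ) (n j : ℕ) (ω : Ω) : ℝ := γ * malmquistE U n j ω / j

/-- `F_j^* = exp (-∑_{h=j}^{k-1} F_h)`. -/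
def fStar (γ : ℝ) (U : ℕ → Ω → ℝ) (k n j : ℕ) (ω : Ω) : ℝ :=
  Real.exp (-∑ h ∈ Finset.Ico j k, fExp γ U n h ω)

/-- `∑_{j=1}^k f j F_j^* (exp F_j - 1)`. -/
def mainSum (γ : ℝ) (U : ℕ → Ω → ℝ) (f : ℕ → ℝ) (k n : ℕ) (ω : Ω) : ℝ :=
  ∑ j ∈ Finset.Icc 1 k, f j * fStar γ U k n j ω * (Real.exp (fExp γ U n j ω) - 1)

/-- `sup {|q u| : 0 < u ≤ U_{k+1,n}}`; for `q = p` and `q = b` these are `p_n` and `b_n`. -/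
def supAbs (q : ℝ → ℝ) (U : ℕ → Ω → ℝ) (k n : ℕ) (ω : Ω) : ℝ :=
  sSup ((fun u => |q u|) '' Ioc 0 (ordU U n (k + 1) ω))

/-- `c_n = max (p_n, b_n log (k + 1))`. -/
def errC (p b : ℝ → ℝ) (U : ℕ → Ω → ℝ) (k n : ℕ) (ω : Ω) : ℝ :=
  max (supAbs p U k n ω) (supAbs b U k n ω * Real.log (k + 1))

end HillStat

end Hill

end

/-!
The Hill process is a function of the uniform order statistics `u_j = U_{j,n}`: since `log
X_{n-j+1,n} = y₀ - V(u_j)`, one has `T_n(f) / s_n = ∑ f j (V(u_{j+1}) - V(u_j)) / V(u_k)`, whereas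
`F_j^* = (u_j / u_k)^γ` and `exp F_j = (u_{j+1} / u_j)^γ`. So `Z_n` is what `T_n(f) / s_n` becomes
when `V` is replaced by a pure power, and the theorem measures the effect of this replacement.

*Law of the spacings* (`map_malmquistE`). On the simplex `0 < u_1 < … < u_n < 1` the substitutions
`u_j = u_{j+1} exp (-t_j / j)`, made from the innermost variable outwards, turn Lebesgue measure
into a product of exponential densities (`lintegral_spacingWeight`); the `n!` orderings of the
sample have equal probabilities, which add up to one, so ties need no separate treatment.

*Representation of `V`.* The domain of attraction condition is inverted to a limit for the affinely
normalized tail quantiles (`tendsto_tailQuantile`). The dyadic increments of the tail quantile then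
decrease geometrically with ratio `2^(-γ)`, so the endpoint is finite and the gap to it is
regularly varying (`tendsto_gap_ratio`); the logarithm, being differentiable at the endpoint,
preserves this (`tailGap_of_inMaxDomain`). Taking the logarithmic average of a slowly varying
function over `[u / e, u]` yields the Karamata representation (`exists_isKaramataRep`).

*Pathwise bounds.* In the representation, `V(u_j) / V(u_k)` is `F_j^*` times `(1 + p(u_j)) / (1 +
p(u_k))` times the exponential of `∫ b t / t` from `u_j` to `u_k`; in absolute
value that integral is at most `b_n log (u_{k+1} / u_1)`. From `u_j` to `u_{j+1}` it is at most
`(b_n / γ) F_j`, which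
convexity of the exponential compares with `exp F_j - 1`. This gives `GoodSample.abs_hill_sub_le`,
and, with the second order condition describing `V(u_{j+1}) / V(u_j)`,
`GoodSample.abs_hill_sub_soc_le`.

*Stochastic control.* `U_{k+1,n} → 0` in probability by the law of large numbers; `log (u_{k+1} /
u_1) = ∑ E_j / j` has mean `1 + 1/2 + … + 1/k`, so it is `O_P(log (k + 1))`; and `max_j E_j / j =
O_P(1)` because the tails `exp (-j K)` are summable. The last fact confines all ratios `u_{j+1} /
u_j` to one compact set, on which the continuous second order condition holds uniformly
(`IsContSOC.uniform`). Finally `Z_n` is at most `sup f` times a telescoping sum, hence `O_P(1)`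
(`mainSum_le`), and the second error sum is `O_P(k)` (`sum_fStar_exp_le`).
-/

namespace Hill

/-! ### Order statistics of a real sequence -/

/-- A permutation that sorts the first `n` terms computes the order statistics; the argument `j` is
zero-based, whereas `orderStat` counts from one. -/
lemma orderStat_eq_of_monotone {x : ℕ → ℝ} {n : ℕ} (σ : Equiv.Perm (Fin n))
    (hσ : Monotone fun i : Fin n => x (σ i)) (j : Fin n) :
    orderStat x n (j + 1) = x (σ j) := by
  have key : ((Multiset.range n).map x).sort (· ≤ ·) = List.ofFn fun i : Fin n => x (σ i) := by
    refine List.Perm.eq_of_pairwise (le := (· ≤ ·)) (fun a b _ _ h1 h2 => le_antisymm h1 h2)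
      (Multiset.pairwise_sort _ _) (List.pairwise_ofFn.2 fun i j h => hσ h.le) ?_
    rw [← Multiset.coe_eq_coe, Multiset.sort_eq]
    have h1 : (List.ofFn fun i : Fin n => x (σ i)).Perm (List.ofFn fun i : Fin n => x i) :=
      Equiv.Perm.ofFn_comp_perm σ (fun i : Fin n => x i)
    rw [Multiset.coe_eq_coe.2 h1, Multiset.range, Multiset.map_coe, Multiset.coe_eq_coe,
      List.ofFn_eq_map, ← List.map_coe_finRange_eq_range, List.map_map]
    rfl
  simp [orderStat, key]

/-- The first `n` terms of any sequence are sorted by some permutation. -/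
lemma exists_orderStat_eq (x : ℕ → ℝ) (n : ℕ) : ∃ σ : Equiv.Perm (Fin n),
    Monotone (fun i : Fin n => x (σ i)) ∧ ∀ j : Fin n, orderStat x n (j + 1) = x (σ j) := by
  refine ⟨Tuple.sort fun i : Fin n => x i, Tuple.monotone_sort fun i : Fin n => x i, fun j => ?_⟩
  exact orderStat_eq_of_monotone _ (Tuple.monotone_sort fun i : Fin n => x i) j

lemma orderStat_mem (x : ℕ → ℝ) {n j : ℕ} (hj : 1 ≤ j) (hjn : j ≤ n) :
    ∃ i, i < n ∧ orderStat x n j = x i := by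
  obtain ⟨σ, -, h⟩ := exists_orderStat_eq x n
  have := h ⟨j - 1, by omega⟩
  rw [show j - 1 + 1 = j by omega] at this
  exact ⟨_, (σ _).2, this⟩

lemma orderStat_mono (x : ℕ → ℝ) {n i j : ℕ} (hi : 1 ≤ i) (hij : i ≤ j) (hjn : j ≤ n) :
    orderStat x n i ≤ orderStat x n j := by
  obtain ⟨σ, hm, h⟩ := exists_orderStat_eq x n
  have h1 := h ⟨i - 1, by omega⟩
  have h2 := h ⟨j - 1, by omega⟩
  simp only [show i - 1 + 1 = i by omega, show j - 1 + 1 = j by omega] at h1 h2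
  rw [h1, h2]
  exact hm (by simp; omega)

/-- An antitone map reverses the order statistics. -/
lemma orderStat_antitone {x : ℕ → ℝ} {s : Set ℝ} (hx : ∀ i, x i ∈ s) {g : ℝ → ℝ}
    (hg : AntitoneOn g s) {n j : ℕ} (hj : 1 ≤ j) (hjn : j ≤ n) :
    orderStat (fun i => g (x i)) n (n - j + 1) = g (orderStat x n j) := by
  obtain ⟨σ, hm, h⟩ := exists_orderStat_eq x n
  have h1 := h ⟨j - 1, by omega⟩
  simp only [show j - 1 + 1 = j by omega] at h1
  have h2 := orderStat_eq_of_monotone (x := fun i => g (x i)) (Fin.revPerm.trans σ)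
    (fun a b hab => hg (hx _) (hx _) (hm (Fin.rev_le_rev.2 hab))) ⟨n - j, by omega⟩
  simp only at h2
  have hrev : Fin.rev (⟨n - j, by omega⟩ : Fin n) = ⟨j - 1, by omega⟩ := by
    ext
    simp only [Fin.val_rev]
    omega
  rw [h2, h1, Equiv.trans_apply, Fin.revPerm_apply, hrev]

/-- If at least `j` of the first `n` terms are at most `t`, so is the `j`-th smallest of them. -/
lemma orderStat_le_of_le_card {x : ℕ → ℝ} {n j : ℕ} {t : ℝ} (hj : 1 ≤ j) (hjn : j ≤ n)
    (hc : j ≤ ((Finset.range n).filter fun i => x i ≤ t).card) : orderStat x n j ≤ t := by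
  obtain ⟨σ, hm, h⟩ := exists_orderStat_eq x n
  have h1 := h ⟨j - 1, by omega⟩
  simp only [show j - 1 + 1 = j by omega] at h1
  by_contra hlt
  rw [h1, not_le] at hlt
  have hle : ((Finset.range n).filter fun i => x i ≤ t).card ≤ (Finset.range (j - 1)).card := by
    refine Finset.card_le_card_of_surjOn
      (fun i => if hi : i < n then ((σ ⟨i, hi⟩ : Fin n) : ℕ) else 0) ?_
    intro i hi
    simp only [Finset.coe_filter, Finset.mem_range, Set.mem_ofPred_eq] at hi
    refine ⟨σ.symm ⟨i, hi.1⟩, ?_, by simp⟩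
    simp only [Finset.coe_range, Set.mem_Iio]
    by_contra hge
    have := hm (show (⟨j - 1, by omega⟩ : Fin n) ≤ σ.symm ⟨i, hi.1⟩ by
      rw [Fin.le_def]; simpa using hge)
    simp only [Equiv.apply_symm_apply] at this
    linarith [hi.2]
  rw [Finset.card_range] at hle
  omega

/-! ### The law of the normalized logarithmic spacings -/

/-- The transition weight from `y` to `x`: for `y < x` it is `g ((m + 1) log (x / y))`, and
otherwise it vanishes. -/
noncomputable def spacingKernel (g : ℝ → ENNReal) (m : ℕ) (y x : ℝ) : ENNReal :=
  if y < x then g ((m + 1) * Real.log (x / y)) else 0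

/-- The product of the transition weights along the vector `u`, restricted to `0 < u 0`. It is
supported on the increasing positive vectors. -/
noncomputable def spacingWeight (g : ℕ → ℝ → ENNReal) (m : ℕ) (u : Fin (m + 1) → ℝ) : ENNReal :=
  (if 0 < u 0 then 1 else 0) * ∏ j : Fin m, spacingKernel (g j) j (u j.castSucc) (u j.succ)

lemma measurable_spacingKernel {g : ℝ → ENNReal} (hg : Measurable g) (m : ℕ) :
    Measurable fun z : ℝ × ℝ => spacingKernel g m z.1 z.2 := by
  unfold spacingKernel
  refine Measurable.ite (measurableSet_lt measurable_fst measurable_snd) ?_ measurable_const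
  exact hg.comp (by fun_prop)

lemma measurable_spacingWeight {g : ℕ → ℝ → ENNReal} (hg : ∀ j, Measurable (g j)) (m : ℕ) :
    Measurable (spacingWeight g m) := by
  unfold spacingWeight
  refine Measurable.mul ?_ (Finset.measurable_prod _ fun j _ => ?_)
  · exact Measurable.ite (measurableSet_lt measurable_const (measurable_pi_apply 0))
      measurable_const measurable_const
  · have hj : Measurable fun u : Fin (m + 1) → ℝ => (u j.castSucc, u j.succ) := by fun_prop
    exact (measurable_spacingKernel (hg j) j).comp hj

lemma spacingWeight_snoc (g : ℕ → ℝ → ENNReal) (m : ℕ) (v : Fin (m + 1) → ℝ) (x : ℝ) :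
    spacingWeight g (m + 1) (Fin.snoc v x) =
      spacingWeight g m v * spacingKernel (g m) m (v (Fin.last m)) x := by
  have h0 : (Fin.snoc v x : Fin (m + 2) → ℝ) 0 = v 0 := by
    rw [← Fin.castSucc_zero, Fin.snoc_castSucc]
  unfold spacingWeight
  rw [Fin.prod_univ_castSucc, h0, mul_assoc]
  congr 2
  · refine Finset.prod_congr rfl fun j _ => ?_
    rw [Fin.succ_castSucc, Fin.snoc_castSucc, Fin.snoc_castSucc]
    simp
  · rw [Fin.snoc_castSucc, Fin.succ_last, Fin.snoc_last]
    simp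

lemma lintegral_expMeasure {g : ℝ → ENNReal} (hg : Measurable g) :
    ∫⁻ t, g t ∂(expMeasure 1) = ∫⁻ t in Ioi (0 : ℝ), ENNReal.ofReal (Real.exp (-t)) * g t := by
  have hd : Measurable (gammaPDF 1 1) := (measurable_gammaPDFReal 1 1).ennreal_ofReal
  rw [expMeasure, gammaMeasure, lintegral_withDensity_eq_lintegral_mul _ hd hg,
    ← setLIntegral_eq_of_support_subset (s := Ici (0 : ℝ)),
    setLIntegral_congr Ioi_ae_eq_Ici.symm]
  · refine setLIntegral_congr_fun measurableSet_Ioi fun t ht => ?_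
    have ht : 0 < t := ht
    simp only [Pi.mul_apply]
    rw [show gammaPDF 1 1 t = exponentialPDF 1 t from rfl, exponentialPDF_of_nonneg ht.le]
    simp
  · intro t ht
    by_contra h
    have : gammaPDF 1 1 t = 0 := gammaPDF_of_neg (by simpa using h)
    simp [this] at ht

/-- The substitution `y = x exp (-t / (m + 1))` turns `y ^ m dy` on `(0, x)` into the exponential
density. -/
lemma lintegral_spacingKernel {g : ℝ → ENNReal} (hg : Measurable g) (m : ℕ) {x : ℝ} (hx : 0 < x) :
    ∫⁻ y in Ioi (0 : ℝ), ENNReal.ofReal (y ^ m / m.factorial) * spacingKernel g m y x =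
      ENNReal.ofReal (x ^ (m + 1) / (m + 1).factorial) * ∫⁻ t, g t ∂(expMeasure 1) := by
  have hm : (0 : ℝ) < m + 1 := by positivity
  set φ : ℝ → ℝ := fun t => x * Real.exp (-t / (m + 1)) with hφ
  have himg : φ '' Ioi 0 = Ioo 0 x := by
    ext y
    constructor
    · rintro ⟨t, ht, rfl⟩
      have ht : 0 < t := ht
      refine ⟨by positivity, ?_⟩
      have : Real.exp (-t / (m + 1)) < 1 := by
        rw [Real.exp_lt_one_iff]
        exact div_neg_of_neg_of_pos (by linarith) hm
      simp only [hφ]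
      nlinarith
    · rintro ⟨h0, h1⟩
      refine ⟨-((m + 1) * Real.log (y / x)), ?_, ?_⟩
      · have : Real.log (y / x) < 0 := Real.log_neg (by positivity) (by rwa [div_lt_one hx])
        simp only [mem_Ioi]
        nlinarith
      · simp only [hφ, neg_neg]
        rw [mul_div_cancel_left₀ _ hm.ne', Real.exp_log (by positivity)]
        field_simp
  have hder : ∀ t ∈ Ioi (0 : ℝ),
      HasDerivWithinAt φ (x * (Real.exp (-t / (m + 1)) * (-1 / (m + 1)))) (Ioi 0) t := by
    intro t _
    exact (((((hasDerivAt_id t).neg).div_const _).exp).const_mul x).hasDerivWithinAt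
  have hinj : InjOn φ (Ioi 0) := by
    intro s _ t _ h
    simp only [hφ] at h
    have := Real.exp_injective (mul_left_cancel₀ hx.ne' h)
    field_simp at this
    linarith
  have h1 : ∫⁻ y in Ioi (0 : ℝ), ENNReal.ofReal (y ^ m / m.factorial) * spacingKernel g m y x =
      ∫⁻ y in Ioo 0 x, ENNReal.ofReal (y ^ m / m.factorial) *
        g ((m + 1) * Real.log (x / y)) := by
    rw [← lintegral_indicator measurableSet_Ioi, ← lintegral_indicator measurableSet_Ioo]
    refine lintegral_congr fun y => ?_
    by_cases h0 : 0 < y <;> by_cases h2 : y < x <;>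
      simp [indicator, spacingKernel, h0, h2]
  rw [h1, ← himg, lintegral_image_eq_lintegral_abs_deriv_mul measurableSet_Ioi hder hinj,
    lintegral_expMeasure hg, ← lintegral_const_mul _ (by fun_prop)]
  refine setLIntegral_congr_fun measurableSet_Ioi fun t ht => ?_
  · have ht : 0 < t := ht
    simp only [hφ]
    rw [← mul_assoc, ← mul_assoc (ENNReal.ofReal (x ^ (m + 1) / (m + 1).factorial))]
    congr 1
    · rw [← ENNReal.ofReal_mul (by positivity), ← ENNReal.ofReal_mul (by positivity)]
      congr 1
      rw [abs_mul, abs_mul, abs_of_pos hx, abs_of_pos (Real.exp_pos _), abs_div, abs_neg, abs_one,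
        abs_of_pos hm, mul_pow, ← Real.exp_nat_mul, Nat.factorial_succ, pow_succ]
      have : Real.exp (-t) = Real.exp (-t / (m + 1)) * Real.exp (m * (-t / (m + 1))) := by
        rw [← Real.exp_add]
        congr 1
        field_simp
        ring
      rw [this]
      push_cast
      field_simp
    · congr 1
      rw [show x / (x * Real.exp (-t / (m + 1))) = Real.exp (t / (m + 1)) by
        rw [neg_div, Real.exp_neg]; field_simp, Real.log_exp]
      field_simp

/-- Integrating out all coordinates but the last leaves the density `x ^ m / m!`, up to the product
of the exponential integrals. -/
lemma lintegral_spacingWeight {g : ℕ → ℝ → ENNReal} (hg : ∀ j, Measurable (g j)) (m : ℕ)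
    {φ : ℝ → ENNReal} (hφ : Measurable φ) :
    ∫⁻ u : Fin (m + 1) → ℝ, spacingWeight g m u * φ (u (Fin.last m)) =
      (∏ j ∈ Finset.range m, ∫⁻ t, g j t ∂(expMeasure 1)) *
        ∫⁻ x in Ioi (0 : ℝ), ENNReal.ofReal (x ^ m / m.factorial) * φ x := by
  induction m generalizing φ with
  | zero =>
    have := (volume_preserving_funUnique (Fin 1) ℝ).lintegral_comp
      (f := fun x : ℝ => (if 0 < x then 1 else 0) * φ x)
      ((Measurable.ite measurableSet_Ioi measurable_const measurable_const).mul hφ)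
    simp only [MeasurableEquiv.funUnique_apply] at this
    rw [← lintegral_indicator measurableSet_Ioi]
    simp only [Finset.range_zero, Finset.prod_empty, one_mul]
    simp only [spacingWeight, Finset.univ_eq_empty, Finset.prod_empty, mul_one]
    refine this.trans (lintegral_congr fun x => ?_)
    by_cases h : 0 < x <;> simp [indicator, h]
  | succ m ih =>
    have hmeas : Measurable fun u : Fin (m + 2) → ℝ =>
        spacingWeight g (m + 1) u * φ (u (Fin.last (m + 1))) :=
      (measurable_spacingWeight hg _).mul (hφ.comp (measurable_pi_apply _))
    have hmp := (volume_preserving_piFinSuccAbove (fun _ : Fin (m + 2) => ℝ)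
      (Fin.last (m + 1))).symm
    have := (hmeas.comp (MeasurableEquiv.piFinSuccAbove (fun _ : Fin (m + 2) => ℝ)
      (Fin.last (m + 1))).symm.measurable).aemeasurable
        (μ := (volume : Measure ℝ).prod (volume : Measure (Fin (m + 1) → ℝ)))
    rw [← hmp.lintegral_comp hmeas, Measure.volume_eq_prod,
      lintegral_prod (fun z => spacingWeight g (m + 1) _ * φ (_ : ℝ)) this]
    have hsymm : ∀ (x : ℝ) (v : Fin (m + 1) → ℝ),
        (MeasurableEquiv.piFinSuccAbove (fun _ : Fin (m + 2) => ℝ) (Fin.last (m + 1))).symm (x, v) =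
          Fin.snoc v x := by
      intro x v
      exact Fin.insertNth_last' x v
    simp only [hsymm, spacingWeight_snoc, Fin.snoc_last]
    have hK := measurable_spacingKernel (hg m) m
    have hstep : ∀ x : ℝ, ∫⁻ v : Fin (m + 1) → ℝ,
        spacingWeight g m v * spacingKernel (g m) m (v (Fin.last m)) x * φ x =
        (Ioi (0 : ℝ)).indicator (fun x =>
          (∏ j ∈ Finset.range (m + 1), ∫⁻ t, g j t ∂(expMeasure 1)) *
            (ENNReal.ofReal (x ^ (m + 1) / (m + 1).factorial) * φ x)) x := by
      intro x
      have hKx : Measurable fun y => spacingKernel (g m) m y x :=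
        hK.comp (measurable_id.prodMk measurable_const)
      have hWK : Measurable fun v : Fin (m + 1) → ℝ =>
          spacingWeight g m v * spacingKernel (g m) m (v (Fin.last m)) x :=
        (measurable_spacingWeight hg m).mul (hKx.comp (measurable_pi_apply (Fin.last m)))
      rw [lintegral_mul_const _ hWK, ih hKx]
      by_cases hx : 0 < x
      · rw [lintegral_spacingKernel (hg m) m hx, indicator_of_mem (by exact hx),
          Finset.prod_range_succ]
        ring
      · have : ∫⁻ y in Ioi (0 : ℝ),
            ENNReal.ofReal (y ^ m / m.factorial) * spacingKernel (g m) m y x = 0 := by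
          rw [← lintegral_zero (μ := volume.restrict (Ioi (0 : ℝ)))]
          refine setLIntegral_congr_fun measurableSet_Ioi fun y hy => ?_
          have : ¬ y < x := fun h => hx (lt_trans hy h)
          simp [spacingKernel, this]
        rw [this, indicator_of_notMem (by exact hx)]
        simp
    simp only [hstep]
    rw [lintegral_indicator measurableSet_Ioi, lintegral_const_mul]
    exact (Measurable.ennreal_ofReal (by fun_prop)).mul hφ

lemma spacingWeight_of_strictMono (g : ℕ → ℝ → ENNReal) {m : ℕ} {u : Fin (m + 1) → ℝ}
    (h0 : 0 < u 0) (hu : StrictMono u) :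
    spacingWeight g m u =
      ∏ j : Fin m, g j (((j : ℕ) + 1) * Real.log (u j.succ / u j.castSucc)) := by
  rw [spacingWeight, if_pos h0, one_mul]
  refine Finset.prod_congr rfl fun j _ => ?_
  rw [spacingKernel, if_pos (hu j.castSucc_lt_succ)]

lemma strictMono_of_spacingWeight_ne_zero {g : ℕ → ℝ → ENNReal} {m : ℕ} {u : Fin (m + 1) → ℝ}
    (h : spacingWeight g m u ≠ 0) : 0 < u 0 ∧ StrictMono u := by
  unfold spacingWeight at h
  have h1 := left_ne_zero_of_mul h
  have h2 := right_ne_zero_of_mul h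
  refine ⟨by by_contra h0; simp [h0] at h1, Fin.strictMono_iff_lt_succ.2 fun j => ?_⟩
  have := Finset.prod_ne_zero_iff.1 h2 j (Finset.mem_univ j)
  by_contra hlt
  simp [spacingKernel, hlt] at this

lemma lintegral_pow_div_factorial_indicator (m : ℕ) :
    ∫⁻ x in Ioi (0 : ℝ), ENNReal.ofReal (x ^ m / m.factorial) * (Iio (1 : ℝ)).indicator 1 x =
      ((m + 1).factorial : ENNReal)⁻¹ := by
  have h := lintegral_spacingKernel (g := fun _ => 1) measurable_const m one_pos
  have := isProbabilityMeasure_expMeasure (r := 1) one_pos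
  have hk : ∀ y : ℝ, spacingKernel (fun _ => 1) m y 1 = (Iio (1 : ℝ)).indicator 1 y := by
    intro y
    by_cases hy : y < 1 <;> simp [spacingKernel, hy]
  simp only [hk, lintegral_one, measure_univ, mul_one, one_pow] at h
  rw [h, one_div, ENNReal.ofReal_inv_of_pos (by positivity), ENNReal.ofReal_natCast]

/-- The event that the permutation `σ` puts the first `m + 1` terms of the sample into strictly
increasing positive order. -/
def sortEvent {Ω : Type*} (U : ℕ → Ω → ℝ) (m : ℕ) (σ : Equiv.Perm (Fin (m + 1))) : Set Ω :=
  {ω | 0 < U (σ 0) ω ∧ StrictMono fun i : Fin (m + 1) => U (σ i) ω}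

lemma pairwise_disjoint_sortEvent {Ω : Type*} (U : ℕ → Ω → ℝ) (m : ℕ) :
    Pairwise (Function.onFun Disjoint (sortEvent U m)) := by
  intro σ τ hne
  refine Set.disjoint_left.2 fun ω h1 h2 => hne ?_
  have heq := Tuple.unique_monotone (f := fun i : Fin (m + 1) => U i ω) h1.2.monotone h2.2.monotone
  ext i : 1
  obtain ⟨j, hj⟩ := σ.surjective (τ i)
  have h3 : U (σ i) ω = U (τ i) ω := congrFun heq i
  rw [← hj] at h3
  rw [← hj, h1.2.injective h3]

/-- On each sorting event the normalized spacings are explicit functions of the sample. -/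
lemma malmquistE_of_mem_sortEvent {Ω : Type*} {U : ℕ → Ω → ℝ} {m : ℕ}
    {σ : Equiv.Perm (Fin (m + 1))} {ω : Ω} (h : ω ∈ sortEvent U m σ) (j : Fin m) :
    malmquistE U (m + 1) (j + 1) ω =
      ((j : ℕ) + 1) * Real.log (U (σ j.succ) ω / U (σ j.castSucc) ω) := by
  have h1 := orderStat_eq_of_monotone (x := fun i => U i ω) σ h.2.monotone j.succ
  have h2 := orderStat_eq_of_monotone (x := fun i => U i ω) σ h.2.monotone j.castSucc
  simp only [Fin.val_succ, Fin.val_castSucc] at h1 h2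
  rw [malmquistE, ordU, ordU, h1, h2]
  push_cast
  rfl

section Malmquist

variable {Ω : Type*} [MeasurableSpace Ω] {P : Measure Ω} [IsProbabilityMeasure P]
  {U : ℕ → Ω → ℝ}

/-- The expected weight of a permuted uniform sample. -/
lemma lintegral_spacingWeight_sample (hUm : ∀ i, Measurable (U i)) (hUind : iIndepFun U P)
    (hUunif : ∀ i, P.map (U i) = volume.restrict (Ioo (0 : ℝ) 1)) {g : ℕ → ℝ → ENNReal}
    (hg : ∀ j, Measurable (g j)) (m : ℕ) (σ : Equiv.Perm (Fin (m + 1))) :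
    ∫⁻ ω, spacingWeight g m (fun i => U (σ i) ω) ∂P =
      (∏ j ∈ Finset.range m, ∫⁻ t, g j t ∂(expMeasure 1)) * ((m + 1).factorial : ENNReal)⁻¹ := by
  have hind : iIndepFun (fun i : Fin (m + 1) => U (σ i)) P :=
    hUind.precomp (g := fun i : Fin (m + 1) => ((σ i : Fin (m + 1)) : ℕ))
      (Fin.val_injective.comp σ.injective)
  have hmap := (iIndepFun_iff_map_fun_eq_pi_map
    (fun i : Fin (m + 1) => (hUm (σ i)).aemeasurable)).1 hind
  simp only [hUunif] at hmap
  have hmU : Measurable fun ω => fun i : Fin (m + 1) => U (σ i) ω :=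
    measurable_pi_lambda _ fun i => hUm (σ i)
  rw [← lintegral_map (measurable_spacingWeight hg m) hmU, hmap, ← Measure.restrict_pi_pi,
    ← volume_pi, ← lintegral_indicator (MeasurableSet.univ_pi fun _ => measurableSet_Ioo),
    ← lintegral_pow_div_factorial_indicator,
    ← lintegral_spacingWeight hg m (φ := (Iio (1 : ℝ)).indicator 1)
      (measurable_const.indicator measurableSet_Iio)]
  refine lintegral_congr fun u => ?_
  by_cases hW : spacingWeight g m u = 0
  · simp [indicator, hW]
  · obtain ⟨h0, hu⟩ := strictMono_of_spacingWeight_ne_zero hW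
    have hiff : u ∈ univ.pi (fun _ : Fin (m + 1) => Ioo (0 : ℝ) 1) ↔ u (Fin.last m) ∈ Iio (1 : ℝ) :=
      ⟨fun h => (h (Fin.last m) (mem_univ _)).2, fun h i _ =>
        ⟨h0.trans_le (hu.monotone (Fin.zero_le i)), (hu.monotone (Fin.le_last i)).trans_lt h⟩⟩
    by_cases hc : u (Fin.last m) ∈ Iio (1 : ℝ)
    · rw [indicator_of_mem (hiff.2 hc), indicator_of_mem hc, Pi.one_apply, mul_one]
    · rw [indicator_of_notMem (fun h => hc (hiff.1 h)), indicator_of_notMem hc, mul_zero]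

lemma measurableSet_sortEvent (hUm : ∀ i, Measurable (U i)) (m : ℕ)
    (σ : Equiv.Perm (Fin (m + 1))) : MeasurableSet (sortEvent U m σ) := by
  have h : sortEvent U m σ =
      {ω | 0 < U (σ 0) ω} ∩ ⋂ i : Fin m, {ω | U (σ i.castSucc) ω < U (σ i.succ) ω} := by
    ext ω
    simp [sortEvent, Fin.strictMono_iff_lt_succ]
  rw [h]
  exact (measurableSet_lt measurable_const (hUm _)).inter
    (MeasurableSet.iInter fun i => measurableSet_lt (hUm _) (hUm _))

lemma measure_sortEvent_inter (hUm : ∀ i, Measurable (U i)) (hUind : iIndepFun U P)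
    (hUunif : ∀ i, P.map (U i) = volume.restrict (Ioo (0 : ℝ) 1)) (m : ℕ)
    (σ : Equiv.Perm (Fin (m + 1))) {s : Fin m → Set ℝ} (hs : ∀ j, MeasurableSet (s j)) :
    P (sortEvent U m σ ∩ {ω | ∀ j : Fin m, malmquistE U (m + 1) (j + 1) ω ∈ s j}) =
      (∏ j : Fin m, expMeasure 1 (s j)) * ((m + 1).factorial : ENNReal)⁻¹ := by
  classical
  set g : ℕ → ℝ → ENNReal := fun j => if h : j < m then (s ⟨j, h⟩).indicator 1 else 0 with hgdef
  have hgj : ∀ j : Fin m, g j = (s j).indicator 1 := fun j => by simp [hgdef]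
  have hg : ∀ j, Measurable (g j) := by
    intro j
    by_cases h : j < m
    · simp only [hgdef, h, dif_pos]
      exact measurable_const.indicator (hs _)
    · simp only [hgdef, h, dif_neg, not_false_eq_true]
      exact measurable_const
  have hset : sortEvent U m σ ∩ {ω | ∀ j : Fin m, malmquistE U (m + 1) (j + 1) ω ∈ s j} =
      sortEvent U m σ ∩ {ω | ∀ j : Fin m,
        ((j : ℕ) + 1) * Real.log (U (σ j.succ) ω / U (σ j.castSucc) ω) ∈ s j} := by
    ext ω
    refine and_congr_right fun h => ?_
    exact forall_congr' fun j => by rw [malmquistE_of_mem_sortEvent h j]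
  have hmeas : MeasurableSet {ω | ∀ j : Fin m,
      ((j : ℕ) + 1) * Real.log (U (σ j.succ) ω / U (σ j.castSucc) ω) ∈ s j} := by
    rw [show {ω | ∀ j : Fin m,
      ((j : ℕ) + 1) * Real.log (U (σ j.succ) ω / U (σ j.castSucc) ω) ∈ s j} = ⋂ j : Fin m,
      (fun ω => ((j : ℕ) + 1) * Real.log (U (σ j.succ) ω / U (σ j.castSucc) ω)) ⁻¹' s j by
        ext ω; simp]
    refine MeasurableSet.iInter fun j => ?_
    have h1 := hUm (σ j.succ)
    have h2 := hUm (σ j.castSucc)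
    exact (show Measurable fun ω => ((j : ℕ) + 1 : ℝ) *
      Real.log (U (σ j.succ) ω / U (σ j.castSucc) ω) by fun_prop) (hs j)
  rw [hset, ← lintegral_indicator_one ((measurableSet_sortEvent hUm m σ).inter hmeas)]
  have hprod : ∏ j : Fin m, expMeasure 1 (s j) =
      ∏ j ∈ Finset.range m, ∫⁻ t, g j t ∂(expMeasure 1) := by
    rw [Finset.prod_range]
    refine Finset.prod_congr rfl fun j _ => ?_
    rw [hgj, lintegral_indicator_one (hs j)]
  rw [hprod, ← lintegral_spacingWeight_sample hUm hUind hUunif hg m σ]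
  refine lintegral_congr fun ω => ?_
  by_cases h : ω ∈ sortEvent U m σ
  · rw [spacingWeight_of_strictMono g h.1 h.2]
    simp only [hgj]
    by_cases h2 : ∀ j : Fin m,
        ((j : ℕ) + 1) * Real.log (U (σ j.succ) ω / U (σ j.castSucc) ω) ∈ s j
    · rw [indicator_of_mem (by exact ⟨h, h2⟩)]
      exact (Finset.prod_eq_one fun j _ => indicator_of_mem (h2 j) _).symm
    · rw [indicator_of_notMem (fun hh => h2 hh.2)]
      push Not at h2
      obtain ⟨j, hj⟩ := h2
      exact (Finset.prod_eq_zero (Finset.mem_univ j) (indicator_of_notMem hj _)).symm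
  · rw [indicator_of_notMem (fun hh => h hh.1)]
    by_contra hne
    exact h (strictMono_of_spacingWeight_ne_zero (Ne.symm hne))

lemma measure_iUnion_sortEvent (hUm : ∀ i, Measurable (U i)) (hUind : iIndepFun U P)
    (hUunif : ∀ i, P.map (U i) = volume.restrict (Ioo (0 : ℝ) 1)) (m : ℕ) :
    P (⋃ σ, sortEvent U m σ) = 1 := by
  have := isProbabilityMeasure_expMeasure (r := 1) one_pos
  rw [measure_iUnion (pairwise_disjoint_sortEvent U m) (measurableSet_sortEvent hUm m),
    tsum_fintype]
  have h : ∀ σ, P (sortEvent U m σ) = ((m + 1).factorial : ENNReal)⁻¹ := by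
    intro σ
    have := measure_sortEvent_inter hUm hUind hUunif m σ (s := fun _ => univ)
      (fun _ => MeasurableSet.univ)
    simpa using this
  simp only [h, Finset.sum_const, Finset.card_univ, Fintype.card_perm, Fintype.card_fin,
    nsmul_eq_mul]
  exact ENNReal.mul_inv_cancel (by exact_mod_cast (Nat.factorial_pos _).ne') (by simp)

lemma aemeasurable_malmquistE (hUm : ∀ i, Measurable (U i)) (hUind : iIndepFun U P)
    (hUunif : ∀ i, P.map (U i) = volume.restrict (Ioo (0 : ℝ) 1)) (m : ℕ) (j : Fin m) :
    AEMeasurable (malmquistE U (m + 1) (j + 1)) P := by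
  have hfull : P.restrict (⋃ σ, sortEvent U m σ) = P := by
    rw [Measure.restrict_eq_self_of_ae_mem]
    exact (prob_compl_eq_zero_iff
      (MeasurableSet.iUnion (measurableSet_sortEvent hUm m))).2
        (measure_iUnion_sortEvent hUm hUind hUunif m)
  rw [← hfull, aemeasurable_iUnion_iff]
  intro σ
  have h1 := hUm (σ j.succ)
  have h2 := hUm (σ j.castSucc)
  refine (show Measurable fun ω => ((j : ℕ) + 1 : ℝ) *
      Real.log (U (σ j.succ) ω / U (σ j.castSucc) ω) by fun_prop).aemeasurable.congr ?_
  filter_upwards [ae_restrict_mem (measurableSet_sortEvent hUm m σ)] with ω hω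
  rw [malmquistE_of_mem_sortEvent hω]

/-- The joint law of the normalized logarithmic spacings is a product of standard exponentials. -/
lemma map_malmquistE (hUm : ∀ i, Measurable (U i)) (hUind : iIndepFun U P)
    (hUunif : ∀ i, P.map (U i) = volume.restrict (Ioo (0 : ℝ) 1)) (m : ℕ) :
    P.map (fun ω => fun j : Fin m => malmquistE U (m + 1) (j + 1) ω) =
      Measure.pi fun _ : Fin m => expMeasure 1 := by
  have := isProbabilityMeasure_expMeasure (r := 1) one_pos
  refine (Measure.pi_eq fun s hs => ?_).symm
  rw [Measure.map_apply_of_aemeasurable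
    (aemeasurable_pi_lambda _ (aemeasurable_malmquistE hUm hUind hUunif m))
    (MeasurableSet.univ_pi hs)]
  have hpre : (fun ω => fun j : Fin m => malmquistE U (m + 1) (j + 1) ω) ⁻¹' univ.pi s =
      {ω | ∀ j : Fin m, malmquistE U (m + 1) (j + 1) ω ∈ s j} := by
    ext ω; simp [Set.mem_pi]
  have hcompl : P (⋃ σ, sortEvent U m σ)ᶜ = 0 := (prob_compl_eq_zero_iff
      (MeasurableSet.iUnion (measurableSet_sortEvent hUm m))).2
        (measure_iUnion_sortEvent hUm hUind hUunif m)
  rw [hpre, ← measure_inter_add_sdiff₀ _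
    (MeasurableSet.iUnion (measurableSet_sortEvent hUm m)).nullMeasurableSet,
    measure_mono_null (t := (⋃ σ, sortEvent U m σ)ᶜ) (s := _ \ _) (fun ω hω => hω.2) hcompl,
    add_zero, inter_comm, iUnion_inter]
  have hnull : ∀ σ, NullMeasurableSet (sortEvent U m σ ∩
      {ω | ∀ j : Fin m, malmquistE U (m + 1) (j + 1) ω ∈ s j}) P := by
    intro σ
    refine (measurableSet_sortEvent hUm m σ).nullMeasurableSet.inter ?_
    rw [← hpre]
    exact (aemeasurable_pi_lambda _
      (aemeasurable_malmquistE hUm hUind hUunif m)).nullMeasurableSet_preimage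
        (MeasurableSet.univ_pi hs)
  rw [measure_iUnion₀ (fun σ τ hne => ((pairwise_disjoint_sortEvent U m hne).mono
    inter_subset_left inter_subset_left).aedisjoint) hnull, tsum_fintype]
  simp only [measure_sortEvent_inter hUm hUind hUunif m _ hs, Finset.sum_const, Finset.card_univ,
    Fintype.card_perm, Fintype.card_fin, nsmul_eq_mul]
  rw [mul_left_comm, ENNReal.mul_inv_cancel (by exact_mod_cast (Nat.factorial_pos _).ne')
    (by simp), mul_one]

lemma map_malmquistE_single (hUm : ∀ i, Measurable (U i)) (hUind : iIndepFun U P)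
    (hUunif : ∀ i, P.map (U i) = volume.restrict (Ioo (0 : ℝ) 1)) {n j : ℕ} (hj : 1 ≤ j)
    (hjn : j < n) : P.map (malmquistE U n j) = expMeasure 1 := by
  have := isProbabilityMeasure_expMeasure (r := 1) one_pos
  obtain ⟨m, rfl⟩ : ∃ m, n = m + 1 := ⟨n - 1, by omega⟩
  have h := map_malmquistE hUm hUind hUunif m
  have hev := (measurePreserving_eval (fun _ : Fin m => expMeasure 1) ⟨j - 1, by omega⟩).map_eq
  rw [← h, AEMeasurable.map_map_of_aemeasurable (measurable_pi_apply _).aemeasurable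
    (aemeasurable_pi_lambda _ (aemeasurable_malmquistE hUm hUind hUunif m))] at hev
  rw [← hev]
  congr 1
  funext ω
  simp [show j - 1 + 1 = j by omega]

lemma iIndepFun_malmquistE (hUm : ∀ i, Measurable (U i)) (hUind : iIndepFun U P)
    (hUunif : ∀ i, P.map (U i) = volume.restrict (Ioo (0 : ℝ) 1)) (n : ℕ) :
    iIndepFun (fun j : Fin (n - 1) => malmquistE U n (j + 1)) P := by
  cases n with
  | zero =>
    refine (iIndepFun_iff_map_fun_eq_pi_map fun i : Fin 0 => i.elim0).2 ?_
    have : IsProbabilityMeasure (P.map fun (ω : Ω) (i : Fin 0) => malmquistE U 0 (i + 1) ω) :=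
      Measure.isProbabilityMeasure_map (measurable_pi_lambda _ fun i => i.elim0).aemeasurable
    refine (Measure.pi_eq fun s _ => ?_).symm
    rw [Set.eq_univ_of_forall (s := univ.pi s) fun x i => i.elim0]
    simp
  | succ m =>
    refine (iIndepFun_iff_map_fun_eq_pi_map (aemeasurable_malmquistE hUm hUind hUunif m)).2 ?_
    refine (map_malmquistE hUm hUind hUunif m).trans ?_
    congr 1
    funext j
    exact (map_malmquistE_single hUm hUind hUunif (by omega) (by omega)).symm

end Malmquist

/-! ### Quantiles of a distribution function and of its logarithmic version -/

section Quantile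

variable {ν : Measure ℝ}

lemma le_cdf_iff_quantile_le {v : ℝ} (h0 : 0 < v) (h1 : v < 1) (x : ℝ) :
    v ≤ cdf ν x ↔ quantile (fun x => cdf ν x) v ≤ x := by
  obtain ⟨z, hz⟩ : ∃ z, v ≤ cdf ν z :=
    ((tendsto_cdf_atTop ν).eventually (eventually_ge_nhds h1)).exists
  obtain ⟨y, hy⟩ : ∃ y, cdf ν y < v :=
    ((tendsto_cdf_atBot ν).eventually (eventually_lt_nhds h0)).exists
  have hne : {x | v ≤ cdf ν x}.Nonempty := ⟨z, hz⟩
  have hlow : ∀ {y}, cdf ν y < v → y ∈ lowerBounds {x | v ≤ cdf ν x} := fun {y} hy x hx => by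
    by_contra hlt
    exact absurd ((monotone_cdf ν (not_le.1 hlt).le).trans_lt hy) (not_lt.2 hx)
  refine ⟨fun h => csInf_le ⟨y, hlow hy⟩ h, fun h => ?_⟩
  refine le_trans ?_ (monotone_cdf ν h)
  by_contra hlt
  rw [not_le] at hlt
  have hc : ContinuousWithinAt (cdf ν) (Ici (quantile (fun x => cdf ν x) v)) _ :=
    (cdf ν).right_continuous _
  have hev := (hc.mono Ioi_subset_Ici_self).eventually (eventually_lt_nhds hlt)
  obtain ⟨w, hw1, hw2⟩ := (hev.and self_mem_nhdsWithin).exists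
  exact absurd (le_csInf hne (hlow hw1)) (not_le.2 hw2)

lemma quantile_cdf_mono {v w : ℝ} (h0 : 0 < v) (hvw : v ≤ w) (h1 : w < 1) :
    quantile (fun x => cdf ν x) v ≤ quantile (fun x => cdf ν x) w :=
  (le_cdf_iff_quantile_le h0 (hvw.trans_lt h1) _).1
    (hvw.trans ((le_cdf_iff_quantile_le (h0.trans_le hvw) h1 _).2 le_rfl))

lemma quantile_cdf_pos (hF0 : cdf ν 0 = 0) {v : ℝ} (h0 : 0 < v) (h1 : v < 1) :
    0 < quantile (fun x => cdf ν x) v := by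
  by_contra h
  have := (le_cdf_iff_quantile_le (ν := ν) h0 h1 0).2 (not_lt.1 h)
  linarith

lemma quantile_logDF (hF0 : cdf ν 0 = 0) {v : ℝ} (h0 : 0 < v) (h1 : v < 1) :
    quantile (logDF fun x => cdf ν x) v = Real.log (quantile (fun x => cdf ν x) v) := by
  have hset : {x | v ≤ logDF (fun x => cdf ν x) x} =
      Ici (Real.log (quantile (fun x => cdf ν x) v)) := by
    ext x
    simp only [logDF, Set.mem_ofPred_eq, mem_Ici]
    rw [le_cdf_iff_quantile_le h0 h1, Real.log_le_iff_le_exp (quantile_cdf_pos hF0 h0 h1)]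
  rw [quantile, hset, csInf_Ici]

/-! ### Regular variation from the domain of attraction -/

/-- The exponent `τ` in `gev (-γ) = exp (-τ)`. -/
noncomputable def gevExponent (γ x : ℝ) : ℝ := if 0 < 1 - γ * x then (1 - γ * x) ^ (1 / γ) else 0

lemma gev_neg_eq {γ : ℝ} (hγ : 0 < γ) (x : ℝ) : gev (-γ) x = Real.exp (-gevExponent γ x) := by
  have h : ¬ (0 < -γ) := by linarith
  simp only [gev, gevExponent, neg_eq_zero, hγ.ne', if_false, h, neg_mul, ← sub_eq_add_neg,
    neg_div_neg_eq]
  split_ifs <;> simp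

lemma gevExponent_lt {γ : ℝ} (hγ : 0 < γ) {x u : ℝ} (hu : 0 < u) (h : (1 - u ^ γ) / γ < x) :
    gevExponent γ x < u := by
  rw [div_lt_iff₀ hγ] at h
  unfold gevExponent
  split_ifs with h1
  · rw [one_div, Real.rpow_inv_lt_iff_of_pos h1.le hu.le hγ]
    linarith
  · exact hu

lemma lt_gevExponent {γ : ℝ} (hγ : 0 < γ) {x u : ℝ} (hu : 0 < u) (h : x < (1 - u ^ γ) / γ) :
    u < gevExponent γ x := by
  rw [lt_div_iff₀ hγ] at h
  have := Real.rpow_pos_of_pos hu γ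
  have h1 : 0 < 1 - γ * x := by linarith
  rw [gevExponent, if_pos h1, one_div, Real.lt_rpow_inv_iff_of_pos hu.le h1.le hγ]
  linarith

/-- Convergence of the powers `c n ^ n` to a positive limit determines the limit of
`n (1 - c n)`. -/
lemma tendsto_mul_one_sub_of_pow {c : ℕ → ℝ} (h0 : ∀ n, 0 ≤ c n) {τ : ℝ}
    (h : Tendsto (fun n => c n ^ n) atTop (𝓝 (Real.exp (-τ)))) :
    Tendsto (fun n : ℕ => n * (1 - c n)) atTop (𝓝 τ) := by
  have hpos : ∀ᶠ n in atTop, 0 < c n := by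
    filter_upwards [h.eventually (eventually_gt_nhds (Real.exp_pos _)), eventually_ge_atTop 1]
      with n hn h1
    refine (h0 n).lt_of_ne fun h2 => ?_
    rw [← h2, zero_pow (by omega)] at hn
    exact lt_irrefl _ hn
  have hlog : Tendsto (fun n : ℕ => -((n : ℝ) * Real.log (c n))) atTop (𝓝 τ) := by
    have := (h.log (Real.exp_pos _).ne').neg
    rw [Real.log_exp, neg_neg] at this
    refine this.congr fun n => ?_
    rw [Real.log_pow]
  have hlog0 : Tendsto (fun n : ℕ => Real.log (c n)) atTop (𝓝 0) := by
    have := (hlog.mul tendsto_inv_atTop_nhds_zero_nat).neg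
    simp only [mul_zero, neg_zero] at this
    refine this.congr' ?_
    filter_upwards [eventually_ge_atTop 1] with n hn
    have : (n : ℝ) ≠ 0 := by positivity
    field_simp
  have hc : Tendsto c atTop (𝓝 1) := by
    have := hlog0.rexp
    rw [Real.exp_zero] at this
    refine this.congr' ?_
    filter_upwards [hpos] with n hn using Real.exp_log hn
  refine tendsto_of_tendsto_of_tendsto_of_le_of_le' (by simpa using hc.mul hlog) hlog ?_ ?_
  · filter_upwards [hpos] with n hn
    have h1 := Real.one_sub_inv_le_log_of_pos hn
    have h2 : -(c n * Real.log (c n)) ≤ 1 - c n := by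
      have := mul_le_mul_of_nonneg_left h1 hn.le
      rw [mul_sub, mul_inv_cancel₀ hn.ne'] at this
      linarith
    have h3 : (0 : ℝ) ≤ n := by positivity
    nlinarith
  · filter_upwards [hpos] with n hn
    have h1 := Real.log_le_sub_one_of_pos hn
    have h3 : (0 : ℝ) ≤ n := by positivity
    nlinarith

/-- The tail quantile `u ↦ F⁻¹(1 - u)`, affinely normalized at `n = ⌊1 / w⌋`, converges as
`w ↓ 0`. -/
lemma tendsto_tailQuantile {γ : ℝ} (hγ : 0 < γ) {a b : ℕ → ℝ} (ha : ∀ n, 0 < a n)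
    (h : ∀ x, Tendsto (fun n : ℕ => cdf ν (a n * x + b n) ^ n) atTop (𝓝 (gev (-γ) x)))
    {u : ℝ} (hu : 0 < u) :
    Tendsto (fun w : ℝ => (quantile (fun x => cdf ν x) (1 - u * w) - b ⌊1 / w⌋₊) / a ⌊1 / w⌋₊)
      (𝓝[>] 0) (𝓝 ((1 - u ^ γ) / γ)) := by
  have hfl : Tendsto (fun w : ℝ => ⌊1 / w⌋₊) (𝓝[>] 0) atTop := by
    refine tendsto_nat_floor_atTop.comp ?_
    exact (tendsto_inv_nhdsGT_zero (𝕜 := ℝ)).congr fun w => (one_div w).symm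
  have hnw : Tendsto (fun w : ℝ => (⌊1 / w⌋₊ : ℝ) * w) (𝓝[>] 0) (𝓝 1) := by
    have h1 : Tendsto (fun w : ℝ => 1 - w) (𝓝[>] 0) (𝓝 1) := by
      have : Tendsto (fun w : ℝ => 1 - w) (𝓝 0) (𝓝 (1 - 0)) := tendsto_const_nhds.sub tendsto_id
      rw [sub_zero] at this
      exact this.mono_left nhdsWithin_le_nhds
    refine tendsto_of_tendsto_of_tendsto_of_le_of_le' h1 tendsto_const_nhds ?_ ?_
    · filter_upwards [self_mem_nhdsWithin] with w (hw : 0 < w)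
      have := Nat.lt_floor_add_one (1 / w)
      rw [div_lt_iff₀ hw] at this
      linarith
    · filter_upwards [self_mem_nhdsWithin] with w (hw : 0 < w)
      have := Nat.floor_le (one_div_pos.2 hw).le
      rwa [le_div_iff₀ hw] at this
  have hunw : Tendsto (fun w : ℝ => u * ((⌊1 / w⌋₊ : ℝ) * w)) (𝓝[>] 0) (𝓝 u) := by
    simpa using hnw.const_mul u
  have htau : ∀ x, Tendsto (fun w : ℝ => (⌊1 / w⌋₊ : ℝ) *
      (1 - cdf ν (a ⌊1 / w⌋₊ * x + b ⌊1 / w⌋₊))) (𝓝[>] 0) (𝓝 (gevExponent γ x)) := by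
    intro x
    have h1 := h x
    rw [gev_neg_eq hγ] at h1
    exact (tendsto_mul_one_sub_of_pow (fun n => cdf_nonneg ν _) h1).comp hfl
  have hsmall : ∀ᶠ w : ℝ in 𝓝[>] 0, 0 < 1 - u * w ∧ 1 - u * w < 1 := by
    have : Tendsto (fun w : ℝ => 1 - u * w) (𝓝 0) (𝓝 (1 - u * 0)) :=
      tendsto_const_nhds.sub (tendsto_id.const_mul u)
    rw [mul_zero, sub_zero] at this
    filter_upwards [(this.mono_left nhdsWithin_le_nhds).eventually
      (eventually_gt_nhds (zero_lt_one)), self_mem_nhdsWithin] with w h1 (h2 : 0 < w)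
    exact ⟨h1, by nlinarith⟩
  have hn1 := hfl.eventually (eventually_ge_atTop 1)
  rw [tendsto_order]
  constructor
  · intro x hx
    obtain ⟨y, hxy, hy⟩ := exists_between hx
    filter_upwards [hsmall, hn1, hunw.eventually_lt (htau y) (lt_gevExponent hγ hu hy)]
      with w hw hn hlt
    have hn : (0 : ℝ) < ⌊1 / w⌋₊ := by exact_mod_cast hn
    refine hxy.trans_le ?_
    rw [le_div_iff₀ (ha _)]
    have h1 : u * w < 1 - cdf ν (a ⌊1 / w⌋₊ * y + b ⌊1 / w⌋₊) := by nlinarith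
    have h2 := (le_cdf_iff_quantile_le (ν := ν) hw.1 hw.2 (a ⌊1 / w⌋₊ * y + b ⌊1 / w⌋₊)).not.1
      (by linarith)
    linarith
  · intro x hx
    obtain ⟨y, hy, hxy⟩ := exists_between hx
    filter_upwards [hsmall, hn1, (htau y).eventually_lt hunw (gevExponent_lt hγ hu hy)]
      with w hw hn hlt
    have hn : (0 : ℝ) < ⌊1 / w⌋₊ := by exact_mod_cast hn
    refine lt_of_le_of_lt ?_ hxy
    rw [div_le_iff₀ (ha _)]
    have h1 : 1 - cdf ν (a ⌊1 / w⌋₊ * y + b ⌊1 / w⌋₊) < u * w := by nlinarith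
    have h2 := (le_cdf_iff_quantile_le (ν := ν) hw.1 hw.2 (a ⌊1 / w⌋₊ * y + b ⌊1 / w⌋₊)).1
      (by linarith)
    linarith

end Quantile

section Gap

variable {γ : ℝ} {Q α β : ℝ → ℝ}

/-- The normalized increments of `Q` between `v w` and `u w`. -/
lemma tendsto_increment
    (hQ : ∀ u, 0 < u → Tendsto (fun w => (Q (u * w) - β w) / α w) (𝓝[>] 0)
      (𝓝 ((1 - u ^ γ) / γ))) {u v : ℝ} (hu : 0 < u) (hv : 0 < v) :
    Tendsto (fun w => (Q (u * w) - Q (v * w)) / α w) (𝓝[>] 0) (𝓝 ((v ^ γ - u ^ γ) / γ)) := by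
  have := (hQ u hu).sub (hQ v hv)
  rw [show (1 - u ^ γ) / γ - (1 - v ^ γ) / γ = (v ^ γ - u ^ γ) / γ by ring] at this
  exact this.congr fun w => by ring

/-- If the dyadic increments `Q (w / 2) - Q w` shrink at least by the factor `r < 1` at each
halving, then `Q w + (Q (w / 2) - Q w) / (1 - r)` decreases along the halvings. -/
lemma iterate_half_le {r δ : ℝ} (hr : r < 1)
    (hA : ∀ w, 0 < w → w < δ → Q (w / 2 / 2) - Q (w / 2) ≤ r * (Q (w / 2) - Q w)) {w : ℝ}
    (hw : 0 < w) (hwδ : w < δ) (m : ℕ) :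
    Q (w / 2 ^ m) + (Q (w / 2 ^ m / 2) - Q (w / 2 ^ m)) / (1 - r) ≤
      Q w + (Q (w / 2) - Q w) / (1 - r) := by
  induction m with
  | zero => simp
  | succ m ih =>
    refine le_trans ?_ ih
    have h2 : (1 : ℝ) ≤ 2 ^ m := one_le_pow₀ (by norm_num)
    have h := hA (w / 2 ^ m) (by positivity) ((div_le_self hw.le h2).trans_lt hwδ)
    rw [pow_succ, ← div_div]
    have hr' : 0 < 1 - r := by linarith
    rw [← sub_nonneg]
    have : Q (w / 2 ^ m) + (Q (w / 2 ^ m / 2) - Q (w / 2 ^ m)) / (1 - r) -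
        (Q (w / 2 ^ m / 2) + (Q (w / 2 ^ m / 2 / 2) - Q (w / 2 ^ m / 2)) / (1 - r)) =
        (r * (Q (w / 2 ^ m / 2) - Q (w / 2 ^ m)) - (Q (w / 2 ^ m / 2 / 2) - Q (w / 2 ^ m / 2))) /
          (1 - r) := by
      field_simp
      ring
    rw [this]
    exact div_nonneg (by linarith) hr'.le

/-- The counterpart of `iterate_half_le` for a lower bound on the ratio of the increments. -/
lemma le_iterate_half {r δ : ℝ} (hr : r < 1)
    (hA : ∀ w, 0 < w → w < δ → r * (Q (w / 2) - Q w) ≤ Q (w / 2 / 2) - Q (w / 2)) {w : ℝ}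
    (hw : 0 < w) (hwδ : w < δ) (m : ℕ) :
    Q w + (Q (w / 2) - Q w) / (1 - r) ≤
      Q (w / 2 ^ m) + (Q (w / 2 ^ m / 2) - Q (w / 2 ^ m)) / (1 - r) := by
  have := iterate_half_le (Q := fun w => -Q w) hr (fun w h1 h2 => by linarith [hA w h1 h2]) hw hwδ m
  have h1 : ∀ x y : ℝ, -x + (-y - -x) / (1 - r) = -(x + (y - x) / (1 - r)) := fun x y => by ring
  rw [h1, h1] at this
  linarith

/-- The dyadic increments `Q (w / 2) - Q w` are eventually positive, and their successive ratios
tend to `2^(-γ)`. -/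
lemma eventually_half_ratio (hγ : 0 < γ) (hα : ∀ w, 0 < α w)
    (hQ : ∀ u, 0 < u → Tendsto (fun w => (Q (u * w) - β w) / α w) (𝓝[>] 0)
      (𝓝 ((1 - u ^ γ) / γ))) {r s : ℝ} (hr : (1 / 2 : ℝ) ^ γ < r) (hs : s < (1 / 2 : ℝ) ^ γ) :
    ∀ᶠ w in 𝓝[>] (0 : ℝ), 0 < Q (w / 2) - Q w ∧
      Q (w / 2 / 2) - Q (w / 2) ≤ r * (Q (w / 2) - Q w) ∧
      s * (Q (w / 2) - Q w) ≤ Q (w / 2 / 2) - Q (w / 2) := by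
  set ρ : ℝ := (1 / 2 : ℝ) ^ γ with hρ
  have hρ1 : ρ < 1 := Real.rpow_lt_one (by norm_num) (by norm_num) hγ
  have h1 := tendsto_increment hQ (u := 1 / 2) (v := 1) (by norm_num) one_pos
  have h2 := tendsto_increment hQ (u := 1 / 4) (v := 1 / 2) (by norm_num) (by norm_num)
  have h4 : (1 / 4 : ℝ) ^ γ = ρ * ρ := by
    rw [hρ, ← Real.mul_rpow (by norm_num) (by norm_num)]; norm_num
  rw [Real.one_rpow, ← hρ] at h1
  rw [h4, ← hρ] at h2
  have hpos : 0 < (1 - ρ) / γ := div_pos (by linarith) hγ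
  have hratio := h2.div h1 hpos.ne'
  rw [show (ρ - ρ * ρ) / γ / ((1 - ρ) / γ) = ρ by
    have : 1 - ρ ≠ 0 := by linarith
    field_simp] at hratio
  filter_upwards [h1.eventually (eventually_gt_nhds hpos),
    hratio.eventually (eventually_lt_nhds hr), hratio.eventually (eventually_gt_nhds hs)]
    with w hw1 hw2 hw3
  have hαw := hα w
  have e1 : (1 / 2 : ℝ) * w = w / 2 := by ring
  have e2 : (1 / 4 : ℝ) * w = w / 2 / 2 := by ring
  simp only [one_mul, e1, e2, Pi.div_apply] at hw1 hw2 hw3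
  have hA : 0 < Q (w / 2) - Q w := by
    rwa [lt_div_iff₀ hαw, zero_mul] at hw1
  rw [div_div_div_cancel_right₀ hαw.ne'] at hw2 hw3
  exact ⟨hA, ((div_lt_iff₀ hA).1 hw2).le, ((lt_div_iff₀ hA).1 hw3).le⟩

lemma tendsto_div_two_pow (w : ℝ) : Tendsto (fun m : ℕ => w / 2 ^ m) atTop (𝓝 0) := by
  have := (tendsto_pow_atTop_nhds_zero_of_lt_one (r := (1 / 2 : ℝ)) (by norm_num)
    (by norm_num)).const_mul w
  rw [mul_zero] at this
  refine this.congr fun m => ?_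
  rw [one_div, inv_pow]
  rfl

variable (hγ : 0 < γ) (hα : ∀ w, 0 < α w) (hanti : AntitoneOn Q (Ioo 0 1))
  (hQ : ∀ u, 0 < u → Tendsto (fun w => (Q (u * w) - β w) / α w) (𝓝[>] 0) (𝓝 ((1 - u ^ γ) / γ)))
include hγ hα hanti hQ

lemma bddAbove_tailQuantile : BddAbove (Q '' Ioo 0 1) := by
  have hρ1 : (1 / 2 : ℝ) ^ γ < 1 := Real.rpow_lt_one (by norm_num) (by norm_num) hγ
  obtain ⟨r, hr, hr1⟩ := exists_between hρ1
  have hev := eventually_half_ratio hγ hα hQ hr (sub_one_lt ((1 / 2 : ℝ) ^ γ))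
  obtain ⟨δ, hδ, hδ2⟩ := mem_nhdsGT_iff_exists_Ioo_subset.1 hev
  have hδ : 0 < δ := hδ
  have hstep := fun w (h0 : 0 < w) (h1 : w < δ) => hδ2 (show w ∈ Ioo 0 δ from ⟨h0, h1⟩)
  set w := min δ 1 / 2 with hw
  have hw0 : 0 < w := by positivity
  have hwδ : w < δ := by have := min_le_left δ 1; rw [hw]; linarith [lt_min hδ one_pos]
  have hw1 : w < 1 := by have := min_le_right δ 1; rw [hw]; linarith [lt_min hδ one_pos]
  refine ⟨Q w + (Q (w / 2) - Q w) / (1 - r), ?_⟩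
  rintro _ ⟨v, hv, rfl⟩
  obtain ⟨m, hm⟩ := ((tendsto_div_two_pow w).eventually (eventually_lt_nhds hv.1)).exists
  have h2 : (1 : ℝ) ≤ 2 ^ m := one_le_pow₀ (by norm_num)
  have hm0 : 0 < w / 2 ^ m := by positivity
  have hmw : w / 2 ^ m ≤ w := div_le_self hw0.le h2
  refine (hanti ⟨hm0, hm.trans hv.2⟩ hv hm.le).trans (le_trans ?_
    (iterate_half_le hr1 (fun w h0 h1 => (hstep w h0 h1).2.1) hw0 hwδ m))
  have := (hstep _ hm0 (hmw.trans_lt hwδ)).1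
  have : 0 ≤ (Q (w / 2 ^ m / 2) - Q (w / 2 ^ m)) / (1 - r) := div_nonneg this.le (by linarith)
  linarith

lemma tendsto_tailQuantile_sSup : Tendsto Q (𝓝[>] 0) (𝓝 (sSup (Q '' Ioo 0 1))) := by
  have hb := bddAbove_tailQuantile hγ hα hanti hQ
  have hne : (Q '' Ioo 0 1).Nonempty := ⟨_, 1 / 2, ⟨by norm_num, by norm_num⟩, rfl⟩
  rw [tendsto_order]
  constructor
  · intro y hy
    obtain ⟨_, ⟨v, hv, rfl⟩, hlt⟩ := exists_lt_of_lt_csSup hne hy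
    filter_upwards [Ioo_mem_nhdsGT hv.1] with w hw
    exact hlt.trans_le (hanti ⟨hw.1, hw.2.trans hv.2⟩ hv hw.2.le)
  · intro y hy
    filter_upwards [Ioo_mem_nhdsGT (one_pos (α := ℝ))] with w hw
    exact (le_csSup hb ⟨w, hw, rfl⟩).trans_lt hy

/-- The gap to the endpoint is comparable with the normalization: summing the geometrically
decreasing dyadic increments gives the limit `1 / γ`. -/
lemma tendsto_gap_div : Tendsto (fun w => (sSup (Q '' Ioo 0 1) - Q w) / α w) (𝓝[>] 0)
    (𝓝 (1 / γ)) := by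
  set x₀ := sSup (Q '' Ioo 0 1)
  have hlim := tendsto_tailQuantile_sSup hγ hα hanti hQ
  set ρ : ℝ := (1 / 2 : ℝ) ^ γ with hρ
  have hρ1 : ρ < 1 := Real.rpow_lt_one (by norm_num) (by norm_num) hγ
  have hinc := tendsto_increment hQ (u := 1 / 2) (v := 1) (by norm_num) one_pos
  rw [Real.one_rpow, ← hρ] at hinc
  have hlimm : ∀ w, 0 < w → Tendsto (fun m : ℕ => Q (w / 2 ^ m)) atTop (𝓝 x₀) := fun w hw =>
    hlim.comp (tendsto_nhdsWithin_iff.2 ⟨tendsto_div_two_pow w,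
      Eventually.of_forall fun m => show 0 < w / 2 ^ m by positivity⟩)
  have hboth : ∀ (w q : ℝ), 0 < w → Tendsto (fun m : ℕ =>
      Q (w / 2 ^ m) + (Q (w / 2 ^ m / 2) - Q (w / 2 ^ m)) / q) atTop (𝓝 x₀) := by
    intro w q hw
    have h1 := hlimm w hw
    have h2 := (hlimm (w / 2) (by positivity)).congr fun m => by rw [div_right_comm]
    simpa using h1.add ((h2.sub h1).div_const q)
  have hratio : Tendsto (fun w => (x₀ - Q w) / (Q (w / 2) - Q w)) (𝓝[>] 0) (𝓝 (1 - ρ)⁻¹) := by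
    have hcont : ContinuousAt (fun r : ℝ => (1 - r)⁻¹) ρ :=
      (continuousAt_const.sub continuousAt_id).inv₀ (by simp; linarith)
    rw [tendsto_order]
    constructor
    · intro y hy
      have h1 := (hcont.mono_left nhdsWithin_le_nhds : Tendsto _ (𝓝[<] ρ) _).eventually
        (eventually_gt_nhds hy)
      obtain ⟨s, hs, hsρ⟩ := (h1.and self_mem_nhdsWithin).exists
      have hsρ : s < ρ := hsρ
      obtain ⟨δ, hδ, hδ2⟩ := mem_nhdsGT_iff_exists_Ioo_subset.1
        (eventually_half_ratio hγ hα hQ (lt_add_one _) hsρ)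
      have hδ : 0 < δ := hδ
      filter_upwards [Ioo_mem_nhdsGT hδ] with w hw
      have hle := ge_of_tendsto' (hboth w (1 - s) hw.1) (le_iterate_half (by linarith)
        (fun w h0 h1 => (hδ2 (show w ∈ Ioo 0 δ from ⟨h0, h1⟩)).2.2) hw.1 hw.2)
      have hA := (hδ2 hw).1
      refine hs.trans_le ?_
      rw [le_div_iff₀ hA, inv_mul_eq_div]
      linarith
    · intro y hy
      have h1 := (hcont.mono_left nhdsWithin_le_nhds : Tendsto _ (𝓝[>] ρ) _).eventually
        (eventually_lt_nhds hy)
      obtain ⟨r, ⟨hr, hrρ⟩, hr1⟩ := ((h1.and self_mem_nhdsWithin).and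
        (nhdsWithin_le_nhds (eventually_lt_nhds hρ1))).exists
      have hrρ : ρ < r := hrρ
      obtain ⟨δ, hδ, hδ2⟩ := mem_nhdsGT_iff_exists_Ioo_subset.1
        (eventually_half_ratio hγ hα hQ hrρ (sub_one_lt _))
      have hδ : 0 < δ := hδ
      filter_upwards [Ioo_mem_nhdsGT hδ] with w hw
      have hle := le_of_tendsto' (hboth w (1 - r) hw.1) (iterate_half_le hr1
        (fun w h0 h1 => (hδ2 (show w ∈ Ioo 0 δ from ⟨h0, h1⟩)).2.1) hw.1 hw.2)
      have hA := (hδ2 hw).1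
      refine lt_of_le_of_lt ?_ hr
      rw [div_le_iff₀ hA, inv_mul_eq_div]
      linarith
  have hmul := hratio.mul hinc
  rw [show (1 - ρ)⁻¹ * ((1 - ρ) / γ) = 1 / γ by
    have : 1 - ρ ≠ 0 := by linarith
    field_simp] at hmul
  refine hmul.congr' ?_
  filter_upwards [eventually_half_ratio hγ hα hQ (lt_add_one _) (sub_one_lt _)] with w hw
  have e1 : (1 / 2 : ℝ) * w = w / 2 := by ring
  have := hw.1.ne'
  have := (hα w).ne'
  simp only [one_mul, e1]
  field_simp

lemma eventually_gap_pos : ∀ᶠ w in 𝓝[>] (0 : ℝ), 0 < sSup (Q '' Ioo 0 1) - Q w := by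
  filter_upwards [(tendsto_gap_div hγ hα hanti hQ).eventually
    (eventually_gt_nhds (one_div_pos.2 hγ))] with w hw
  rwa [lt_div_iff₀ (hα w), zero_mul] at hw

/-- The gap to the endpoint is regularly varying at `0` with index `γ`. -/
lemma tendsto_gap_ratio {u : ℝ} (hu : 0 < u) :
    Tendsto (fun w => (sSup (Q '' Ioo 0 1) - Q (u * w)) / (sSup (Q '' Ioo 0 1) - Q w)) (𝓝[>] 0)
      (𝓝 (u ^ γ)) := by
  have h1 := tendsto_gap_div hγ hα hanti hQ
  have h2 := tendsto_increment hQ hu one_pos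
  have h3 := (h1.sub h2).div h1 (one_div_pos.2 hγ).ne'
  rw [Real.one_rpow, show (1 / γ - (1 - u ^ γ) / γ) / (1 / γ) = u ^ γ by field_simp; ring] at h3
  refine h3.congr' ?_
  filter_upwards with w
  have := (hα w).ne'
  simp only [Pi.div_apply, one_mul]
  rw [← sub_div, div_div_div_cancel_right₀ this]
  congr 1
  ring

end Gap

section LogTail

variable {ν : Measure ℝ} {γ : ℝ}

/-- What the domain of attraction condition gives for `log X`: a finite upper endpoint, and a
positive monotone gap to it which is regularly varying at `0` with index `γ`. -/
theorem tailGap_of_inMaxDomain (hγ : 0 < γ) (hF0 : cdf ν 0 = 0)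
    (hF : InMaxDomain (fun x => cdf ν x) (-γ)) :
    BddAbove {x | logDF (fun x => cdf ν x) x < 1} ∧
      MonotoneOn (tailGap (logDF fun x => cdf ν x)) (Ioo 0 1) ∧
      (∀ u ∈ Ioo (0 : ℝ) 1, 0 < tailGap (logDF fun x => cdf ν x) u) ∧
      ∀ u, 0 < u → Tendsto (fun w => tailGap (logDF fun x => cdf ν x) (u * w) /
        tailGap (logDF fun x => cdf ν x) w) (𝓝[>] 0) (𝓝 (u ^ γ)) := by
  obtain ⟨a, b, ha, hab⟩ := hF
  set Q : ℝ → ℝ := fun u => quantile (fun x => cdf ν x) (1 - u) with hQdef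
  have hanti : AntitoneOn Q (Ioo 0 1) := fun u hu v hv huv =>
    quantile_cdf_mono (by linarith [hv.2]) (by linarith) (by linarith [hu.1])
  have hα : ∀ w : ℝ, 0 < a ⌊1 / w⌋₊ := fun w => ha _
  have hQ : ∀ u, 0 < u → Tendsto (fun w => (Q (u * w) - b ⌊1 / w⌋₊) / a ⌊1 / w⌋₊) (𝓝[>] 0)
      (𝓝 ((1 - u ^ γ) / γ)) := fun u hu => tendsto_tailQuantile hγ ha hab hu
  have hQpos : ∀ u ∈ Ioo (0 : ℝ) 1, 0 < Q u := fun u hu =>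
    quantile_cdf_pos hF0 (by linarith [hu.2]) (by linarith [hu.1])
  set x₀ := sSup (Q '' Ioo 0 1) with hx₀
  have hbdd := bddAbove_tailQuantile hγ hα hanti hQ
  have hQle : ∀ u ∈ Ioo (0 : ℝ) 1, Q u ≤ x₀ := fun u hu => le_csSup hbdd ⟨u, hu, rfl⟩
  have hhalf : (1 / 2 : ℝ) ∈ Ioo (0 : ℝ) 1 := ⟨by norm_num, by norm_num⟩
  have hx₀pos : 0 < x₀ := (hQpos _ hhalf).trans_le (hQle _ hhalf)
  have hupper : ∀ x ∈ {x | logDF (fun x => cdf ν x) x < 1}, x ≤ Real.log x₀ := by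
    intro x (hx : cdf ν (Real.exp x) < 1)
    rw [Real.le_log_iff_exp_le hx₀pos]
    obtain ⟨v, hv, hv1⟩ := exists_between hx
    have hv0 : 0 < v := (cdf_nonneg ν _).trans_lt hv
    have h1 := (le_cdf_iff_quantile_le (ν := ν) hv0 hv1 (Real.exp x)).not.1 (not_le.2 hv)
    have h2 := hQle (1 - v) ⟨by linarith, by linarith⟩
    simp only [hQdef, sub_sub_cancel] at h2
    linarith
  have hend : upperEndpoint (logDF fun x => cdf ν x) = Real.log x₀ := by
    refine le_antisymm (csSup_le ?_ hupper) (le_of_forall_lt fun x hx => ?_)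
    · obtain ⟨y, hy⟩ : ∃ y, cdf ν 0 < y ∧ y < 1 := ⟨1 / 2, by rw [hF0]; norm_num, by norm_num⟩
      have h1 := (cdf ν).right_continuous 0
      have h2 := (h1.mono Ioi_subset_Ici_self).eventually (eventually_lt_nhds hy.1)
      obtain ⟨z, hz, hz0⟩ := (h2.and self_mem_nhdsWithin).exists
      have hz0 : 0 < z := hz0
      refine ⟨Real.log z, ?_⟩
      simp only [Set.mem_ofPred_eq, logDF, Real.exp_log hz0]
      exact hz.trans hy.2
    · obtain ⟨y, hxy, hy⟩ := exists_between hx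
      refine hxy.trans_le (le_csSup ⟨_, hupper⟩ ?_)
      rw [Real.lt_log_iff_exp_lt hx₀pos] at hy
      obtain ⟨_, ⟨v, hv, rfl⟩, hlt⟩ :=
        exists_lt_of_lt_csSup (s := Q '' Ioo 0 1) ⟨_, _, hhalf, rfl⟩ hy
      have h1 := (le_cdf_iff_quantile_le (ν := ν) (v := 1 - v) (by linarith [hv.2])
        (by linarith [hv.1]) (Real.exp y)).not.2 (not_le.2 hlt)
      simp only [Set.mem_ofPred_eq, logDF]
      linarith [hv.1]
  have hgap : ∀ u ∈ Ioo (0 : ℝ) 1,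
      tailGap (logDF fun x => cdf ν x) u = Real.log x₀ - Real.log (Q u) := by
    intro u hu
    rw [tailGap, hend, quantile_logDF hF0 (by linarith [hu.2]) (by linarith [hu.1])]
  have hmono : MonotoneOn (tailGap (logDF fun x => cdf ν x)) (Ioo 0 1) := by
    intro u hu v hv huv
    rw [hgap u hu, hgap v hv]
    have := Real.log_le_log (hQpos v hv) (hanti hu hv huv)
    linarith
  have hposev := eventually_gap_pos hγ hα hanti hQ
  refine ⟨⟨_, hupper⟩, hmono, fun u hu => ?_, fun u hu => ?_⟩
  · obtain ⟨w, hw, hw2⟩ := (hposev.and (Ioo_mem_nhdsGT hu.1)).exists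
    have hw' : w ∈ Ioo (0 : ℝ) 1 := ⟨hw2.1, hw2.2.trans hu.2⟩
    refine lt_of_lt_of_le ?_ (hmono hw' hu hw2.2.le)
    rw [hgap w hw', sub_pos]
    exact Real.log_lt_log (hQpos w hw') (by linarith)
  · have hlim := tendsto_tailQuantile_sSup hγ hα hanti hQ
    -- The logarithm is differentiable at the endpoint, so the gap of `log Q` is asymptotically
    -- proportional to the gap of `Q`.
    have hslope : Tendsto (fun w => slope Real.log x₀ (Q w)) (𝓝[>] 0) (𝓝 x₀⁻¹) := by
      refine (hasDerivAt_iff_tendsto_slope.1 (Real.hasDerivAt_log hx₀pos.ne')).comp ?_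
      refine tendsto_nhdsWithin_iff.2 ⟨hlim, ?_⟩
      filter_upwards [hposev] with w hw
      simp only [mem_compl_iff, mem_singleton_iff]
      intro h
      linarith
    have hscale : Tendsto (fun w : ℝ => u * w) (𝓝[>] 0) (𝓝[>] 0) := by
      refine tendsto_nhdsWithin_iff.2 ⟨?_, ?_⟩
      · have : Tendsto (fun w : ℝ => u * w) (𝓝 0) (𝓝 (u * 0)) := tendsto_id.const_mul u
        rw [mul_zero] at this
        exact this.mono_left nhdsWithin_le_nhds
      · filter_upwards [self_mem_nhdsWithin] with w (hw : 0 < w)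
        exact mul_pos hu hw
    have h1 := ((hslope.comp hscale).div hslope (inv_pos.2 hx₀pos).ne').mul
      (tendsto_gap_ratio hγ hα hanti hQ hu)
    rw [div_self (inv_pos.2 hx₀pos).ne', one_mul] at h1
    have hI : ∀ᶠ w in 𝓝[>] (0 : ℝ), w ∈ Ioo (0 : ℝ) 1 := Ioo_mem_nhdsGT one_pos
    refine h1.congr' ?_
    filter_upwards [hposev, hscale.eventually hposev, hI, hscale.eventually hI]
      with w (h2 : 0 < x₀ - Q w) (h3 : 0 < x₀ - Q (u * w)) h4 h5
    have h2' : Q w - x₀ ≠ 0 := by linarith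
    have h3' : Q (u * w) - x₀ ≠ 0 := by linarith
    have e1 : slope Real.log x₀ (Q w) = tailGap (logDF fun x => cdf ν x) w / (x₀ - Q w) := by
      rw [slope_def_field, hgap w h4, ← neg_sub x₀ (Q w), div_neg, ← neg_div, neg_sub]
    have e2 : slope Real.log x₀ (Q (u * w)) =
        tailGap (logDF fun x => cdf ν x) (u * w) / (x₀ - Q (u * w)) := by
      rw [slope_def_field, hgap _ h5, ← neg_sub x₀ (Q (u * w)), div_neg, ← neg_div, neg_sub]
    simp only [Pi.div_apply, Function.comp_apply, e1, e2]
    have h2'' := h2.ne'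
    have h3'' := h3.ne'
    rw [← hx₀]
    field_simp

end LogTail

/-! ### The Karamata representation -/

lemma measurable_indicator_of_monotoneOn {V : ℝ → ℝ} (hV : MonotoneOn V (Ioo 0 1)) :
    Measurable ((Ioo (0 : ℝ) 1).indicator V) := by
  refine measurable_of_restrict_of_restrict_compl (s := Ioo (0 : ℝ) 1) measurableSet_Ioo ?_ ?_
  · have h : Monotone ((Ioo (0 : ℝ) 1).domRestrict ((Ioo (0 : ℝ) 1).indicator V)) := by
      intro u v huv
      simp only [domRestrict_apply, indicator_of_mem u.2, indicator_of_mem v.2]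
      exact hV u.2 v.2 huv
    exact h.measurable
  · have h : (Ioo (0 : ℝ) 1)ᶜ.domRestrict ((Ioo (0 : ℝ) 1).indicator V) = fun _ => 0 := by
      funext u
      simp only [domRestrict_apply]
      exact indicator_of_notMem u.2 V
    rw [h]
    exact measurable_const

/-- A positive monotone gap which is regularly varying at `0` with index `γ` has a Karamata
representation. With `ℓ u = log (V u) - γ log u` (modified away from `0`), the representation uses
`b t = ℓ (t / e) - ℓ t`, so that `∫_u^1 b t / t dt` is, up to a constant, the logarithmic average of
`ℓ` over `[u / e, u]`; dominated convergence shows that this average is asymptotic to `ℓ u`. -/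
theorem exists_isKaramataRep {G : ℝ → ℝ} {γ : ℝ} (hγ : 0 < γ)
    (hmono : MonotoneOn (tailGap G) (Ioo 0 1)) (hpos : ∀ u ∈ Ioo (0 : ℝ) 1, 0 < tailGap G u)
    (hrv : ∀ u, 0 < u →
      Tendsto (fun w => tailGap G (u * w) / tailGap G w) (𝓝[>] 0) (𝓝 (u ^ γ))) :
    ∃ c p b, IsKaramataRep G γ c p b := by
  set V := tailGap G with hV
  set q : ℝ := Real.exp (-1) with hq
  have hq0 : 0 < q := Real.exp_pos _
  have hq1 : q < 1 := Real.exp_lt_one_iff.2 (by norm_num)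
  -- Capping the argument at `1 / 2` makes `W` monotone on the whole positive half-line.
  set W : ℝ → ℝ := fun u => (Ioo (0 : ℝ) 1).indicator V (min u (1 / 2)) with hW
  have hmem : ∀ u : ℝ, 0 < u → min u (1 / 2) ∈ Ioo (0 : ℝ) 1 := fun u hu =>
    ⟨lt_min hu (by norm_num), (min_le_right _ _).trans_lt (by norm_num)⟩
  have hWV : ∀ u : ℝ, 0 < u → W u = V (min u (1 / 2)) := fun u hu =>
    indicator_of_mem (hmem u hu) V
  have hWV' : ∀ u : ℝ, 0 < u → u < 1 / 2 → W u = V u := fun u hu h => by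
    rw [hWV u hu, min_eq_left h.le]
  have hWpos : ∀ u : ℝ, 0 < u → 0 < W u := fun u hu => by
    rw [hWV u hu]; exact hpos _ (hmem u hu)
  have hWmono : ∀ u v : ℝ, 0 < u → u ≤ v → W u ≤ W v := fun u v hu huv => by
    rw [hWV u hu, hWV v (hu.trans_le huv)]
    exact hmono (hmem u hu) (hmem v (hu.trans_le huv)) (min_le_min_right _ huv)
  have hWmeas : Measurable W :=
    (measurable_indicator_of_monotoneOn hmono).comp (measurable_id.min measurable_const)
  set ℓ : ℝ → ℝ := fun u => Real.log (W u) - γ * Real.log u with hℓ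
  have hℓmeas : Measurable ℓ := hWmeas.log.sub (Real.measurable_log.const_mul γ)
  have hpos_uIcc : ∀ {a b x : ℝ}, 0 < a → 0 < b → x ∈ uIcc a b → 0 < x := fun ha hb hx =>
    (lt_min ha hb).trans_le hx.1
  have hint : ∀ s a b : ℝ, 0 < s → 0 < a → 0 < b →
      IntervalIntegrable (fun r => ℓ (s * r) / r) volume a b := by
    intro s a b hs ha hb
    have h1 : IntervalIntegrable (fun r => Real.log (W (s * r))) volume a b := by
      refine MonotoneOn.intervalIntegrable fun x hx y hy hxy => ?_
      have hx0 := hpos_uIcc ha hb hx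
      exact Real.log_le_log (hWpos _ (by positivity)) (hWmono _ _ (by positivity) (by gcongr))
    have h2 : IntervalIntegrable (fun r => γ * Real.log (s * r)) volume a b := by
      refine ContinuousOn.intervalIntegrable fun x hx => ContinuousAt.continuousWithinAt ?_
      have hx0 := hpos_uIcc ha hb hx
      exact continuousAt_const.mul ((continuousAt_const.mul continuousAt_id).log
        (mul_pos hs hx0).ne')
    have h3 : ContinuousOn (fun r : ℝ => r⁻¹) (uIcc a b) := fun x hx =>
      (continuousAt_inv₀ (hpos_uIcc ha hb hx).ne').continuousWithinAt
    exact ((h1.sub h2).mul_continuousOn h3).congr fun x _ => by simp [hℓ, div_eq_mul_inv]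
  have hint1 : ∀ a b : ℝ, 0 < a → 0 < b →
      IntervalIntegrable (fun r => ℓ r / r) volume a b := by
    intro a b ha hb
    simpa using hint 1 a b one_pos ha hb
  set b : ℝ → ℝ := fun t => ℓ (q * t) - ℓ t with hb
  set M : ℝ → ℝ := fun u => ∫ s in q..1, ℓ (s * u) / s with hM
  have hMeq : ∀ u, 0 < u → M u = ∫ r in q * u..u, ℓ r / r := by
    intro u hu
    have h := intervalIntegral.mul_integral_comp_mul_right (a := q) (b := 1)
      (f := fun r => ℓ r / r) u
    rw [one_mul] at h
    rw [← h, hM, ← intervalIntegral.integral_const_mul]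
    refine intervalIntegral.integral_congr fun s hs => ?_
    have hs0 := hpos_uIcc hq0 one_pos hs
    field_simp
  have hbint : ∀ u : ℝ, 0 < u → IntervalIntegrable (fun t => b t / t) volume u 1 := by
    intro u hu
    exact ((hint q u 1 hq0 hu one_pos).sub (hint1 u 1 hu one_pos)).congr
      fun t _ => by simp [hb, sub_div]
  have hbM : ∀ u, 0 < u → ∫ t in u..1, b t / t = M u - M 1 := by
    intro u hu
    have h1 : ∫ t in u..1, b t / t = (∫ t in u..1, ℓ (q * t) / t) - ∫ t in u..1, ℓ t / t := by
      rw [← intervalIntegral.integral_sub (hint q u 1 hq0 hu one_pos) (hint1 u 1 hu one_pos)]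
      exact intervalIntegral.integral_congr fun t _ => by simp [hb, sub_div]
    have h2 : ∫ t in u..1, ℓ (q * t) / t = ∫ r in q * u..q, ℓ r / r := by
      have h := intervalIntegral.mul_integral_comp_mul_left (a := u) (b := 1)
        (f := fun r => ℓ r / r) q
      rw [mul_one] at h
      rw [← h, ← intervalIntegral.integral_const_mul]
      refine intervalIntegral.integral_congr fun t ht => ?_
      have ht0 := hpos_uIcc hu one_pos ht
      field_simp
    have hqu : 0 < q * u := by positivity
    have h3 := intervalIntegral.integral_add_adjacent_intervals (hint1 (q * u) u hqu hu)
      (hint1 u 1 hu one_pos)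
    have h4 := intervalIntegral.integral_add_adjacent_intervals (hint1 (q * u) q hqu hq0)
      (hint1 q 1 hq0 one_pos)
    rw [h1, h2, hMeq u hu, hMeq 1 one_pos, mul_one]
    linarith
  have hsmall : ∀ s : ℝ, 0 < s → ∀ᶠ u in 𝓝[>] (0 : ℝ), 0 < u ∧ u < 1 / 2 ∧ s * u < 1 / 2 := by
    intro s hs
    filter_upwards [Ioo_mem_nhdsGT (show (0 : ℝ) < 1 / 2 by norm_num),
      Ioo_mem_nhdsGT (show (0 : ℝ) < 1 / 2 / s by positivity)] with u h1 h2
    refine ⟨h1.1, h1.2, ?_⟩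
    have := (lt_div_iff₀ hs).1 h2.2
    linarith
  have hlogW : ∀ s : ℝ, 0 < s → Tendsto (fun u => Real.log (W (s * u)) - Real.log (W u)) (𝓝[>] 0)
      (𝓝 (γ * Real.log s)) := by
    intro s hs
    have h := (hrv s hs).log (Real.rpow_pos_of_pos hs γ).ne'
    rw [Real.log_rpow hs] at h
    refine h.congr' ?_
    filter_upwards [hsmall s hs] with u hu
    have hsu : 0 < s * u := mul_pos hs hu.1
    rw [hWV' _ hsu hu.2.2, hWV' _ hu.1 hu.2.1, Real.log_div]
    · exact (hpos _ ⟨hsu, by linarith [hu.2.2]⟩).ne'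
    · exact (hpos _ ⟨hu.1, by linarith [hu.2.1]⟩).ne'
  have hℓlim : ∀ s : ℝ, 0 < s → Tendsto (fun u => ℓ (s * u) - ℓ u) (𝓝[>] 0) (𝓝 0) := by
    intro s hs
    have h := (hlogW s hs).sub_const (γ * Real.log s)
    rw [sub_self] at h
    refine h.congr' ?_
    filter_upwards [self_mem_nhdsWithin] with u (hu : 0 < u)
    simp only [hℓ]
    rw [Real.log_mul hs.ne' hu.ne']
    ring
  have hMlim : Tendsto (fun u => M u - ℓ u) (𝓝[>] 0) (𝓝 0) := by
    have h1 : Tendsto (fun u => ∫ s in q..1, (ℓ (s * u) - ℓ u) / s) (𝓝[>] 0)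
        (𝓝 (∫ s in q..1, 0)) := by
      refine intervalIntegral.tendsto_integral_filter_of_dominated_convergence
        (fun _ => (2 * γ + 1) / q) ?_ ?_ intervalIntegrable_const ?_
      · exact Eventually.of_forall fun u => (show Measurable fun s => (ℓ (s * u) - ℓ u) / s by
          fun_prop).aestronglyMeasurable
      · have hev := (hlogW q hq0).eventually (eventually_gt_nhds
          (show -(γ + 1) < γ * Real.log q by rw [hq, Real.log_exp]; linarith))
        filter_upwards [hev, self_mem_nhdsWithin] with u h2 (hu : 0 < u)
        refine Eventually.of_forall fun s hs => ?_
        rw [uIoc_of_le hq1.le] at hs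
        have hs0 : 0 < s := hq0.trans hs.1
        have hlogs : -1 ≤ Real.log s ∧ Real.log s ≤ 0 := by
          refine ⟨?_, Real.log_nonpos hs0.le hs.2⟩
          have := Real.log_le_log hq0 hs.1.le
          rwa [hq, Real.log_exp] at this
        have hsu : 0 < s * u := mul_pos hs0 hu
        have h3 : Real.log (W (q * u)) ≤ Real.log (W (s * u)) :=
          Real.log_le_log (hWpos _ (by positivity))
            (hWmono _ _ (by positivity) (mul_le_mul_of_nonneg_right hs.1.le hu.le))
        have h4 : Real.log (W (s * u)) ≤ Real.log (W u) :=
          Real.log_le_log (hWpos _ hsu) (hWmono _ _ hsu (mul_le_of_le_one_left hu.le hs.2))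
        rw [Real.norm_eq_abs, abs_div, abs_of_pos hs0]
        refine div_le_div₀ (by positivity) ?_ hq0 hs.1.le
        rw [abs_le]
        simp only [hℓ]
        rw [Real.log_mul hs0.ne' hu.ne']
        constructor <;> nlinarith
      · refine Eventually.of_forall fun s hs => ?_
        rw [uIoc_of_le hq1.le] at hs
        simpa using (hℓlim s (hq0.trans hs.1)).div_const s
    rw [intervalIntegral.integral_zero] at h1
    refine h1.congr' ?_
    filter_upwards [self_mem_nhdsWithin] with u (hu : 0 < u)
    have h2 : IntervalIntegrable (fun s => ℓ (s * u) / s) volume q 1 :=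
      (hint u q 1 hu hq0 one_pos).congr fun s _ => by rw [mul_comm]
    have h3 : IntervalIntegrable (fun s => ℓ u / s) volume q 1 := by
      refine ContinuousOn.intervalIntegrable fun x hx => ContinuousAt.continuousWithinAt ?_
      exact continuousAt_const.div continuousAt_id (hpos_uIcc hq0 one_pos hx).ne'
    have h4 : ∫ s in q..1, ℓ u / s = ℓ u := by
      simp only [div_eq_mul_inv]
      rw [intervalIntegral.integral_const_mul, integral_inv_of_pos hq0 one_pos, hq, one_div,
        ← Real.exp_neg, Real.log_exp]
      ring
    simp only [sub_div]
    rw [intervalIntegral.integral_sub h2 h3, h4]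
  have hMmeas : Measurable M := by
    have h : StronglyMeasurable fun z : ℝ × ℝ => ℓ (z.2 * z.1) / z.2 :=
      (show Measurable fun z : ℝ × ℝ => ℓ (z.2 * z.1) / z.2 by fun_prop).stronglyMeasurable
    have h2 : M = fun u => ∫ s in Ioc q 1, ℓ (s * u) / s := by
      funext u
      exact intervalIntegral.integral_of_le hq1.le
    rw [h2]
    exact (h.integral_prod_right (ν := volume.restrict (Ioc q 1))).measurable
  have hVmeas := measurable_indicator_of_monotoneOn hmono
  refine ⟨Real.exp (M 1), fun u => (Ioo (0 : ℝ) 1).indicator V u /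
    (Real.exp (M 1) * u ^ γ * Real.exp (M u - M 1)) - 1, b, Real.exp_pos _, ?_, ?_, ?_, ?_,
    fun u hu => hbint u hu.1, fun u hu => ?_⟩
  · fun_prop
  · fun_prop
  · have h := (hMlim.neg.rexp).sub_const 1
    rw [neg_zero, Real.exp_zero, sub_self] at h
    refine h.congr' ?_
    filter_upwards [hsmall 1 one_pos] with u hu
    have hu0 := hu.1
    have hVu : V u = Real.exp (ℓ u) * u ^ γ := by
      rw [← hWV' u hu.1 hu.2.1, Real.rpow_def_of_pos hu0, ← Real.exp_add, mul_comm (Real.log u)]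
      simp only [hℓ, sub_add_cancel]
      rw [Real.exp_log (hWpos u hu0)]
    have hug : u ^ γ ≠ 0 := (Real.rpow_pos_of_pos hu0 γ).ne'
    rw [indicator_of_mem (show u ∈ Ioo (0 : ℝ) 1 from ⟨hu0, by linarith [hu.2.1]⟩), hVu,
      neg_sub, mul_right_comm, ← Real.exp_add, add_sub_cancel, mul_div_mul_right _ _ hug,
      ← Real.exp_sub]
  · exact hℓlim q hq0
  · have hug : u ^ γ ≠ 0 := (Real.rpow_pos_of_pos hu.1 γ).ne'
    rw [hbM u hu.1, indicator_of_mem hu]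
    field_simp
    ring

/-! ### The Hill process in terms of the uniform order statistics -/

section Sample

variable {Ω : Type*} {U : ℕ → Ω → ℝ} {ω : Ω} {k n : ℕ}

lemma ordU_mem (hU : ∀ i, U i ω ∈ Ioo (0 : ℝ) 1) {j : ℕ} (hj : 1 ≤ j) (hjn : j ≤ n) :
    ordU U n j ω ∈ Ioo (0 : ℝ) 1 := by
  obtain ⟨i, -, hi⟩ := orderStat_mem (fun i => U i ω) hj hjn
  rw [ordU, hi]
  exact hU i

lemma ordU_mono (U : ℕ → Ω → ℝ) (ω : Ω) {i j : ℕ} (hi : 1 ≤ i) (hij : i ≤ j) (hjn : j ≤ n) :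
    ordU U n i ω ≤ ordU U n j ω := orderStat_mono _ hi hij hjn

lemma log_ordX {ν : Measure ℝ} (hF0 : cdf ν 0 = 0) (hU : ∀ i, U i ω ∈ Ioo (0 : ℝ) 1) {j : ℕ}
    (hj : 1 ≤ j) (hjn : j ≤ n) :
    Real.log (ordX (fun x => cdf ν x) U n (n - j + 1) ω) =
      quantile (logDF fun x => cdf ν x) (1 - ordU U n j ω) := by
  have hanti : AntitoneOn (fun u => quantile (fun x => cdf ν x) (1 - u)) (Ioo (0 : ℝ) 1) :=
    fun u hu v hv huv => quantile_cdf_mono (by linarith [hv.2]) (by linarith) (by linarith [hu.1])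
  have hmem := ordU_mem hU hj hjn
  rw [quantile_logDF hF0 (by linarith [hmem.2]) (by linarith [hmem.1])]
  exact congrArg Real.log (orderStat_antitone (x := fun i => U i ω) hU hanti hj hjn)

lemma hillS_eq {ν : Measure ℝ} (hF0 : cdf ν 0 = 0) (hU : ∀ i, U i ω ∈ Ioo (0 : ℝ) 1)
    (hk : 1 ≤ k) (hkn : k ≤ n) :
    hillS (fun x => cdf ν x) U k n ω = tailGap (logDF fun x => cdf ν x) (ordU U n k ω) := by
  rw [hillS, log_ordX hF0 hU hk hkn, tailGap]

lemma hillT_eq {ν : Measure ℝ} (hF0 : cdf ν 0 = 0) (hU : ∀ i, U i ω ∈ Ioo (0 : ℝ) 1)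
    (f : ℕ → ℝ) (hkn : k + 1 ≤ n) :
    hillT (fun x => cdf ν x) U f k n ω = ∑ j ∈ Finset.Icc 1 k, f j *
      (tailGap (logDF fun x => cdf ν x) (ordU U n (j + 1) ω) -
        tailGap (logDF fun x => cdf ν x) (ordU U n j ω)) := by
  refine Finset.sum_congr rfl fun j hj => ?_
  rw [Finset.mem_Icc] at hj
  have h1 := log_ordX hF0 hU hj.1 (by omega : j ≤ n)
  have h2 := log_ordX hF0 hU (by omega : 1 ≤ j + 1) (by omega : j + 1 ≤ n)
  rw [show n - (j + 1) + 1 = n - j by omega] at h2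
  rw [h1, h2, tailGap, tailGap]
  ring

lemma malmquistE_div {j : ℕ} (hj : 1 ≤ j) :
    malmquistE U n j ω / j = Real.log (ordU U n (j + 1) ω / ordU U n j ω) := by
  have : (j : ℝ) ≠ 0 := by positivity
  rw [malmquistE, mul_div_cancel_left₀ _ this]

lemma fExp_eq (γ : ℝ) {j : ℕ} (hj : 1 ≤ j) :
    fExp γ U n j ω = Real.log (ordU U n (j + 1) ω / ordU U n j ω) * γ := by
  rw [fExp, mul_div_assoc, malmquistE_div hj, mul_comm]

lemma exp_fExp (hU : ∀ i, U i ω ∈ Ioo (0 : ℝ) 1) (γ : ℝ) {j : ℕ} (hj : 1 ≤ j) (hjn : j + 1 ≤ n) :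
    Real.exp (fExp γ U n j ω) = (ordU U n (j + 1) ω / ordU U n j ω) ^ γ := by
  have h1 := (ordU_mem hU hj (by omega : j ≤ n)).1
  have h2 := (ordU_mem hU (by omega : 1 ≤ j + 1) hjn).1
  rw [fExp_eq γ hj, Real.rpow_def_of_pos (div_pos h2 h1)]

lemma fStar_eq (hU : ∀ i, U i ω ∈ Ioo (0 : ℝ) 1) (γ : ℝ) {j : ℕ} (hj : 1 ≤ j) (hjk : j ≤ k)
    (hkn : k ≤ n) : fStar γ U k n j ω = (ordU U n j ω / ordU U n k ω) ^ γ := by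
  have hpos : ∀ i, 1 ≤ i → i ≤ k → 0 < ordU U n i ω := fun i h1 h2 =>
    (ordU_mem hU h1 (h2.trans hkn)).1
  induction hjk using Nat.decreasingInduction with
  | self => simp [fStar, div_self (hpos k hj le_rfl).ne']
  | of_succ i hi ih =>
    have h1 := hpos i hj hi.le
    have h2 := hpos (i + 1) (by omega) hi
    have h3 := hpos k (by omega) le_rfl
    have h4 : fStar γ U k n i ω = (Real.exp (fExp γ U n i ω))⁻¹ * fStar γ U k n (i + 1) ω := by
      rw [fStar, fStar, Finset.sum_eq_sum_Ico_succ_bot hi, neg_add, Real.exp_add, Real.exp_neg]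
    rw [h4, ih (by omega), exp_fExp hU γ hj (by omega), ← Real.inv_rpow (by positivity),
      ← Real.mul_rpow (by positivity) (by positivity)]
    congr 1
    field_simp

lemma fStar_mul_exp (hU : ∀ i, U i ω ∈ Ioo (0 : ℝ) 1) (γ : ℝ) {j : ℕ} (hj : 1 ≤ j) (hjk : j ≤ k)
    (hkn : k + 1 ≤ n) : fStar γ U k n j ω * Real.exp (fExp γ U n j ω) =
      (ordU U n (j + 1) ω / ordU U n k ω) ^ γ := by
  have h1 := (ordU_mem hU hj (by omega : j ≤ n)).1
  have h2 := (ordU_mem hU (by omega : 1 ≤ j + 1) (by omega : j + 1 ≤ n)).1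
  have h3 := (ordU_mem hU (hj.trans hjk) (by omega : k ≤ n)).1
  rw [fStar_eq hU γ hj hjk (by omega), exp_fExp hU γ hj (by omega),
    ← Real.mul_rpow (by positivity) (by positivity)]
  congr 1
  field_simp

lemma fStar_pos (γ : ℝ) (U : ℕ → Ω → ℝ) (k n j : ℕ) (ω : Ω) : 0 < fStar γ U k n j ω :=
  Real.exp_pos _

lemma fExp_nonneg {γ : ℝ} (hγ : 0 < γ) (hU : ∀ i, U i ω ∈ Ioo (0 : ℝ) 1) {j : ℕ} (hj : 1 ≤ j)
    (hjn : j + 1 ≤ n) : 0 ≤ fExp γ U n j ω := by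
  rw [fExp_eq γ hj]
  refine mul_nonneg (Real.log_nonneg ?_) hγ.le
  rw [one_le_div (ordU_mem hU hj (by omega : j ≤ n)).1]
  exact ordU_mono U ω hj (by omega) hjn

lemma fStar_le_one {γ : ℝ} (hγ : 0 < γ) (hU : ∀ i, U i ω ∈ Ioo (0 : ℝ) 1) {j : ℕ} (hj : 1 ≤ j)
    (hkn : k ≤ n) : fStar γ U k n j ω ≤ 1 := by
  rw [fStar, Real.exp_le_one_iff, neg_nonpos]
  refine Finset.sum_nonneg fun i hi => ?_
  rw [Finset.mem_Ico] at hi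
  exact fExp_nonneg hγ hU (by omega) (by omega)

lemma fStar_mul_exp_le {γ : ℝ} (hγ : 0 < γ) (hU : ∀ i, U i ω ∈ Ioo (0 : ℝ) 1) {j : ℕ}
    (hj : 1 ≤ j) (hjk : j ≤ k) (hkn : k + 1 ≤ n) :
    fStar γ U k n j ω * Real.exp (fExp γ U n j ω) ≤ Real.exp (fExp γ U n k ω) := by
  have h2 := (ordU_mem hU (by omega : 1 ≤ j + 1) (by omega : j + 1 ≤ n)).1
  have h3 := (ordU_mem hU (hj.trans hjk) (by omega : k ≤ n)).1
  rw [fStar_mul_exp hU γ hj hjk hkn, exp_fExp hU γ (hj.trans hjk) hkn]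
  refine Real.rpow_le_rpow (by positivity) ?_ hγ.le
  gcongr
  exact ordU_mono U ω (by omega) (by omega) hkn

variable {f : ℕ → ℝ} {B : ℝ}

/-- The main sum is dominated by a telescoping sum. -/
lemma mainSum_le {γ : ℝ} (hγ : 0 < γ) (hU : ∀ i, U i ω ∈ Ioo (0 : ℝ) 1)
    (hf : ∀ j, 1 ≤ j → 0 < f j) (hB : ∀ j, 1 ≤ j → f j ≤ B) (hk : 1 ≤ k) (hkn : k + 1 ≤ n) :
    mainSum γ U f k n ω ≤ B * Real.exp (fExp γ U n k ω) := by
  set g : ℕ → ℝ := fun j => (ordU U n j ω / ordU U n k ω) ^ γ with hg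
  have htel : ∀ m : ℕ, ∑ j ∈ Finset.Icc 1 m, (g (j + 1) - g j) = g (m + 1) - g 1 := by
    intro m
    induction m with
    | zero => simp
    | succ m ih => rw [Finset.sum_Icc_succ_top (by omega), ih]; ring
  have hB0 : 0 ≤ B := (hf 1 le_rfl).le.trans (hB 1 le_rfl)
  have h3 := (ordU_mem hU hk (by omega : k ≤ n)).1
  have h1 := (ordU_mem hU le_rfl (by omega : 1 ≤ n)).1
  calc mainSum γ U f k n ω ≤ ∑ j ∈ Finset.Icc 1 k, B * (g (j + 1) - g j) := by
        refine Finset.sum_le_sum fun j hj => ?_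
        rw [Finset.mem_Icc] at hj
        have e1 : f j * fStar γ U k n j ω * (Real.exp (fExp γ U n j ω) - 1) =
            f j * (g (j + 1) - g j) := by
          rw [mul_assoc, mul_sub, mul_one, fStar_mul_exp hU γ hj.1 hj.2 hkn,
            fStar_eq hU γ hj.1 hj.2 (by omega)]
        rw [e1]
        refine mul_le_mul_of_nonneg_right (hB j hj.1) (sub_nonneg.2 ?_)
        have h2 := (ordU_mem hU hj.1 (by omega : j ≤ n)).1
        refine Real.rpow_le_rpow (by positivity) ?_ hγ.le
        gcongr
        exact ordU_mono U ω hj.1 (by omega) (by omega)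
    _ = B * (g (k + 1) - g 1) := by rw [← Finset.mul_sum, htel]
    _ ≤ B * Real.exp (fExp γ U n k ω) := by
        refine mul_le_mul_of_nonneg_left ?_ hB0
        rw [exp_fExp hU γ hk hkn]
        have : 0 ≤ g 1 := by positivity
        linarith

lemma sum_fStar_exp_le {γ : ℝ} (hγ : 0 < γ) (hU : ∀ i, U i ω ∈ Ioo (0 : ℝ) 1)
    (hf : ∀ j, 1 ≤ j → 0 < f j) (hB : ∀ j, 1 ≤ j → f j ≤ B) (hkn : k + 1 ≤ n) :
    ∑ j ∈ Finset.Icc 1 k, f j * fStar γ U k n j ω * Real.exp (fExp γ U n j ω) ≤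
      k * (B * Real.exp (fExp γ U n k ω)) := by
  have hB0 : 0 ≤ B := (hf 1 le_rfl).le.trans (hB 1 le_rfl)
  have : ∑ _j ∈ Finset.Icc 1 k, B * Real.exp (fExp γ U n k ω) =
      k * (B * Real.exp (fExp γ U n k ω)) := by simp
  rw [← this]
  refine Finset.sum_le_sum fun j hj => ?_
  rw [Finset.mem_Icc] at hj
  rw [mul_assoc]
  refine mul_le_mul (hB j hj.1) (fStar_mul_exp_le hγ hU hj.1 hj.2 hkn) ?_ hB0
  exact mul_nonneg (fStar_pos ..).le (Real.exp_pos _).le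

end Sample

/-! ### Deterministic error bounds -/

/-- The sample lies in `(0, 1)`, the functions `p` and `b` are small up to `U_{k+1,n}`, and both the
logarithmic range of the first `k + 1` order statistics and the error `c_n` are controlled by `K`.
-/
structure GoodSample {Ω : Type*} (γ : ℝ) (p b : ℝ → ℝ) (U : ℕ → Ω → ℝ) (k n : ℕ) (K : ℝ)
    (ω : Ω) : Prop where
  mem : ∀ i, U i ω ∈ Ioo (0 : ℝ) 1
  one_le : 1 ≤ k
  lt : k + 1 ≤ n
  p_le : ∀ u, 0 < u → u ≤ ordU U n (k + 1) ω → |p u| ≤ 1 / 2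
  b_le : ∀ u, 0 < u → u ≤ ordU U n (k + 1) ω → |b u| ≤ γ
  log_le : Real.log (ordU U n (k + 1) ω / ordU U n 1 ω) ≤ K * Real.log (k + 1)
  err_le : errC p b U k n ω ≤ K

/-- The constant in the deterministic error bounds. -/
noncomputable def errConst (γ K : ℝ) : ℝ := Real.exp (K * K) * (K + 2 / γ + 8)

lemma supAbs_nonneg {Ω : Type*} (q : ℝ → ℝ) (U : ℕ → Ω → ℝ) (k n : ℕ) (ω : Ω) :
    0 ≤ supAbs q U k n ω := by
  refine Real.sSup_nonneg ?_
  rintro _ ⟨u, -, rfl⟩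
  exact abs_nonneg _

lemma abs_le_supAbs {Ω : Type*} {q : ℝ → ℝ} {U : ℕ → Ω → ℝ} {k n : ℕ} {ω : Ω} {C : ℝ}
    (h : ∀ u, 0 < u → u ≤ ordU U n (k + 1) ω → |q u| ≤ C) {u : ℝ} (h0 : 0 < u)
    (hu : u ≤ ordU U n (k + 1) ω) : |q u| ≤ supAbs q U k n ω := by
  refine le_csSup ⟨C, ?_⟩ ⟨u, ⟨h0, hu⟩, rfl⟩
  rintro _ ⟨v, hv, rfl⟩
  exact h v hv.1 hv.2

lemma supAbs_le {Ω : Type*} {q : ℝ → ℝ} {U : ℕ → Ω → ℝ} {k n : ℕ} {ω : Ω} {C : ℝ}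
    (hC : 0 ≤ C) (h : ∀ u, 0 < u → u ≤ ordU U n (k + 1) ω → |q u| ≤ C) :
    supAbs q U k n ω ≤ C := by
  refine Real.sSup_le ?_ hC
  rintro _ ⟨v, hv, rfl⟩
  exact h v hv.1 hv.2

lemma abs_exp_sub_one_le_mul {β θ F : ℝ} (hθ : 0 ≤ θ) (hθ1 : θ ≤ 1)
    (hβ : |β| ≤ θ * F) : |Real.exp β - 1| ≤ θ * (Real.exp F - 1) := by
  have hconv : Real.exp (θ * F) - 1 ≤ θ * (Real.exp F - 1) := by
    have := convexOn_exp.2 (mem_univ F) (mem_univ 0) hθ (sub_nonneg.2 hθ1) (by ring)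
    simp only [smul_eq_mul, mul_zero, add_zero, Real.exp_zero] at this
    linarith
  refine le_trans ?_ hconv
  rw [abs_le] at hβ ⊢
  have h1 : Real.exp β ≤ Real.exp (θ * F) := Real.exp_le_exp.2 hβ.2
  have h2 : Real.exp (-(θ * F)) ≤ Real.exp β := Real.exp_le_exp.2 (by linarith)
  have h3 : 2 - Real.exp (θ * F) ≤ Real.exp (-(θ * F)) := by
    have h4 : 0 < Real.exp (θ * F) := Real.exp_pos _
    have h5 : Real.exp (-(θ * F)) * Real.exp (θ * F) = 1 := by
      rw [← Real.exp_add]; simp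
    nlinarith [sq_nonneg (Real.exp (θ * F) - 1)]
  constructor <;> linarith

lemma abs_exp_sub_one_le_mul_exp (x : ℝ) : |Real.exp x - 1| ≤ |x| * Real.exp |x| := by
  have h1 : 1 ≤ Real.exp |x| := Real.one_le_exp (abs_nonneg x)
  have h2 : |x| ≤ |x| * Real.exp |x| := le_mul_of_one_le_right (abs_nonneg x) h1
  have h3 := Real.add_one_le_exp x
  have h4 : Real.exp x - 1 ≤ x * Real.exp x := by
    have h5 := Real.add_one_le_exp (-x)
    have h6 : Real.exp (-x) * Real.exp x = 1 := by rw [← Real.exp_add]; simp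
    nlinarith [Real.exp_pos x]
  have h7 : x * Real.exp x ≤ |x| * Real.exp |x| :=
    mul_le_mul (le_abs_self x) (Real.exp_le_exp.2 (le_abs_self x)) (Real.exp_pos x).le
      (abs_nonneg x)
  rw [abs_le]
  constructor <;> linarith [neg_abs_le x]

lemma abs_ratio_sub_one_le {x y P : ℝ} (hx : |x| ≤ P) (hy : |y| ≤ P) (hP : P ≤ 1 / 2) :
    |(1 + x) / (1 + y) - 1| ≤ 4 * P := by
  rw [abs_le] at hx hy
  have hy0 : 0 < 1 + y := by linarith
  rw [div_sub_one hy0.ne', abs_div, abs_of_pos hy0, div_le_iff₀ hy0, abs_le]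
  constructor <;> nlinarith

section Bounds

variable {Ω : Type*} {U : ℕ → Ω → ℝ} {ω : Ω} {k n : ℕ} {G : ℝ → ℝ} {γ c K : ℝ} {p b : ℝ → ℝ}

lemma GoodSample.errC_nonneg (_ : GoodSample γ p b U k n K ω) : 0 ≤ errC p b U k n ω :=
  (supAbs_nonneg p U k n ω).trans (le_max_left _ _)

lemma GoodSample.nonneg (h : GoodSample γ p b U k n K ω) : 0 ≤ K := h.errC_nonneg.trans h.err_le

lemma GoodSample.supAbs_b_le (h : GoodSample γ p b U k n K ω) :
    supAbs b U k n ω ≤ 2 * errC p b U k n ω := by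
  have h1 : supAbs b U k n ω * Real.log (k + 1) ≤ errC p b U k n ω := le_max_right _ _
  have h2 : (1 : ℝ) / 2 ≤ Real.log (k + 1) := by
    have h3 : Real.log 2 ≤ Real.log (k + 1) := by
      refine Real.log_le_log (by norm_num) ?_
      have : (1 : ℝ) ≤ k := by exact_mod_cast h.one_le
      linarith
    linarith [Real.log_two_gt_d9]
  nlinarith [supAbs_nonneg b U k n ω]

lemma errConst_nonneg (hγ : 0 < γ) (hK : 0 ≤ K) : 0 ≤ errConst γ K := by
  unfold errConst
  positivity

/-- The integral of `b t / t` between two of the first `k + 1` order statistics. -/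
lemma GoodSample.abs_integral_le (h : GoodSample γ p b U k n K ω) {x y : ℝ}
    (hx : 0 < x) (hxy : x ≤ y) (hy : y ≤ ordU U n (k + 1) ω) :
    |∫ t in x..y, b t / t| ≤ supAbs b U k n ω * Real.log (y / x) := by
  have hy0 := hx.trans_le hxy
  have h1 := intervalIntegral.norm_integral_le_of_norm_le (μ := volume) hxy
    (f := fun t => b t / t) (g := fun t => supAbs b U k n ω * t⁻¹)
    (Eventually.of_forall fun t ht => by
      have ht0 : 0 < t := hx.trans ht.1
      rw [Real.norm_eq_abs, abs_div, abs_of_pos ht0, div_eq_mul_inv]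
      refine mul_le_mul_of_nonneg_right ?_ (inv_pos.2 ht0).le
      exact abs_le_supAbs h.b_le ht0 (ht.2.trans hy))
    ((intervalIntegral.intervalIntegrable_inv (fun t ht => by
      rw [uIcc_of_le hxy] at ht
      exact (hx.trans_le ht.1).ne') continuousOn_id).const_mul _)
  rwa [Real.norm_eq_abs, intervalIntegral.integral_const_mul, integral_inv_of_pos hx hy0] at h1

lemma tailGap_ratio (hrep : IsKaramataRep G γ c p b) {x y : ℝ} (hx : x ∈ Ioo (0 : ℝ) 1)
    (hy : y ∈ Ioo (0 : ℝ) 1) : tailGap G x / tailGap G y =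
      (x / y) ^ γ * ((1 + p x) / (1 + p y) * Real.exp (∫ t in x..y, b t / t)) := by
  have hint := intervalIntegral.integral_interval_sub_left
    (hrep.integrable x hx).symm (hrep.integrable y hy).symm
  rw [intervalIntegral.integral_symm x 1, intervalIntegral.integral_symm y 1] at hint
  have hint2 : ∫ t in x..y, b t / t = (∫ t in x..1, b t / t) - ∫ t in y..1, b t / t := by
    rw [intervalIntegral.integral_symm y x, ← hint]
    ring
  rw [hrep.eq x hx, hrep.eq y hy, hint2, Real.exp_sub, Real.div_rpow hx.1.le hy.1.le]
  have h1 := hrep.c_pos.ne'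
  have h2 := (Real.rpow_pos_of_pos hy.1 γ).ne'
  have h3 := (Real.exp_pos (∫ t in y..1, b t / t)).ne'
  rw [mul_assoc c, mul_assoc c, mul_assoc c, mul_assoc c, mul_div_mul_left _ _ h1]
  rw [mul_div_mul_comm, mul_div_mul_comm]
  ring

lemma GoodSample.tailGap_pos (h : GoodSample γ p b U k n K ω) (hrep : IsKaramataRep G γ c p b)
    {j : ℕ} (hj : 1 ≤ j) (hjk : j ≤ k + 1) : 0 < tailGap G (ordU U n j ω) := by
  have hm := ordU_mem h.mem hj (hjk.trans h.lt)
  have hp := (abs_le.1 (h.p_le _ hm.1 (ordU_mono U ω hj hjk h.lt))).1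
  rw [hrep.eq _ hm]
  have := hrep.c_pos
  have := Real.rpow_pos_of_pos hm.1 γ
  have : 0 < 1 + p (ordU U n j ω) := by linarith
  positivity

/-- The two ingredients of the multiplicative error at `U_{j,n}`. -/
lemma GoodSample.factor_bounds (h : GoodSample γ p b U k n K ω) {j : ℕ} (hj : 1 ≤ j)
    (hjk : j ≤ k + 1) :
    |(1 + p (ordU U n j ω)) / (1 + p (ordU U n k ω)) - 1| ≤ 4 * supAbs p U k n ω ∧
    |Real.exp (∫ t in ordU U n j ω..ordU U n k ω, b t / t) - 1| ≤
      K * Real.exp (K * K) * errC p b U k n ω ∧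
    Real.exp (∫ t in ordU U n j ω..ordU U n k ω, b t / t) ≤ Real.exp (K * K) := by
  have hkn := h.lt
  have hk := h.one_le
  have hj0 := (ordU_mem h.mem hj (by omega : j ≤ n)).1
  have hk0 := (ordU_mem h.mem hk (by omega : k ≤ n)).1
  have h10 := (ordU_mem h.mem le_rfl (by omega : 1 ≤ n)).1
  have hk10 := (ordU_mem h.mem (by omega : 1 ≤ k + 1) hkn).1
  have hjle := ordU_mono U ω hj hjk hkn
  have hkle := ordU_mono U ω hk (by omega : k ≤ k + 1) hkn
  refine ⟨abs_ratio_sub_one_le (abs_le_supAbs h.p_le hj0 hjle) (abs_le_supAbs h.p_le hk0 hkle)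
    (supAbs_le (by norm_num) h.p_le), ?_⟩
  have hI : |∫ t in ordU U n j ω..ordU U n k ω, b t / t| ≤ K * errC p b U k n ω := by
    have h1 : |∫ t in ordU U n j ω..ordU U n k ω, b t / t| ≤
        supAbs b U k n ω * Real.log (ordU U n (k + 1) ω / ordU U n 1 ω) := by
      rcases le_total (ordU U n j ω) (ordU U n k ω) with hle | hle
      · refine (h.abs_integral_le hj0 hle hkle).trans ?_
        refine mul_le_mul_of_nonneg_left (Real.log_le_log (by positivity) ?_)
          (supAbs_nonneg _ _ _ _ _)
        exact div_le_div₀ hk10.le hkle h10 (ordU_mono U ω le_rfl hj (by omega))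
      · rw [intervalIntegral.integral_symm, abs_neg]
        refine (h.abs_integral_le hk0 hle hjle).trans ?_
        refine mul_le_mul_of_nonneg_left (Real.log_le_log (by positivity) ?_)
          (supAbs_nonneg _ _ _ _ _)
        exact div_le_div₀ hk10.le hjle h10 (ordU_mono U ω le_rfl hk (by omega))
    refine h1.trans ((mul_le_mul_of_nonneg_left h.log_le (supAbs_nonneg _ _ _ _ _)).trans ?_)
    rw [mul_left_comm]
    exact mul_le_mul_of_nonneg_left (le_max_right _ _) h.nonneg
  have hKK : K * errC p b U k n ω ≤ K * K := mul_le_mul_of_nonneg_left h.err_le h.nonneg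
  generalize (∫ t in ordU U n j ω..ordU U n k ω, b t / t) = I at hI
  constructor
  · refine (abs_exp_sub_one_le_mul_exp I).trans ?_
    have : |I| * Real.exp |I| ≤ (K * errC p b U k n ω) * Real.exp (K * K) :=
      mul_le_mul hI (Real.exp_le_exp.2 (hI.trans hKK)) (Real.exp_pos _).le
        (mul_nonneg h.nonneg h.errC_nonneg)
    linarith
  · exact Real.exp_le_exp.2 ((le_abs_self I).trans (hI.trans hKK))

end Bounds

section Bounds

variable {Ω : Type*} {U : ℕ → Ω → ℝ} {ω : Ω} {k n : ℕ} {γ c K : ℝ} {p b : ℝ → ℝ}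

/-- The relative error in replacing `V(u_j) / V(u_k)` by `F_j^*` is of order `c_n`. -/
lemma GoodSample.abs_weight_sub_le {G : ℝ → ℝ} (hγ : 0 < γ) (h : GoodSample γ p b U k n K ω)
    (hrep : IsKaramataRep G γ c p b) {j : ℕ} (hj : 1 ≤ j) (hjk : j ≤ k) :
    |tailGap G (ordU U n j ω) / tailGap G (ordU U n k ω) - fStar γ U k n j ω| ≤
      errConst γ K * errC p b U k n ω * fStar γ U k n j ω := by
  have hkn := h.lt
  have hk := h.one_le
  have hK := h.nonneg
  rw [tailGap_ratio hrep (ordU_mem h.mem hj (by omega)) (ordU_mem h.mem hk (by omega)),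
    ← fStar_eq h.mem γ hj hjk (by omega)]
  obtain ⟨h1, h2, h3⟩ := h.factor_bounds hj (by omega : j ≤ k + 1)
  have hc : supAbs p U k n ω ≤ errC p b U k n ω := le_max_left _ _
  have hp := supAbs_nonneg p U k n ω
  have hs := fStar_pos γ U k n j ω
  have he : 0 < Real.exp (K * K) := Real.exp_pos _
  generalize (1 + p (ordU U n j ω)) / (1 + p (ordU U n k ω)) = r at h1 ⊢
  generalize hX : Real.exp (∫ t in ordU U n j ω..ordU U n k ω, b t / t) = X at h2 h3 ⊢
  have hX0 : 0 < X := by rw [← hX]; exact Real.exp_pos _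
  have key : |r * X - 1| ≤ errConst γ K * errC p b U k n ω := by
    calc |r * X - 1| = |(r - 1) * X + (X - 1)| := by congr 1; ring
      _ ≤ |r - 1| * X + |X - 1| := by
        refine (abs_add_le _ _).trans ?_
        rw [abs_mul, abs_of_pos hX0]
      _ ≤ 4 * errC p b U k n ω * Real.exp (K * K) + K * Real.exp (K * K) * errC p b U k n ω := by
        refine add_le_add (mul_le_mul (by linarith) h3 hX0.le (by linarith)) h2
      _ ≤ errConst γ K * errC p b U k n ω := by
        have : 0 ≤ Real.exp (K * K) * (2 / γ + 4) * errC p b U k n ω := by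
          have := h.errC_nonneg
          positivity
        unfold errConst
        linarith
  rw [show fStar γ U k n j ω * (r * X) - fStar γ U k n j ω =
    (r * X - 1) * fStar γ U k n j ω by ring, abs_mul, abs_of_pos hs]
  exact mul_le_mul_of_nonneg_right key hs.le

/-- The error in one summand of the Hill process: the function `b` only contributes in proportion to
the increment `F_j^* (exp F_j - 1)` itself, whereas `p`, which has no regularity, contributes in
proportion to `F_j^* exp F_j`. -/
lemma GoodSample.abs_increment_sub_le {G : ℝ → ℝ} (hγ : 0 < γ)
    (h : GoodSample γ p b U k n K ω) (hrep : IsKaramataRep G γ c p b) {j : ℕ} (hj : 1 ≤ j)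
    (hjk : j ≤ k) :
    |(tailGap G (ordU U n (j + 1) ω) - tailGap G (ordU U n j ω)) / tailGap G (ordU U n k ω) -
      fStar γ U k n j ω * (Real.exp (fExp γ U n j ω) - 1)| ≤
      errConst γ K * (errC p b U k n ω * (fStar γ U k n j ω * (Real.exp (fExp γ U n j ω) - 1)) +
        supAbs p U k n ω * (fStar γ U k n j ω * Real.exp (fExp γ U n j ω))) := by
  have hkn := h.lt
  have hk := h.one_le
  have hK := h.nonneg
  have hmj := ordU_mem h.mem hj (by omega : j ≤ n)
  have hmj1 := ordU_mem h.mem (by omega : 1 ≤ j + 1) (by omega : j + 1 ≤ n)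
  have hmk := ordU_mem h.mem hk (by omega : k ≤ n)
  have hle := ordU_mono U ω hj (Nat.le_succ j) (by omega : j + 1 ≤ n)
  have hFnn := fExp_nonneg hγ h.mem hj (by omega : j + 1 ≤ n)
  rw [sub_div, tailGap_ratio hrep hmj1 hmk, tailGap_ratio hrep hmj hmk,
    ← fStar_eq h.mem γ hj hjk (by omega), ← fStar_mul_exp h.mem γ hj hjk hkn]
  obtain ⟨h1, -, h3⟩ := h.factor_bounds hj (by omega : j ≤ k + 1)
  obtain ⟨h1', h2', h3'⟩ := h.factor_bounds (by omega : 1 ≤ j + 1) (by omega : j + 1 ≤ k + 1)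
  -- The exponential factors at `U_{j,n}` and `U_{j+1,n}` differ by `exp β` with `β` small compared
  -- with `F_j`, which is what produces an error proportional to `exp F_j - 1`.
  set β := ∫ t in ordU U n j ω..ordU U n (j + 1) ω, b t / t with hβdef
  have hsplit : ∫ t in ordU U n j ω..ordU U n k ω, b t / t =
      β + ∫ t in ordU U n (j + 1) ω..ordU U n k ω, b t / t := by
    have hij : ∀ {x y : ℝ}, x ∈ Ioo (0 : ℝ) 1 → y ∈ Ioo (0 : ℝ) 1 →
        IntervalIntegrable (fun t => b t / t) volume x y := fun hx hy =>
      (hrep.integrable _ hx).trans (hrep.integrable _ hy).symm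
    exact (intervalIntegral.integral_add_adjacent_intervals (hij hmj hmj1) (hij hmj1 hmk)).symm
  have hbn := supAbs_nonneg b U k n ω
  have hbγ : supAbs b U k n ω ≤ γ := supAbs_le hγ.le h.b_le
  have hβ : |Real.exp β - 1| ≤ supAbs b U k n ω / γ * (Real.exp (fExp γ U n j ω) - 1) := by
    refine abs_exp_sub_one_le_mul (by positivity) ((div_le_one hγ).2 hbγ) ?_
    refine (h.abs_integral_le hmj.1 hle (ordU_mono U ω (by omega) (by omega) hkn)).trans ?_
    rw [fExp_eq γ hj]
    refine le_of_eq ?_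
    field_simp
  have hbc := h.supAbs_b_le
  have hp := supAbs_nonneg p U k n ω
  have hc := h.errC_nonneg
  have hs := fStar_pos γ U k n j ω
  have he : 0 < Real.exp (K * K) := Real.exp_pos _
  have hF1 : 1 ≤ Real.exp (fExp γ U n j ω) := Real.one_le_exp hFnn
  rw [hsplit, Real.exp_add] at h3 ⊢
  generalize (1 + p (ordU U n j ω)) / (1 + p (ordU U n k ω)) = r at h1 ⊢
  generalize (1 + p (ordU U n (j + 1) ω)) / (1 + p (ordU U n k ω)) = r' at h1' ⊢
  generalize hX : Real.exp (∫ t in ordU U n (j + 1) ω..ordU U n k ω, b t / t) = X at h2' h3' h3 ⊢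
  have hX0 : 0 < X := by rw [← hX]; exact Real.exp_pos _
  generalize Real.exp (fExp γ U n j ω) = e at hβ hF1 ⊢
  have hY0 : 0 < Real.exp β := Real.exp_pos _
  generalize Real.exp β = Y at hβ h3 hY0 ⊢
  generalize supAbs p U k n ω = P at *
  generalize errC p b U k n ω = C at *
  generalize supAbs b U k n ω = D at *
  generalize fStar γ U k n j ω = s at *
  rw [show s * e * (r' * X) - s * (r * (Y * X)) - s * (e - 1) =
      s * ((e - 1) * (X - 1) - X * (Y - 1) + e * ((r' - 1) * X) - (r - 1) * (Y * X)) by ring,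
    show errConst γ K * (C * (s * (e - 1)) + P * (s * e)) =
      s * (errConst γ K * (C * (e - 1) + P * e)) by ring, abs_mul, abs_of_pos hs]
  refine mul_le_mul_of_nonneg_left ?_ hs.le
  have b1 : |(e - 1) * (X - 1)| ≤ (e - 1) * (K * Real.exp (K * K) * C) := by
    rw [abs_mul, abs_of_nonneg (by linarith : 0 ≤ e - 1)]
    exact mul_le_mul_of_nonneg_left h2' (by linarith)
  have b2 : |X * (Y - 1)| ≤ Real.exp (K * K) * (2 * C / γ * (e - 1)) := by
    rw [abs_mul, abs_of_pos hX0]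
    refine mul_le_mul h3' (hβ.trans ?_) (abs_nonneg _) he.le
    exact mul_le_mul_of_nonneg_right (by gcongr) (by linarith)
  have b3 : |e * ((r' - 1) * X)| ≤ e * (4 * P * Real.exp (K * K)) := by
    rw [abs_mul, abs_mul, abs_of_pos hX0, abs_of_pos (by linarith : 0 < e)]
    exact mul_le_mul_of_nonneg_left (mul_le_mul h1' h3' hX0.le (by linarith)) (by linarith)
  have b4 : |(r - 1) * (Y * X)| ≤ e * (4 * P * Real.exp (K * K)) := by
    rw [abs_mul, abs_of_pos (mul_pos hY0 hX0)]
    have : |r - 1| * (Y * X) ≤ 4 * P * Real.exp (K * K) :=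
      mul_le_mul h1 h3 (mul_pos hY0 hX0).le (by linarith)
    exact this.trans (le_mul_of_one_le_left (by positivity) hF1)
  have hsum : |(e - 1) * (X - 1) - X * (Y - 1) + e * ((r' - 1) * X) - (r - 1) * (Y * X)| ≤
      |(e - 1) * (X - 1)| + |X * (Y - 1)| + |e * ((r' - 1) * X)| + |(r - 1) * (Y * X)| :=
    (abs_sub _ _).trans (add_le_add_left ((abs_add_le _ _).trans
      (add_le_add_left (abs_sub _ _) _)) _)
  have rest : 0 ≤ Real.exp (K * K) * (8 * C * (e - 1) + (K + 2 / γ) * (P * e)) := by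
    have : 0 ≤ e - 1 := by linarith
    positivity
  refine hsum.trans ((add_le_add (add_le_add (add_le_add b1 b2) b3) b4).trans ?_)
  rw [← sub_nonneg]
  refine rest.trans_eq ?_
  unfold errConst
  ring

/-- Representation approach: the pathwise error bound. -/
theorem GoodSample.abs_hill_sub_le {ν : Measure ℝ} (hγ : 0 < γ) (hF0 : cdf ν 0 = 0)
    (h : GoodSample γ p b U k n K ω) (hrep : IsKaramataRep (logDF fun x => cdf ν x) γ c p b)
    {f : ℕ → ℝ} (hf : ∀ j, 1 ≤ j → 0 < f j) :
    |hillT (fun x => cdf ν x) U f k n ω / hillS (fun x => cdf ν x) U k n ω -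
      mainSum γ U f k n ω| ≤
      errConst γ K * (errC p b U k n ω * mainSum γ U f k n ω + supAbs p U k n ω *
        ∑ j ∈ Finset.Icc 1 k, f j * fStar γ U k n j ω * Real.exp (fExp γ U n j ω)) := by
  have hkn := h.lt
  rw [hillT_eq hF0 h.mem f hkn, hillS_eq hF0 h.mem h.one_le (by omega), mainSum,
    Finset.sum_div, ← Finset.sum_sub_distrib, Finset.mul_sum, Finset.mul_sum,
    ← Finset.sum_add_distrib, Finset.mul_sum]
  refine (Finset.abs_sum_le_sum_abs _ _).trans (Finset.sum_le_sum fun j hj => ?_)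
  rw [Finset.mem_Icc] at hj
  have h1 := mul_le_mul_of_nonneg_left (h.abs_increment_sub_le hγ hrep hj.1 hj.2) (hf j hj.1).le
  rw [← abs_of_pos (hf j hj.1), ← abs_mul, abs_of_pos (hf j hj.1)] at h1
  convert h1 using 1
  · congr 1
    ring
  · ring

/-- The error at `U_{j,n}` in the second order condition. -/
noncomputable def socError (G : ℝ → ℝ) (γ : ℝ) (S h : ℝ → ℝ) (u x : ℝ) : ℝ :=
  (S u)⁻¹ * ((quantile G (1 - x * u) - quantile G (1 - u)) / (γ * tailGap G u) -
    (x ^ γ - 1) / (-γ)) - h x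

/-- The increment of the gap as given by the second order condition. -/
lemma tailGap_sub_eq {G S h : ℝ → ℝ} (hγ : 0 < γ) {u x : ℝ} (hV : 0 < tailGap G u)
    (hS : S u ≠ 0) : tailGap G (x * u) - tailGap G u =
      tailGap G u * ((x ^ γ - 1) - γ * (S u * (h x + socError G γ S h u x))) := by
  have h1 : tailGap G (x * u) - tailGap G u =
      -(quantile G (1 - x * u) - quantile G (1 - u)) := by
    simp only [tailGap]
    ring
  have h2 := hV.ne'
  rw [h1, socError]
  generalize quantile G (1 - x * u) - quantile G (1 - u) = d
  field_simp
  ring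

/-- Second order approach: the pathwise error bound. -/
theorem GoodSample.abs_hill_sub_soc_le {ν : Measure ℝ} (hγ : 0 < γ) (hF0 : cdf ν 0 = 0)
    (h : GoodSample γ p b U k n K ω) (hrep : IsKaramataRep (logDF fun x => cdf ν x) γ c p b)
    {f : ℕ → ℝ} (hf : ∀ j, 1 ≤ j → 0 < f j) {S g : ℝ → ℝ} {H η : ℝ} (hH0 : 0 ≤ H) (hη0 : 0 ≤ η)
    (hS : ∀ j, 1 ≤ j → j ≤ k → S (ordU U n j ω) ≠ 0)
    (hH : ∀ j, 1 ≤ j → j ≤ k → |g (Real.exp (malmquistE U n j ω / j))| ≤ H)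
    (hη : ∀ j, 1 ≤ j → j ≤ k → |socError (logDF fun x => cdf ν x) γ S g (ordU U n j ω)
      (Real.exp (malmquistE U n j ω / j))| ≤ η) :
    |hillT (fun x => cdf ν x) U f k n ω / hillS (fun x => cdf ν x) U k n ω -
      mainSum γ U f k n ω + γ * ∑ j ∈ Finset.Icc 1 k, f j * fStar γ U k n j ω *
        (S (ordU U n j ω) * g (Real.exp (malmquistE U n j ω / j)))| ≤
      (errConst γ K * (1 + γ * H + γ * K) + γ) * (errC p b U k n ω * mainSum γ U f k n ω +
        (errC p b U k n ω + η) * ∑ j ∈ Finset.Icc 1 k,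
          f j * fStar γ U k n j ω * |S (ordU U n j ω)|) := by
  have hkn := h.lt
  have hk := h.one_le
  have hK := h.nonneg
  rw [hillT_eq hF0 h.mem f hkn, hillS_eq hF0 h.mem hk (by omega), mainSum,
    Finset.sum_div, ← Finset.sum_sub_distrib, Finset.mul_sum, ← Finset.sum_add_distrib,
    Finset.mul_sum, Finset.mul_sum, ← Finset.sum_add_distrib, Finset.mul_sum]
  refine (Finset.abs_sum_le_sum_abs _ _).trans (Finset.sum_le_sum fun j hj => ?_)
  rw [Finset.mem_Icc] at hj
  have hmj := ordU_mem h.mem hj.1 (by omega : j ≤ n)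
  have hmj1 := ordU_mem h.mem (by omega : 1 ≤ j + 1) (by omega : j + 1 ≤ n)
  have hx : Real.exp (malmquistE U n j ω / j) = ordU U n (j + 1) ω / ordU U n j ω := by
    rw [malmquistE_div hj.1, Real.exp_log (div_pos hmj1.1 hmj.1)]
  have hinc := tailGap_sub_eq (G := logDF fun x => cdf ν x) (S := S) (h := g) hγ
    (x := Real.exp (malmquistE U n j ω / j)) (h.tailGap_pos hrep hj.1 (by omega)) (hS j hj.1 hj.2)
  have hxu : Real.exp (malmquistE U n j ω / j) * ordU U n j ω = ordU U n (j + 1) ω := by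
    rw [hx, div_mul_cancel₀ _ hmj.1.ne']
  have hxγ : Real.exp (malmquistE U n j ω / j) ^ γ = Real.exp (fExp γ U n j ω) := by
    rw [exp_fExp h.mem γ hj.1 (by omega), hx]
  rw [hxu, hxγ] at hinc
  rw [hinc]
  have hw := h.abs_weight_sub_le hγ hrep hj.1 hj.2
  have hFnn := fExp_nonneg hγ h.mem hj.1 (by omega : j + 1 ≤ n)
  have hF1 : 1 ≤ Real.exp (fExp γ U n j ω) := Real.one_le_exp hFnn
  have hg := hH j hj.1 hj.2
  have hδ := hη j hj.1 hj.2
  have hfj := hf j hj.1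
  have hs := fStar_pos γ U k n j ω
  have hc := h.errC_nonneg
  have hcK := h.err_le
  have hM := errConst_nonneg hγ hK
  generalize socError _ γ S g (ordU U n j ω) (Real.exp (malmquistE U n j ω / j)) = δ at hδ ⊢
  generalize g (Real.exp (malmquistE U n j ω / j)) = q at hg ⊢
  generalize Real.exp (fExp γ U n j ω) = e at hF1 ⊢
  generalize fStar γ U k n j ω = s at hs hw ⊢
  generalize S (ordU U n j ω) = σ
  generalize errC p b U k n ω = C at hc hcK hw ⊢
  generalize errConst γ K = M at hM hw ⊢
  rw [show ∀ V Vk : ℝ, f j * (V * (e - 1 - γ * (σ * (q + δ)))) / Vk - f j * s * (e - 1) +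
      γ * (f j * s * (σ * q)) =
      f j * ((V / Vk - s) * (e - 1) - γ * ((V / Vk - s) * (σ * (q + δ))) - γ * (s * (σ * δ))) from
    fun V Vk => by ring, abs_mul, abs_of_pos hfj]
  generalize tailGap _ (ordU U n j ω) / tailGap _ (ordU U n k ω) - s = w at hw ⊢
  have b1 : |w * (e - 1)| ≤ M * C * s * (e - 1) := by
    rw [abs_mul, abs_of_nonneg (by linarith : 0 ≤ e - 1)]
    exact mul_le_mul_of_nonneg_right hw (by linarith)
  have b2 : |γ * (w * (σ * (q + δ)))| ≤ γ * (M * C * s * (|σ| * (H + η))) := by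
    rw [abs_mul, abs_mul, abs_mul, abs_of_pos hγ]
    have : |q + δ| ≤ H + η := (abs_add_le _ _).trans (add_le_add hg hδ)
    gcongr
  have b3 : |γ * (s * (σ * δ))| ≤ γ * (s * (|σ| * η)) := by
    rw [abs_mul, abs_mul, abs_mul, abs_of_pos hγ, abs_of_pos hs]
    gcongr
  have hsum : |w * (e - 1) - γ * (w * (σ * (q + δ))) - γ * (s * (σ * δ))| ≤
      |w * (e - 1)| + |γ * (w * (σ * (q + δ)))| + |γ * (s * (σ * δ))| :=
    (abs_sub _ _).trans (add_le_add_left (abs_sub _ _) _)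
  have hfin : |w * (e - 1) - γ * (w * (σ * (q + δ))) - γ * (s * (σ * δ))| ≤
      (M * (1 + γ * H + γ * K) + γ) * (C * (s * (e - 1)) + (C + η) * (s * |σ|)) := by
    refine hsum.trans ((add_le_add (add_le_add b1 b2) b3).trans ?_)
    have he : 0 ≤ e - 1 := by linarith
    have hK' : 0 ≤ M * γ * (s * |σ|) * η * (K - C) := by
      have := sub_nonneg.2 hcK
      positivity
    have rest : 0 ≤ (M * (γ * H + γ * K) + γ) * (C * (s * (e - 1))) +
        (M * (1 + γ * K) + γ) * C * (s * |σ|) + M * (1 + γ * H) * η * (s * |σ|) := by positivity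
    linarith
  refine (mul_le_mul_of_nonneg_left hfin hfj.le).trans (le_of_eq ?_)
  ring

end Bounds

/-! ### Events of large probability -/

section LargeProb

variable {Ω : Type*} [MeasurableSpace Ω] {P : Measure Ω}

/-- The events `A n` have outer probability at least `1 - ε` for all large `n`, in the sense that
the outer measure of the complement is at most `ε`; no measurability is required. -/
def WithProb (P : Measure Ω) (ε : ℝ) (A : ℕ → Ω → Prop) : Prop :=
  ∀ᶠ n in atTop, P {ω | ¬ A n ω} ≤ ENNReal.ofReal ε

lemma WithProb.and {ε₁ ε₂ : ℝ} {A B : ℕ → Ω → Prop} (hA : WithProb P ε₁ A) (hB : WithProb P ε₂ B)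
    (h₁ : 0 ≤ ε₁) (h₂ : 0 ≤ ε₂) : WithProb P (ε₁ + ε₂) fun n ω => A n ω ∧ B n ω := by
  filter_upwards [hA, hB] with n h1 h2
  rw [ENNReal.ofReal_add h₁ h₂]
  refine (measure_mono fun ω (hω : ¬ (A n ω ∧ B n ω)) => ?_).trans
    ((measure_union_le {ω | ¬ A n ω} {ω | ¬ B n ω}).trans (add_le_add h1 h2))
  by_cases h : A n ω
  · exact Or.inr fun hB => hω ⟨h, hB⟩
  · exact Or.inl h

lemma WithProb.mono {ε : ℝ} {A B : ℕ → Ω → Prop} (hA : WithProb P ε A)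
    (h : ∀ᶠ n in atTop, ∀ ω, A n ω → B n ω) : WithProb P ε B := by
  filter_upwards [hA, h] with n h1 h2
  exact (measure_mono fun ω (hω : ¬ B n ω) (hA : A n ω) => hω (h2 ω hA)).trans h1

lemma isBigOP_iff {Z w : ℕ → Ω → ℝ} : IsBigOP P Z w ↔
    ∀ ε : ℝ, 0 < ε → ∃ M : ℝ, WithProb P ε fun n ω => |Z n ω| ≤ M * w n ω := by
  simp only [IsBigOP, WithProb, not_le]

lemma isLittleOP_iff {Z : ℕ → Ω → ℝ} : IsLittleOP P Z ↔
    ∀ δ : ℝ, 0 < δ → ∀ ε : ℝ, 0 < ε → WithProb P ε fun n ω => |Z n ω| < δ := by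
  rw [IsLittleOP, tendstoInMeasure_iff_norm]
  refine forall_congr' fun δ => forall_congr' fun hδ => ?_
  simp only [sub_zero, Real.norm_eq_abs, WithProb, not_lt]
  rw [ENNReal.tendsto_atTop_zero]
  constructor
  · intro h ε hε
    obtain ⟨N, hN⟩ := h (ENNReal.ofReal ε) (by simpa using hε)
    filter_upwards [eventually_ge_atTop N] with n hn using hN n hn
  · intro h ε hε
    by_cases htop : ε = ⊤
    · exact ⟨0, fun n _ => by simp [htop]⟩
    · obtain ⟨N, hN⟩ := eventually_atTop.1 (h ε.toReal (ENNReal.toReal_pos hε.ne' htop))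
      exact ⟨N, fun n hn => by simpa [ENNReal.ofReal_toReal htop] using hN n hn⟩

lemma IsLittleOP.isBigOP_one {Z : ℕ → Ω → ℝ} (h : IsLittleOP P Z) :
    IsBigOP P Z fun _ _ => 1 :=
  isBigOP_iff.2 fun ε hε => ⟨1, (isLittleOP_iff.1 h 1 one_pos ε hε).mono
    (Eventually.of_forall fun n ω hω => by simpa using hω.le)⟩

end LargeProb

/-! ### Stochastic bounds for uniform order statistics -/

lemma lintegral_ofReal_expMeasure : ∫⁻ t, ENNReal.ofReal t ∂(expMeasure 1) = 1 := by
  rw [lintegral_expMeasure ENNReal.measurable_ofReal]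
  have h1 := Real.Gamma_eq_integral (s := 2) two_pos
  have h2 := Real.GammaIntegral_convergent (s := 2) two_pos
  rw [Real.Gamma_two] at h1
  have h3 := ofReal_integral_eq_lintegral_ofReal h2 (by
    filter_upwards [ae_restrict_mem measurableSet_Ioi] with t (ht : 0 < t)
    positivity)
  rw [← h1, ENNReal.ofReal_one] at h3
  rw [h3]
  refine setLIntegral_congr_fun measurableSet_Ioi fun t _ => ?_
  rw [← ENNReal.ofReal_mul (Real.exp_pos _).le, show (2 : ℝ) - 1 = 1 by norm_num, Real.rpow_one]

lemma expMeasure_Ioi {t : ℝ} (ht : 0 ≤ t) :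
    expMeasure 1 (Ioi t) = ENNReal.ofReal (Real.exp (-t)) := by
  have := isProbabilityMeasure_expMeasure (r := 1) one_pos
  have h1 : expMeasure 1 (Iic t) = ENNReal.ofReal (1 - Real.exp (-t)) := by
    rw [← ofReal_cdf, cdf_expMeasure_eq one_pos, if_pos ht, one_mul]
  rw [← compl_Iic, prob_compl_eq_one_sub measurableSet_Iic, h1, ← ENNReal.ofReal_one,
    ← ENNReal.ofReal_sub _ (by simpa using ht)]
  congr 1
  ring

lemma ae_forall_mem_Ioo {Ω : Type*} [MeasurableSpace Ω] {P : Measure Ω} {U : ℕ → Ω → ℝ}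
    (hUm : ∀ i, Measurable (U i))
    (hUunif : ∀ i, P.map (U i) = volume.restrict (Ioo (0 : ℝ) 1)) :
    ∀ᵐ ω ∂P, ∀ i, U i ω ∈ Ioo (0 : ℝ) 1 := by
  refine ae_all_iff.2 fun i => ae_of_ae_map (hUm i).aemeasurable ?_
  rw [hUunif i]
  exact ae_restrict_mem measurableSet_Ioo

lemma eventually_succ_le {k : ℕ → ℕ}
    (hk0 : Tendsto (fun n : ℕ => (k n : ℝ) / n) atTop (𝓝 0)) :
    ∀ᶠ n in atTop, k n + 1 ≤ n := by
  filter_upwards [hk0.eventually (eventually_lt_nhds one_pos), eventually_ge_atTop 1] with n h hn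
  have hn' : (0 : ℝ) < n := by positivity
  rw [div_lt_one hn'] at h
  exact_mod_cast h

lemma log_ordU_ratio {Ω : Type*} {U : ℕ → Ω → ℝ} {ω : Ω} {n m : ℕ}
    (hU : ∀ i, U i ω ∈ Ioo (0 : ℝ) 1) (hm : m + 1 ≤ n) :
    Real.log (ordU U n (m + 1) ω / ordU U n 1 ω) =
      ∑ j ∈ Finset.Icc 1 m, malmquistE U n j ω / j := by
  have hpos : ∀ i, 1 ≤ i → i ≤ n → ordU U n i ω ≠ 0 := fun i h1 h2 => (ordU_mem hU h1 h2).1.ne'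
  induction m with
  | zero => simp [div_self (hpos 1 le_rfl hm)]
  | succ m ih =>
    rw [Finset.sum_Icc_succ_top (by omega), ← ih (by omega), malmquistE_div (by omega),
      Real.log_div (hpos _ (by omega) hm) (hpos _ le_rfl (by omega)),
      Real.log_div (hpos _ (by omega) (by omega)) (hpos _ le_rfl (by omega)),
      Real.log_div (hpos _ (by omega) hm) (hpos _ (by omega) (by omega))]
    ring

section Tightness

variable {Ω : Type*} [MeasurableSpace Ω] {P : Measure Ω} [IsProbabilityMeasure P]
  {U : ℕ → Ω → ℝ} {k : ℕ → ℕ}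

/-- Since `k / n → 0`, the order statistic `U_{k+1,n}` tends to `0` in probability: by the law of
large numbers the proportion of the sample below `t` exceeds `(k + 1) / n`. -/
lemma withProb_ordU_le (hUm : ∀ i, Measurable (U i)) (hUind : iIndepFun U P)
    (hUunif : ∀ i, P.map (U i) = volume.restrict (Ioo (0 : ℝ) 1))
    (hk0 : Tendsto (fun n : ℕ => (k n : ℝ) / n) atTop (𝓝 0)) {t : ℝ} (ht : 0 < t) {ε : ℝ}
    (hε : 0 < ε) : WithProb P ε fun n ω => ordU U n (k n + 1) ω ≤ t := by
  set φ : ℝ → ℝ := (Iic t).indicator 1 with hφ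
  have hφm : Measurable φ := measurable_const.indicator measurableSet_Iic
  have hφb : ∀ x, ‖φ x‖ ≤ 1 := fun x => by
    by_cases hx : x ∈ Iic t <;> simp [hφ, hx]
  set m : ℝ := ∫ ω, φ (U 0 ω) ∂P with hm
  have hmpos : 0 < m := by
    have h1 : m = P.real (U 0 ⁻¹' Iic t) := by
      rw [hm, ← integral_indicator_one ((hUm 0) measurableSet_Iic)]
      rfl
    rw [h1, measureReal_def, ENNReal.toReal_pos_iff]
    refine ⟨?_, measure_lt_top _ _⟩
    rw [← Measure.map_apply (hUm 0) measurableSet_Iic, hUunif 0,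
      Measure.restrict_apply measurableSet_Iic]
    refine lt_of_lt_of_le ?_ (measure_mono
      (show Ioo 0 (min t 1) ⊆ Iic t ∩ Ioo (0 : ℝ) 1 from fun x hx =>
        ⟨hx.2.le.trans (min_le_left _ _), hx.1, hx.2.trans_le (min_le_right _ _)⟩))
    rw [Real.volume_Ioo, sub_zero, ENNReal.ofReal_pos]
    exact lt_min ht one_pos
  have hslln := strong_law_ae (fun i ω => φ (U i ω))
    (Integrable.of_bound (hφm.comp (hUm 0)).aestronglyMeasurable 1
      (Eventually.of_forall fun ω => hφb _))
    (fun i j hij => (hUind.indepFun hij).comp hφm hφm)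
    (fun i => (IdentDistrib.mk (hUm i).aemeasurable (hUm 0).aemeasurable
      ((hUunif i).trans (hUunif 0).symm)).comp hφm)
  have hmeas := tendstoInMeasure_of_tendsto_ae (fun n => (Measurable.const_smul
    (Finset.measurable_sum (Finset.range n) fun i _ => hφm.comp (hUm i))
      ((n : ℝ)⁻¹)).aestronglyMeasurable) (by
        refine hslln.mono fun ω hω => ?_
        simpa only [Pi.smul_apply, Finset.sum_apply, Function.comp_apply] using hω)
  have hdiff : IsLittleOP P fun n ω => (n : ℝ)⁻¹ • ∑ i ∈ Finset.range n, φ (U i ω) - m := by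
    rw [IsLittleOP, tendstoInMeasure_iff_norm]
    rw [tendstoInMeasure_iff_norm] at hmeas
    simpa using hmeas
  have hkm : Tendsto (fun n : ℕ => (k n + 1 : ℝ) / n) atTop (𝓝 0) := by
    have := hk0.add tendsto_one_div_atTop_nhds_zero_nat
    rw [add_zero] at this
    exact this.congr fun n => by rw [add_div]
  refine (isLittleOP_iff.1 hdiff (m / 2) (by positivity) ε hε).mono ?_
  filter_upwards [hkm.eventually (eventually_lt_nhds (half_pos hmpos)), eventually_succ_le hk0,
    eventually_ge_atTop 1] with n h1 h2 h3 ω hω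
  refine orderStat_le_of_le_card (by omega) h2 ?_
  have hcard : ∑ i ∈ Finset.range n, φ (U i ω) =
      (((Finset.range n).filter fun i => U i ω ≤ t).card : ℝ) := by
    rw [Finset.card_filter]
    push_cast
    exact Finset.sum_congr rfl fun i _ => by by_cases h : U i ω ≤ t <;> simp [hφ, h]
  have hn : (0 : ℝ) < n := by positivity
  rw [hcard, smul_eq_mul, inv_mul_eq_div, abs_lt] at hω
  have h4 : (k n + 1 : ℝ) / n < (((Finset.range n).filter fun i => U i ω ≤ t).card : ℝ) / n := by
    linarith [hω.1]
  rw [div_lt_div_iff_of_pos_right hn] at h4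
  exact_mod_cast h4.le

/-- The ratios of consecutive lower order statistics are bounded in probability, uniformly over all
of them: `P(E_j / j > K) = exp (-j K)` is summable in `j`. -/
lemma exists_withProb_malmquistE_le (hUm : ∀ i, Measurable (U i)) (hUind : iIndepFun U P)
    (hUunif : ∀ i, P.map (U i) = volume.restrict (Ioo (0 : ℝ) 1))
    (hk0 : Tendsto (fun n : ℕ => (k n : ℝ) / n) atTop (𝓝 0)) {ε : ℝ} (hε : 0 < ε) :
    ∃ K : ℝ, WithProb P ε fun n ω => ∀ j, 1 ≤ j → j ≤ k n → malmquistE U n j ω / j ≤ K := by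
  -- With `x = exp (-K)` the probability to bound is at most `∑ x ^ j ≤ 2 x`, as `x ≤ 1 / 2`.
  set x : ℝ := min (1 / 2) (ε / 2) with hx
  have hx0 : 0 < x := lt_min (by norm_num) (by positivity)
  have hx1 : x ≤ 1 / 2 := min_le_left _ _
  have hx2 : x ≤ ε / 2 := min_le_right _ _
  have hgeom : ∀ m : ℕ, ∑ j ∈ Finset.Icc 1 m, x ^ j ≤ 2 * x - 2 * x ^ (m + 1) := by
    intro m
    induction m with
    | zero => simp
    | succ m ih =>
      rw [Finset.sum_Icc_succ_top (by omega)]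
      have : 0 < x ^ (m + 1) := by positivity
      rw [pow_succ x (m + 1)]
      nlinarith
  refine ⟨-Real.log x, ?_⟩
  filter_upwards [eventually_succ_le hk0] with n hn
  have hsub : {ω | ¬ ∀ j, 1 ≤ j → j ≤ k n → malmquistE U n j ω / j ≤ -Real.log x} ⊆
      ⋃ j ∈ Finset.Icc 1 (k n), malmquistE U n j ⁻¹' Ioi (j * -Real.log x) := by
    intro ω hω
    simp only [Set.mem_ofPred_eq, not_forall, not_le] at hω
    obtain ⟨j, hj1, hjk, hlt⟩ := hω
    have hj : (0 : ℝ) < j := by positivity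
    simp only [mem_iUnion, Finset.mem_Icc, mem_preimage, mem_Ioi]
    refine ⟨j, ⟨hj1, hjk⟩, ?_⟩
    rw [lt_div_iff₀ hj] at hlt
    linarith
  refine (measure_mono hsub).trans ((measure_biUnion_finset_le _ _).trans ?_)
  have hterm : ∀ j ∈ Finset.Icc 1 (k n),
      P (malmquistE U n j ⁻¹' Ioi (j * -Real.log x)) = ENNReal.ofReal (x ^ j) := by
    intro j hj
    rw [Finset.mem_Icc] at hj
    have hmap := map_malmquistE_single hUm hUind hUunif hj.1 (by omega : j < n)
    have hae : AEMeasurable (malmquistE U n j) P := by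
      obtain ⟨m, rfl⟩ : ∃ m, n = m + 1 := ⟨n - 1, by omega⟩
      have := aemeasurable_malmquistE hUm hUind hUunif m ⟨j - 1, by omega⟩
      simpa only [show j - 1 + 1 = j by omega] using this
    rw [← Measure.map_apply_of_aemeasurable hae measurableSet_Ioi, hmap, expMeasure_Ioi]
    · congr 1
      rw [mul_neg, neg_neg, Real.exp_nat_mul, Real.exp_log hx0]
    · have : Real.log x ≤ 0 := Real.log_nonpos hx0.le (by linarith)
      exact mul_nonneg (by positivity) (by linarith)
  rw [Finset.sum_congr rfl hterm, ← ENNReal.ofReal_sum_of_nonneg fun j _ => by positivity]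
  refine ENNReal.ofReal_le_ofReal ((hgeom _).trans ?_)
  have : 0 < x ^ (k n + 1) := by positivity
  linarith

/-- The logarithmic range of the first `k + 1` order statistics is `O_P(log (k + 1))`: its mean is
the harmonic number of `k`. -/
lemma exists_withProb_log_ratio_le (hUm : ∀ i, Measurable (U i)) (hUind : iIndepFun U P)
    (hUunif : ∀ i, P.map (U i) = volume.restrict (Ioo (0 : ℝ) 1))
    (hk1 : ∀ᶠ n in atTop, 1 ≤ k n)
    (hk0 : Tendsto (fun n : ℕ => (k n : ℝ) / n) atTop (𝓝 0)) {ε : ℝ} (hε : 0 < ε) :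
    ∃ K : ℝ, WithProb P ε fun n ω => (∀ i, U i ω ∈ Ioo (0 : ℝ) 1) ∧
      Real.log (ordU U n (k n + 1) ω / ordU U n 1 ω) ≤ K * Real.log (k n + 1) := by
  refine ⟨3 / ε, ?_⟩
  filter_upwards [hk1, eventually_succ_le hk0] with n hn1 hn
  have hae : ∀ j ∈ Finset.Icc 1 (k n), AEMeasurable (malmquistE U n j) P := by
    intro j hj
    rw [Finset.mem_Icc] at hj
    obtain ⟨m, rfl⟩ : ∃ m, n = m + 1 := ⟨n - 1, by omega⟩
    have := aemeasurable_malmquistE hUm hUind hUunif m ⟨j - 1, by omega⟩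
    simpa only [show j - 1 + 1 = j by omega] using this
  set Y : Ω → ENNReal := fun ω => ∑ j ∈ Finset.Icc 1 (k n),
    ENNReal.ofReal (malmquistE U n j ω) * ENNReal.ofReal (1 / j) with hY
  have hYm : AEMeasurable Y P := by
    refine Finset.aemeasurable_fun_sum _ fun j hj => ?_
    exact (hae j hj).ennreal_ofReal.mul_const _
  have hlog0 : 0 < Real.log (k n + 1) := Real.log_pos (by
    have : (1 : ℝ) ≤ k n := by exact_mod_cast hn1
    linarith)
  have hYint : ∫⁻ ω, Y ω ∂P ≤ ENNReal.ofReal (3 * Real.log (k n + 1)) := by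
    rw [hY, lintegral_finsetSum' _ fun j hj => (hae j hj).ennreal_ofReal.mul_const _]
    have hterm : ∀ j ∈ Finset.Icc 1 (k n),
        ∫⁻ ω, ENNReal.ofReal (malmquistE U n j ω) * ENNReal.ofReal (1 / j) ∂P =
          ENNReal.ofReal (1 / j) := by
      intro j hj
      rw [lintegral_mul_const'' _ (hae j hj).ennreal_ofReal,
        ← lintegral_map' (f := ENNReal.ofReal) ENNReal.measurable_ofReal.aemeasurable (hae j hj)]
      rw [Finset.mem_Icc] at hj
      rw [map_malmquistE_single hUm hUind hUunif hj.1 (by omega), lintegral_ofReal_expMeasure,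
        one_mul]
    rw [Finset.sum_congr rfl hterm, ← ENNReal.ofReal_sum_of_nonneg fun j _ => by positivity]
    refine ENNReal.ofReal_le_ofReal ?_
    have h1 := harmonic_le_one_add_log (k n)
    rw [harmonic_eq_sum_Icc] at h1
    push_cast at h1
    simp only [one_div]
    have h2 : Real.log (k n) ≤ Real.log (k n + 1) :=
      Real.log_le_log (by exact_mod_cast hn1) (by linarith)
    have h3 : Real.log 2 ≤ Real.log (k n + 1) := by
      refine Real.log_le_log (by norm_num) ?_
      have : (1 : ℝ) ≤ k n := by exact_mod_cast hn1
      linarith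
    linarith [Real.log_two_gt_d9]
  have hmarkov := meas_ge_le_lintegral_div hYm (ε := ENNReal.ofReal (3 / ε * Real.log (k n + 1)))
    (by simp; positivity) ENNReal.ofReal_ne_top
  have hnull := ae_iff.1 (ae_forall_mem_Ioo hUm hUunif)
  refine (measure_mono (t := {ω | ¬ ∀ i, U i ω ∈ Ioo (0 : ℝ) 1} ∪
    {ω | ENNReal.ofReal (3 / ε * Real.log (k n + 1)) ≤ Y ω}) fun ω hω => ?_).trans
      ((measure_union_le _ _).trans ?_)
  · by_cases hU : ∀ i, U i ω ∈ Ioo (0 : ℝ) 1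
    · refine Or.inr ?_
      have hlt : 3 / ε * Real.log (k n + 1) <
          Real.log (ordU U n (k n + 1) ω / ordU U n 1 ω) := by
        by_contra hle
        exact hω ⟨hU, not_lt.1 hle⟩
      have hE : ∀ j ∈ Finset.Icc 1 (k n), ENNReal.ofReal (malmquistE U n j ω) *
          ENNReal.ofReal (1 / j) = ENNReal.ofReal (malmquistE U n j ω / j) := by
        intro j _
        rw [← ENNReal.ofReal_mul' (by positivity)]
        congr 1
        ring
      have hE0 : ∀ j ∈ Finset.Icc 1 (k n), 0 ≤ malmquistE U n j ω / j := by
        intro j hj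
        rw [Finset.mem_Icc] at hj
        have := fExp_nonneg (U := U) one_pos hU hj.1 (by omega : j + 1 ≤ n)
        rwa [fExp_eq 1 hj.1, mul_one, ← malmquistE_div hj.1] at this
      simp only [Set.mem_ofPred_eq, hY]
      rw [Finset.sum_congr rfl hE, ← ENNReal.ofReal_sum_of_nonneg hE0, ← log_ordU_ratio hU hn]
      exact ENNReal.ofReal_le_ofReal hlt.le
    · exact Or.inl hU
  · rw [hnull, zero_add]
    refine hmarkov.trans ((ENNReal.div_le_div_right hYint _).trans ?_)
    rw [← ENNReal.ofReal_div_of_pos (by positivity)]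
    refine ENNReal.ofReal_le_ofReal (le_of_eq ?_)
    field_simp

end Tightness

/-! ### The continuous second order condition on compact sets -/

lemma IsContSOC.eventually_ne_zero {G S h : ℝ → ℝ} {γ : ℝ} (hs : IsContSOC G γ S h) :
    ∀ᶠ u in 𝓝[>] (0 : ℝ), S u ≠ 0 := by
  rcases hs.1 with h | h <;> filter_upwards [h] with u hu
  · exact hu.ne'
  · exact hu.ne

/-- Continuous convergence to `h` makes `h` continuous and the convergence locally uniform. -/
lemma IsContSOC.locally {G S h : ℝ → ℝ} {γ : ℝ} (hs : IsContSOC G γ S h) {x : ℝ} (hx : 0 < x)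
    {ε : ℝ} (hε : 0 < ε) : (∀ᶠ y in 𝓝 x, |h y - h x| ≤ ε) ∧
      ∀ᶠ w in 𝓝[>] (0 : ℝ) ×ˢ 𝓝 x, |socError G γ S h w.1 w.2| ≤ ε := by
  have hcore : ∀ δ : ℝ, 0 < δ → (∀ᶠ y in 𝓝 x, |h y - h x| ≤ δ) ∧
      ∀ᶠ w in 𝓝[>] (0 : ℝ) ×ˢ 𝓝 x, |socError G γ S h w.1 w.2 + (h w.2 - h x)| ≤ δ := by
    intro δ hδ
    have h1 : ∀ᶠ w in 𝓝[>] (0 : ℝ) ×ˢ 𝓝 x,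
        |socError G γ S h w.1 w.2 + (h w.2 - h x)| ≤ δ := by
      filter_upwards [(hs.2 x hx).eventually (Metric.closedBall_mem_nhds (h x) hδ)] with w hw
      rw [Real.dist_eq] at hw
      refine le_of_eq_of_le ?_ hw
      congr 1
      simp only [socError]
      ring
    refine ⟨?_, h1⟩
    obtain ⟨pa, ha, pb, hb, hab⟩ := eventually_prod_iff.1 h1
    filter_upwards [hb, eventually_gt_nhds hx] with y hy hy0
    have hlim := hs.2 y hy0
    have hlim2 : Tendsto (fun u : ℝ => (u, y)) (𝓝[>] 0) (𝓝[>] (0 : ℝ) ×ˢ 𝓝 y) :=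
      tendsto_id.prodMk tendsto_const_nhds
    have h3 := ((hlim.comp hlim2).sub_const (h x)).abs
    refine le_of_tendsto h3 ?_
    filter_upwards [ha] with u hu
    refine le_of_eq_of_le ?_ (hab hu hy)
    congr 1
    simp only [socError, Function.comp_apply]
    ring
  refine ⟨(hcore ε hε).1, ?_⟩
  obtain ⟨h1, h2⟩ := hcore (ε / 2) (by positivity)
  filter_upwards [h2, tendsto_snd.eventually h1] with w hw1 hw2
  have h3 := abs_sub (socError G γ S h w.1 w.2 + (h w.2 - h x)) (h w.2 - h x)
  rw [add_sub_cancel_right] at h3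
  linarith

lemma IsContSOC.uniform {G S h : ℝ → ℝ} {γ : ℝ} (hs : IsContSOC G γ S h) {L ε : ℝ}
    (hε : 0 < ε) : ∀ᶠ u in 𝓝[>] (0 : ℝ), ∀ x ∈ Icc 1 L, |socError G γ S h u x| ≤ ε := by
  refine isCompact_Icc.induction_on
    (p := fun s => ∀ᶠ u in 𝓝[>] (0 : ℝ), ∀ x ∈ s, |socError G γ S h u x| ≤ ε) ?_ ?_ ?_ ?_
  · simp
  · exact fun s t hst ht => ht.mono fun u hu x hx => hu x (hst hx)
  · intro s t h1 h2
    filter_upwards [h1, h2] with u hu1 hu2 x hx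
    exact hx.elim (hu1 x) (hu2 x)
  · intro x hx
    obtain ⟨pa, ha, pb, hb, hab⟩ := eventually_prod_iff.1
      (hs.locally (zero_lt_one.trans_le hx.1) hε).2
    exact ⟨{y | pb y}, mem_nhdsWithin_of_mem_nhds hb, ha.mono fun u hu y hy => hab hu hy⟩

lemma IsContSOC.exists_bound {G S h : ℝ → ℝ} {γ : ℝ} (hs : IsContSOC G γ S h) (L : ℝ) :
    ∃ H : ℝ, 0 ≤ H ∧ ∀ x ∈ Icc 1 L, |h x| ≤ H := by
  have hc : ContinuousOn h (Icc 1 L) := fun x hx => by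
    refine ContinuousAt.continuousWithinAt ?_
    refine Metric.continuousAt_iff'.2 fun ε hε => ?_
    filter_upwards [(hs.locally (zero_lt_one.trans_le hx.1) (half_pos hε)).1] with y hy
    rw [Real.dist_eq]
    linarith
  obtain ⟨H, hH⟩ := isCompact_Icc.exists_bound_of_continuousOn hc
  exact ⟨max H 0, le_max_right _ _, fun x hx => (hH x hx).trans (le_max_left _ _)⟩

/-! ### The stochastic expansions -/

lemma exists_forall_le_of_tendsto {q : ℝ → ℝ} (hq : Tendsto q (𝓝[>] 0) (𝓝 0)) {δ : ℝ}
    (hδ : 0 < δ) : ∃ t : ℝ, 0 < t ∧ ∀ u, 0 < u → u ≤ t → |q u| ≤ δ := by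
  have h1 : ∀ᶠ u in 𝓝[>] (0 : ℝ), |q u| ≤ δ := by
    filter_upwards [hq.eventually (Metric.closedBall_mem_nhds 0 hδ)] with u hu
    simpa using hu
  obtain ⟨t, ht, hsub⟩ := mem_nhdsGT_iff_exists_Ioc_subset.1 h1
  exact ⟨t, ht, fun u h0 hu => hsub ⟨h0, hu⟩⟩

lemma exp_fExp_le {Ω : Type*} {U : ℕ → Ω → ℝ} {n m : ℕ} {ω : Ω} {γ : ℝ}
    (hγ : 0 < γ) {K : ℝ} (hm : 1 ≤ m)
    (h : Real.exp (malmquistE U n m ω / m) ∈ Icc 1 (Real.exp K)) :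
    Real.exp (fExp γ U n m ω) ≤ Real.exp (K * γ) := by
  rw [fExp_eq γ hm, ← malmquistE_div hm]
  exact Real.exp_le_exp.2 (mul_le_mul_of_nonneg_right (Real.exp_le_exp.1 h.2) hγ.le)

section Main

variable {Ω : Type*} [MeasurableSpace Ω] {P : Measure Ω} [IsProbabilityMeasure P]
  {U : ℕ → Ω → ℝ} {k : ℕ → ℕ} {γ : ℝ}

lemma isLittleOP_supAbs (hUm : ∀ i, Measurable (U i)) (hUind : iIndepFun U P)
    (hUunif : ∀ i, P.map (U i) = volume.restrict (Ioo (0 : ℝ) 1))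
    (hk0 : Tendsto (fun n : ℕ => (k n : ℝ) / n) atTop (𝓝 0)) {q : ℝ → ℝ}
    (hq : Tendsto q (𝓝[>] 0) (𝓝 0)) : IsLittleOP P fun n => supAbs q U (k n) n := by
  refine isLittleOP_iff.2 fun δ hδ ε hε => ?_
  obtain ⟨t, ht, hle⟩ := exists_forall_le_of_tendsto hq (half_pos hδ)
  refine (withProb_ordU_le hUm hUind hUunif hk0 ht hε).mono (Eventually.of_forall fun n ω hω => ?_)
  rw [abs_of_nonneg (supAbs_nonneg ..)]
  exact (supAbs_le (half_pos hδ).le fun u h0 hu => hle u h0 (hu.trans hω)).trans_lt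
    (half_lt_self hδ)

/-- With large probability the sample is good and all the ratios `exp (E_j / j)` are bounded. -/
lemma exists_withProb_goodSample (hγ : 0 < γ) (hUm : ∀ i, Measurable (U i))
    (hUind : iIndepFun U P) (hUunif : ∀ i, P.map (U i) = volume.restrict (Ioo (0 : ℝ) 1))
    (hk1 : ∀ᶠ n in atTop, 1 ≤ k n)
    (hk0 : Tendsto (fun n : ℕ => (k n : ℝ) / n) atTop (𝓝 0)) {p b : ℝ → ℝ}
    (hp : Tendsto p (𝓝[>] 0) (𝓝 0)) (hb : Tendsto b (𝓝[>] 0) (𝓝 0))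
    (hc : IsBigOP P (fun n => errC p b U (k n) n) fun _ _ => 1) {ε : ℝ} (hε : 0 < ε) :
    ∃ K : ℝ, 0 ≤ K ∧ WithProb P ε fun n ω => GoodSample γ p b U (k n) n K ω ∧
      ∀ j, 1 ≤ j → j ≤ k n → Real.exp (malmquistE U n j ω / j) ∈ Icc 1 (Real.exp K) := by
  obtain ⟨t₁, ht₁, hp'⟩ := exists_forall_le_of_tendsto hp (show (0 : ℝ) < 1 / 2 by norm_num)
  obtain ⟨t₂, ht₂, hb'⟩ := exists_forall_le_of_tendsto hb hγ
  have hε4 : 0 < ε / 4 := by positivity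
  obtain ⟨K₁, h1⟩ := isBigOP_iff.1 hc (ε / 4) hε4
  obtain ⟨K₂, h2⟩ := exists_withProb_malmquistE_le hUm hUind hUunif hk0 hε4
  obtain ⟨K₃, h3⟩ := exists_withProb_log_ratio_le hUm hUind hUunif hk1 hk0 hε4
  have h4 := withProb_ordU_le hUm hUind hUunif hk0 (lt_min ht₁ ht₂) hε4
  refine ⟨max (max K₁ K₂) (max K₃ 0), (le_max_right _ _).trans (le_max_right _ _), ?_⟩
  have hall := ((h1.and h2 hε4.le hε4.le).and (h3.and h4 hε4.le hε4.le) (by positivity)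
    (by positivity)).mono (B := fun n ω =>
      GoodSample γ p b U (k n) n (max (max K₁ K₂) (max K₃ 0)) ω ∧ ∀ j, 1 ≤ j → j ≤ k n →
        Real.exp (malmquistE U n j ω / j) ∈ Icc 1 (Real.exp (max (max K₁ K₂) (max K₃ 0)))) ?_
  · rwa [show ε / 4 + ε / 4 + (ε / 4 + ε / 4) = ε by ring] at hall
  filter_upwards [hk1, eventually_succ_le hk0] with n hn1 hn ω hω
  obtain ⟨⟨g1, g2⟩, ⟨gU, g3⟩, g4⟩ := hω
  have hlog : 0 ≤ Real.log ((k n : ℝ) + 1) := Real.log_nonneg (by simp)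
  refine ⟨⟨gU, hn1, hn, fun u h0 hu => hp' u h0 (hu.trans (g4.trans (min_le_left _ _))),
    fun u h0 hu => hb' u h0 (hu.trans (g4.trans (min_le_right _ _))), ?_, ?_⟩,
    fun j hj hjk => ⟨?_, ?_⟩⟩
  · refine g3.trans (mul_le_mul_of_nonneg_right ?_ hlog)
    exact (le_max_left _ _).trans (le_max_right _ _)
  · rw [mul_one] at g1
    exact (le_abs_self _).trans (g1.trans ((le_max_left _ _).trans (le_max_left _ _)))
  · refine Real.one_le_exp ?_
    have := fExp_nonneg (U := U) one_pos gU hj (by omega : j + 1 ≤ n)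
    rwa [fExp_eq 1 hj, mul_one, ← malmquistE_div hj] at this
  · exact Real.exp_le_exp.2 ((g2 j hj hjk).trans ((le_max_right _ _).trans (le_max_left _ _)))

end Main

section Expansions

variable {Ω : Type*} [MeasurableSpace Ω] {P : Measure Ω} [IsProbabilityMeasure P]
  {U : ℕ → Ω → ℝ} {k : ℕ → ℕ} {γ c : ℝ} {p b : ℝ → ℝ} {f : ℕ → ℝ} {ν : Measure ℝ}
  (hγ : 0 < γ) (hUm : ∀ i, Measurable (U i)) (hUind : iIndepFun U P)
  (hUunif : ∀ i, P.map (U i) = volume.restrict (Ioo (0 : ℝ) 1))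
  (hk1 : ∀ᶠ n in atTop, 1 ≤ k n)
  (hk0 : Tendsto (fun n : ℕ => (k n : ℝ) / n) atTop (𝓝 0)) (hF0 : cdf ν 0 = 0)
  (hf : ∀ j, 1 ≤ j → 0 < f j)
  (hrep : IsKaramataRep (logDF fun x => cdf ν x) γ c p b)
include hγ hUm hUind hUunif hk1 hk0 hF0 hf hrep

lemma isBigOP_hill_sub
    (hc : IsBigOP P (fun n => errC p b U (k n) n) fun _ _ => 1) :
    IsBigOP P
      (fun n ω => hillT (fun x => cdf ν x) U f (k n) n ω / hillS (fun x => cdf ν x) U (k n) n ω -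
        mainSum γ U f (k n) n ω)
      (fun n ω => errC p b U (k n) n ω * mainSum γ U f (k n) n ω +
        supAbs p U (k n) n ω * ∑ j ∈ Finset.Icc 1 (k n),
          f j * fStar γ U (k n) n j ω * Real.exp (fExp γ U n j ω)) := by
  refine isBigOP_iff.2 fun ε hε => ?_
  obtain ⟨K, -, hgood⟩ := exists_withProb_goodSample hγ hUm hUind hUunif hk1 hk0 hrep.tendsto_p
    hrep.tendsto_b hc hε
  exact ⟨errConst γ K, hgood.mono (Eventually.of_forall fun n ω h =>
    h.1.abs_hill_sub_le hγ hF0 hrep hf)⟩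

lemma isLittleOP_hill_sub (hfb : ∃ B : ℝ, ∀ j, 1 ≤ j → f j ≤ B)
    (hc : IsLittleOP P fun n => errC p b U (k n) n)
    (hkp : IsLittleOP P fun n ω => k n * supAbs p U (k n) n ω) :
    IsLittleOP P fun n ω =>
      hillT (fun x => cdf ν x) U f (k n) n ω / hillS (fun x => cdf ν x) U (k n) n ω -
        mainSum γ U f (k n) n ω := by
  obtain ⟨B, hB⟩ := hfb
  have hB0 : 0 < B := (hf 1 le_rfl).trans_le (hB 1 le_rfl)
  refine isLittleOP_iff.2 fun δ hδ ε hε => ?_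
  have hε3 : 0 < ε / 3 := by positivity
  obtain ⟨K, hK, hgood⟩ := exists_withProb_goodSample hγ hUm hUind hUunif hk1 hk0 hrep.tendsto_p
    hrep.tendsto_b hc.isBigOP_one hε3
  set D : ℝ := errConst γ K * (B * Real.exp (K * γ)) with hD
  have hM := errConst_nonneg hγ hK
  have hD0 : 0 ≤ D := by positivity
  have hδ' : 0 < δ / (2 * (D + 1)) := by positivity
  have hall := (hgood.and (isLittleOP_iff.1 hc _ hδ' _ hε3) hε3.le hε3.le).and
    (isLittleOP_iff.1 hkp _ hδ' _ hε3) (by positivity) hε3.le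
  rw [show ε / 3 + ε / 3 + ε / 3 = ε by ring] at hall
  refine hall.mono (Eventually.of_forall ?_)
  rintro n ω ⟨⟨⟨h, hE⟩, h1⟩, h2⟩
  have hFk := exp_fExp_le hγ h.one_le (hE _ h.one_le le_rfl)
  have hZ := (mainSum_le hγ h.mem hf hB h.one_le h.lt).trans (mul_le_mul_of_nonneg_left hFk hB0.le)
  have hS : ∑ j ∈ Finset.Icc 1 (k n), f j * fStar γ U (k n) n j ω * Real.exp (fExp γ U n j ω) ≤
      k n * (B * Real.exp (K * γ)) :=
    (sum_fStar_exp_le hγ h.mem hf hB h.lt).trans (by gcongr)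
  have hbound := h.abs_hill_sub_le hγ hF0 hrep hf
  have hc0 := h.errC_nonneg
  have hp0 := supAbs_nonneg p U (k n) n ω
  have hc1 := (le_abs_self _).trans h1.le
  have hp1 := (le_abs_self _).trans h2.le
  have e1 : errC p b U (k n) n ω * mainSum γ U f (k n) n ω ≤
      δ / (2 * (D + 1)) * (B * Real.exp (K * γ)) :=
    (mul_le_mul_of_nonneg_left hZ hc0).trans (mul_le_mul_of_nonneg_right hc1 (by positivity))
  have e2 : supAbs p U (k n) n ω * ∑ j ∈ Finset.Icc 1 (k n),
      f j * fStar γ U (k n) n j ω * Real.exp (fExp γ U n j ω) ≤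
      δ / (2 * (D + 1)) * (B * Real.exp (K * γ)) := by
    refine (mul_le_mul_of_nonneg_left hS hp0).trans ?_
    rw [← mul_assoc, mul_comm (supAbs p U (k n) n ω)]
    exact mul_le_mul_of_nonneg_right hp1 (by positivity)
  refine hbound.trans_lt ((mul_le_mul_of_nonneg_left (add_le_add e1 e2) hM).trans_lt ?_)
  rw [show errConst γ K * (δ / (2 * (D + 1)) * (B * Real.exp (K * γ)) +
    δ / (2 * (D + 1)) * (B * Real.exp (K * γ))) = δ * D / (D + 1) by rw [hD]; field_simp; ring,
    div_lt_iff₀ (by positivity)]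
  nlinarith

/-- Second order approach: with large probability the pathwise bound holds, where the error `η` is
the largest deviation in the second order condition over the first `k` order statistics. -/
lemma exists_soc_error {S h : ℝ → ℝ} (hs : IsContSOC (logDF fun x => cdf ν x) γ S h)
    (hc : IsBigOP P (fun n => errC p b U (k n) n) fun _ _ => 1) :
    ∃ η : ℕ → Ω → ℝ, (∀ n ω, 0 ≤ η n ω) ∧ IsLittleOP P η ∧
      ∀ ε : ℝ, 0 < ε → ∃ K H : ℝ, 0 ≤ K ∧ 0 ≤ H ∧ WithProb P ε fun n ω =>
        GoodSample γ p b U (k n) n K ω ∧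
        (∀ j, 1 ≤ j → j ≤ k n → Real.exp (malmquistE U n j ω / j) ∈ Icc 1 (Real.exp K)) ∧
        (∀ j, 1 ≤ j → j ≤ k n → |h (Real.exp (malmquistE U n j ω / j))| ≤ H) ∧
        |hillT (fun x => cdf ν x) U f (k n) n ω / hillS (fun x => cdf ν x) U (k n) n ω -
          mainSum γ U f (k n) n ω + γ * ∑ j ∈ Finset.Icc 1 (k n), f j * fStar γ U (k n) n j ω *
            (S (ordU U n j ω) * h (Real.exp (malmquistE U n j ω / j)))| ≤
        (errConst γ K * (1 + γ * H + γ * K) + γ) *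
          (errC p b U (k n) n ω * mainSum γ U f (k n) n ω +
          (errC p b U (k n) n ω + η n ω) * ∑ j ∈ Finset.Icc 1 (k n),
            f j * fStar γ U (k n) n j ω * |S (ordU U n j ω)|) := by
  set err : ℕ → Ω → ℕ → ℝ := fun n ω j => socError (logDF fun x => cdf ν x) γ S h (ordU U n j ω)
    (Real.exp (malmquistE U n j ω / j)) with herr
  -- A supremum over a finite set in `ℝ≥0` avoids a case distinction for an empty range of indices.
  set η : ℕ → Ω → ℝ := fun n ω => ((Finset.Icc 1 (k n)).sup fun j => ‖err n ω j‖₊ : NNReal) with hη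
  have hη0 : ∀ n ω, 0 ≤ η n ω := fun n ω => NNReal.coe_nonneg _
  have hle : ∀ n ω j, 1 ≤ j → j ≤ k n → |err n ω j| ≤ η n ω := by
    intro n ω j hj hjk
    rw [← Real.norm_eq_abs, ← coe_nnnorm]
    exact NNReal.coe_le_coe.2 (Finset.le_sup (f := fun j => ‖err n ω j‖₊)
      (Finset.mem_Icc.2 ⟨hj, hjk⟩))
  have hgoodK := fun {ε : ℝ} (hε : 0 < ε) => exists_withProb_goodSample hγ hUm hUind hUunif hk1
    hk0 hrep.tendsto_p hrep.tendsto_b hc hε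
  -- On a good sample the order statistics up to `U_{k,n}` lie in any given right neighbourhood
  -- of `0`.
  have hnear : ∀ {Q : ℝ → Prop}, (∀ᶠ u in 𝓝[>] (0 : ℝ), Q u) → ∀ {K ε : ℝ}, 0 < ε →
      (WithProb P ε fun n ω => GoodSample γ p b U (k n) n K ω ∧
        ∀ j, 1 ≤ j → j ≤ k n → Real.exp (malmquistE U n j ω / j) ∈ Icc 1 (Real.exp K)) →
      WithProb P (ε + ε) fun n ω => (GoodSample γ p b U (k n) n K ω ∧
        ∀ j, 1 ≤ j → j ≤ k n → Real.exp (malmquistE U n j ω / j) ∈ Icc 1 (Real.exp K)) ∧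
        ∀ j, 1 ≤ j → j ≤ k n → Q (ordU U n j ω) := by
    intro Q hQ K ε hε hgood
    obtain ⟨t, ht, hsub⟩ := mem_nhdsGT_iff_exists_Ioc_subset.1 hQ
    refine (hgood.and (withProb_ordU_le hUm hUind hUunif hk0 ht hε) hε.le hε.le).mono
      (Eventually.of_forall ?_)
    rintro n ω ⟨h1, h2⟩
    refine ⟨h1, fun j hj hjk => hsub ⟨?_, ?_⟩⟩
    · exact (ordU_mem h1.1.mem hj (by have := h1.1.lt; omega)).1
    · exact (ordU_mono U ω hj (by omega) h1.1.lt).trans h2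
  refine ⟨η, hη0, isLittleOP_iff.2 fun δ hδ ε hε => ?_, fun ε hε => ?_⟩
  · obtain ⟨K, hK, hgood⟩ := hgoodK (half_pos hε)
    have h1 := hnear (hs.uniform (L := Real.exp K) (half_pos hδ)) (half_pos hε) hgood
    rw [add_halves] at h1
    refine h1.mono (Eventually.of_forall ?_)
    rintro n ω ⟨⟨-, hE⟩, hQ⟩
    rw [abs_of_nonneg (hη0 n ω)]
    refine lt_of_le_of_lt ?_ (half_lt_self hδ)
    have h2 : ((Finset.Icc 1 (k n)).sup fun j => ‖err n ω j‖₊ : NNReal) ≤ (δ / 2).toNNReal := by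
      refine Finset.sup_le fun j hj => ?_
      rw [Finset.mem_Icc] at hj
      rw [← NNReal.coe_le_coe, coe_nnnorm, Real.coe_toNNReal _ (half_pos hδ).le, Real.norm_eq_abs]
      exact hQ j hj.1 hj.2 _ (hE j hj.1 hj.2)
    have h3 := NNReal.coe_le_coe.2 h2
    rwa [Real.coe_toNNReal _ (half_pos hδ).le] at h3
  · obtain ⟨K, hK, hgood⟩ := hgoodK (half_pos hε)
    obtain ⟨H, hH0, hH⟩ := hs.exists_bound (Real.exp K)
    have h1 := hnear hs.eventually_ne_zero (half_pos hε) hgood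
    rw [add_halves] at h1
    refine ⟨K, H, hK, hH0, h1.mono (Eventually.of_forall ?_)⟩
    rintro n ω ⟨⟨hg, hE⟩, hS⟩
    have hHE := fun j hj hjk => hH _ (hE j hj hjk)
    exact ⟨hg, hE, hHE, hg.abs_hill_sub_soc_le hγ hF0 hrep hf hH0 (hη0 n ω) hS hHE (hle n ω)⟩

lemma isLittleOP_hill_sub_of_soc (hfb : ∃ B : ℝ, ∀ j, 1 ≤ j → f j ≤ B) {S h : ℝ → ℝ}
    (hs : IsContSOC (logDF fun x => cdf ν x) γ S h)
    (hc : IsLittleOP P fun n => errC p b U (k n) n)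
    (hsum : IsLittleOP P fun n ω => ∑ j ∈ Finset.Icc 1 (k n), |S (ordU U n j ω)|) :
    IsLittleOP P fun n ω =>
      hillT (fun x => cdf ν x) U f (k n) n ω / hillS (fun x => cdf ν x) U (k n) n ω -
        mainSum γ U f (k n) n ω := by
  obtain ⟨B, hB⟩ := hfb
  have hB0 : 0 < B := (hf 1 le_rfl).trans_le (hB 1 le_rfl)
  obtain ⟨η, hη0, hη, hsoc⟩ := exists_soc_error hγ hUm hUind hUunif hk1 hk0 hF0 hf hrep hs
    hc.isBigOP_one
  refine isLittleOP_iff.2 fun δ hδ ε hε => ?_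
  have hε4 : 0 < ε / 4 := by positivity
  obtain ⟨K, H, hK, hH0, hgood⟩ := hsoc _ hε4
  have hM := errConst_nonneg hγ hK
  set M : ℝ := errConst γ K * (1 + γ * H + γ * K) + γ with hMdef
  have hM0 : 0 ≤ M := by positivity
  set D : ℝ := M * (B * Real.exp (K * γ)) + (M * (K + 1) + γ * H) * B with hD
  have hD0 : 0 ≤ D := by positivity
  have hδ' : 0 < δ / (D + 1) := by positivity
  have hall := ((hgood.and (isLittleOP_iff.1 hc _ hδ' _ hε4) hε4.le hε4.le).and
    ((isLittleOP_iff.1 hsum _ hδ' _ hε4).and (isLittleOP_iff.1 hη 1 one_pos _ hε4) hε4.le hε4.le)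
    (by positivity) (by positivity))
  rw [show ε / 4 + ε / 4 + (ε / 4 + ε / 4) = ε by ring] at hall
  refine hall.mono (Eventually.of_forall ?_)
  rintro n ω ⟨⟨⟨hg, hE, hHE, hbound⟩, h1⟩, h2, h3⟩
  have hFk := exp_fExp_le hγ hg.one_le (hE _ hg.one_le le_rfl)
  have hZ := (mainSum_le hγ hg.mem hf hB hg.one_le hg.lt).trans
    (mul_le_mul_of_nonneg_left hFk hB0.le)
  have hlt := hg.lt
  have hw : ∀ j ∈ Finset.Icc 1 (k n),
      0 ≤ f j * fStar γ U (k n) n j ω ∧ f j * fStar γ U (k n) n j ω ≤ B := by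
    intro j hj
    rw [Finset.mem_Icc] at hj
    have hfs := (fStar_pos γ U (k n) n j ω).le
    have hfs1 := fStar_le_one (k := k n) hγ hg.mem hj.1 (by omega : k n ≤ n)
    refine ⟨mul_nonneg (hf j hj.1).le hfs, ?_⟩
    exact (mul_le_mul (hB j hj.1) hfs1 hfs hB0.le).trans_eq (mul_one B)
  have hsS : ∑ j ∈ Finset.Icc 1 (k n), f j * fStar γ U (k n) n j ω * |S (ordU U n j ω)| ≤
      B * ∑ j ∈ Finset.Icc 1 (k n), |S (ordU U n j ω)| := by
    rw [Finset.mul_sum]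
    exact Finset.sum_le_sum fun j hj => mul_le_mul_of_nonneg_right (hw j hj).2 (abs_nonneg _)
  have hsh : |∑ j ∈ Finset.Icc 1 (k n), f j * fStar γ U (k n) n j ω *
      (S (ordU U n j ω) * h (Real.exp (malmquistE U n j ω / j)))| ≤
      H * (B * ∑ j ∈ Finset.Icc 1 (k n), |S (ordU U n j ω)|) := by
    refine (Finset.abs_sum_le_sum_abs _ _).trans ?_
    rw [Finset.mul_sum, Finset.mul_sum]
    refine Finset.sum_le_sum fun j hj => ?_
    have hj' := Finset.mem_Icc.1 hj
    rw [abs_mul, abs_of_nonneg (hw j hj).1, abs_mul]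
    calc f j * fStar γ U (k n) n j ω * (|S (ordU U n j ω)| *
          |h (Real.exp (malmquistE U n j ω / j))|) ≤ B * (|S (ordU U n j ω)| * H) := by
          refine mul_le_mul (hw j hj).2 ?_ (by positivity) hB0.le
          exact mul_le_mul_of_nonneg_left (hHE j hj'.1 hj'.2) (abs_nonneg _)
      _ = H * (B * |S (ordU U n j ω)|) := by ring
  have hs0 : 0 ≤ ∑ j ∈ Finset.Icc 1 (k n), |S (ordU U n j ω)| :=
    Finset.sum_nonneg fun j _ => abs_nonneg _
  have hsS0 : 0 ≤ ∑ j ∈ Finset.Icc 1 (k n), f j * fStar γ U (k n) n j ω * |S (ordU U n j ω)| :=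
    Finset.sum_nonneg fun j hj => mul_nonneg (hw j hj).1 (abs_nonneg _)
  have hs1 := (le_abs_self _).trans h2.le
  have hc1 := (le_abs_self _).trans h1.le
  have hη1 := (le_abs_self _).trans h3.le
  have hc0 := hg.errC_nonneg
  have hcK := hg.err_le
  have hηn := hη0 n ω
  generalize ∑ j ∈ Finset.Icc 1 (k n), f j * fStar γ U (k n) n j ω *
    (S (ordU U n j ω) * h (Real.exp (malmquistE U n j ω / j))) = A at hbound hsh
  generalize ∑ j ∈ Finset.Icc 1 (k n), f j * fStar γ U (k n) n j ω * |S (ordU U n j ω)| = A₂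
    at hbound hsS hsS0
  generalize ∑ j ∈ Finset.Icc 1 (k n), |S (ordU U n j ω)| = s at hs0 hs1 hsS hsh
  generalize hillT (fun x => cdf ν x) U f (k n) n ω / hillS (fun x => cdf ν x) U (k n) n ω -
    mainSum γ U f (k n) n ω = R at hbound ⊢
  have e0 : |R| ≤ |R + γ * A| + γ * |A| := by
    have := abs_sub (R + γ * A) (γ * A)
    rwa [add_sub_cancel_right, abs_mul γ A, abs_of_pos hγ] at this
  have e1 : errC p b U (k n) n ω * mainSum γ U f (k n) n ω ≤
      δ / (D + 1) * (B * Real.exp (K * γ)) :=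
    (mul_le_mul_of_nonneg_left hZ hc0).trans (mul_le_mul_of_nonneg_right hc1 (by positivity))
  have hBs : B * s ≤ B * (δ / (D + 1)) := mul_le_mul_of_nonneg_left hs1 hB0.le
  have e2 : (errC p b U (k n) n ω + η n ω) * A₂ ≤ (K + 1) * (B * (δ / (D + 1))) :=
    mul_le_mul (by linarith) (hsS.trans hBs) hsS0 (by positivity)
  have e3 : γ * |A| ≤ γ * (H * (B * (δ / (D + 1)))) :=
    mul_le_mul_of_nonneg_left (hsh.trans (mul_le_mul_of_nonneg_left hBs hH0)) hγ.le
  have e4 := hbound.trans (mul_le_mul_of_nonneg_left (add_le_add e1 e2) hM0)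
  refine (e0.trans (add_le_add e4 e3)).trans_lt ?_
  rw [show M * (δ / (D + 1) * (B * Real.exp (K * γ)) + (K + 1) * (B * (δ / (D + 1)))) +
    γ * (H * (B * (δ / (D + 1)))) = δ * D / (D + 1) by rw [hD]; ring, div_lt_iff₀ (by positivity)]
  nlinarith

end Expansions

end Hill

open Hill in
theorem mainTheorem2 {Ω : Type*} [MeasurableSpace Ω] (P : Measure Ω) [IsProbabilityMeasure P]
    (γ : ℝ) (hγ : 0 < γ)
    (ν : Measure ℝ) [IsProbabilityMeasure ν] (F : ℝ → ℝ) (hFν : F = fun x => cdf ν x)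
    (hF0 : F 0 = 0) (hF : InMaxDomain F (-γ))
    (U : ℕ → Ω → ℝ) (hUm : ∀ i, Measurable (U i)) (hUind : iIndepFun U P)
    (hUunif : ∀ i, P.map (U i) = volume.restrict (Ioo (0 : ℝ) 1))
    (k : ℕ → ℕ) (hk1 : ∀ᶠ n in atTop, 1 ≤ k n)
    (hk0 : Tendsto (fun n : ℕ => (k n : ℝ) / n) atTop (𝓝 0))
    (f : ℕ → ℝ) (hf : ∀ j, 1 ≤ j → 0 < f j) (hfb : ∃ B : ℝ, ∀ j, 1 ≤ j → f j ≤ B) :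
    -- for each `n`, the variables `E_1, …, E_{n-1}` are independent standard exponential
    (∀ n : ℕ, iIndepFun (fun j : Fin (n - 1) => malmquistE U n (j + 1)) P ∧
      ∀ j ∈ Finset.Ico 1 n, P.map (malmquistE U n j) = expMeasure 1) ∧
    -- `G` has a finite upper endpoint and at least one representation `(c, p, b)`
    (BddAbove {x | logDF F x < 1} ∧ ∃ c p b, IsKaramataRep (logDF F) γ c p b) ∧
    -- and for every such representation:
    ∀ (c : ℝ) (p b : ℝ → ℝ), IsKaramataRep (logDF F) γ c p b →
      IsLittleOP P (fun n => supAbs p U (k n) n) ∧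
      IsLittleOP P (fun n => supAbs b U (k n) n) ∧
      -- representation approach: error terms
      (IsBigOP P (fun n => errC p b U (k n) n) (fun _ _ => 1) →
        IsBigOP P
          (fun n ω => hillT F U f (k n) n ω / hillS F U (k n) n ω - mainSum γ U f (k n) n ω)
          (fun n ω => errC p b U (k n) n ω * mainSum γ U f (k n) n ω +
            supAbs p U (k n) n ω * ∑ j ∈ Finset.Icc 1 (k n),
              f j * fStar γ U (k n) n j ω * Real.exp (fExp γ U n j ω))) ∧
      -- representation approach: asymptotic equivalence
      (IsLittleOP P (fun n => errC p b U (k n) n) →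
        IsLittleOP P (fun n ω => k n * supAbs p U (k n) n ω) →
        IsLittleOP P
          (fun n ω => hillT F U f (k n) n ω / hillS F U (k n) n ω - mainSum γ U f (k n) n ω)) ∧
      -- second order approach
      ∀ S h : ℝ → ℝ, IsContSOC (logDF F) γ S h →
        (IsBigOP P (fun n => errC p b U (k n) n) (fun _ _ => 1) →
          ∃ η : ℕ → Ω → ℝ, (∀ n ω, 0 ≤ η n ω) ∧ IsLittleOP P η ∧
            IsBigOP P
              (fun n ω => hillT F U f (k n) n ω / hillS F U (k n) n ω - mainSum γ U f (k n) n ω +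
                γ * ∑ j ∈ Finset.Icc 1 (k n), f j * fStar γ U (k n) n j ω *
                  (S (ordU U n j ω) * h (Real.exp (malmquistE U n j ω / j))))
              (fun n ω => errC p b U (k n) n ω * mainSum γ U f (k n) n ω +
                (errC p b U (k n) n ω + η n ω) * ∑ j ∈ Finset.Icc 1 (k n),
                  f j * fStar γ U (k n) n j ω * |S (ordU U n j ω)|)) ∧
        (IsLittleOP P (fun n => errC p b U (k n) n) →
          IsLittleOP P (fun n ω => ∑ j ∈ Finset.Icc 1 (k n), |S (ordU U n j ω)|) →
          IsLittleOP P
            (fun n ω => hillT F U f (k n) n ω / hillS F U (k n) n ω -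
              mainSum γ U f (k n) n ω)) := by
  subst hFν
  obtain ⟨hbdd, hmono, hpos, hrv⟩ := tailGap_of_inMaxDomain hγ hF0 hF
  refine ⟨fun n => ⟨iIndepFun_malmquistE hUm hUind hUunif n, fun j hj => ?_⟩,
    ⟨hbdd, exists_isKaramataRep hγ hmono hpos hrv⟩, fun c p b hrep =>
    ⟨isLittleOP_supAbs hUm hUind hUunif hk0 hrep.tendsto_p,
      isLittleOP_supAbs hUm hUind hUunif hk0 hrep.tendsto_b,
      isBigOP_hill_sub hγ hUm hUind hUunif hk1 hk0 hF0 hf hrep,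
      isLittleOP_hill_sub hγ hUm hUind hUunif hk1 hk0 hF0 hf hrep hfb,
      fun S h hs => ⟨fun hc => ?_,
        isLittleOP_hill_sub_of_soc hγ hUm hUind hUunif hk1 hk0 hF0 hf hrep hfb hs⟩⟩⟩
  · rw [Finset.mem_Ico] at hj
    exact map_malmquistE_single hUm hUind hUunif hj.1 hj.2
  · obtain ⟨η, hη0, hη, hsoc⟩ := exists_soc_error hγ hUm hUind hUunif hk1 hk0 hF0 hf hrep hs hc
    refine ⟨η, hη0, hη, isBigOP_iff.2 fun ε hε => ?_⟩
    obtain ⟨K, H, -, -, hgood⟩ := hsoc ε hε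
    exact ⟨_, hgood.mono (Eventually.of_forall fun n ω h => h.2.2.2)⟩
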